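/- Let $E,F,G$ be real Banach spaces and let $\alpha$ be a uniform crossnorm, i.e. a reasonable crossnorm on $E_1\otimes E_2$ for every pair of Banach spaces such that $\|T\otimes S\|\le\|T\|\,\|S\|$ for all bounded linear $T,S$; $\widehat\otimes_\alpha$ denotes the completed tensor product. Let $(\pi_n)_{n\in\mathbb N}$ be a sequence of partitions $\{\,]t_i,t_{i+1}]: i\in\mathbb N\}$ of $\mathbb R_{\ge0}$ with $0=t_0<t_1<\cdots\to\infty$. For a path $Z$ put $\delta Z_t(]r,s])=Z_{s\wedge t}-Z_{r\wedge t}$. For a càdlàg path $Z$ put $\Delta Z_t=Z_t-Z_{t-}$ ($\Delta Z_0=0$), let $J_\varepsilon(Z)_t=\sum_{0<s\le t,\ \|\Delta Z_s\|>\varepsilon}\Delta Z_s$, and for $s>0$ let $\pi_n(s)=\,]\underline{\pi_n}(s),\overline{\pi_n}(s)]$ be the interval of $\pi_n$ containing $s$. Let $A:\mathbb R_{\ge0}\to F$ be càdlàg of finite variation (on compact intervals) and $X:\mathbb R_{\ge0}\to E$ càdlàg, and write $Z=(A,X)$. Assume that $(\pi_n)$ approximates $Z$ from the left, i.e. $Z(\underline{\pi_n}(t))\to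 Z(t-)$ for all $t>0$, and satisfies Condition (C) for $Z$: (C1) for all $t\ge0$, $\varepsilon>0$ there is $N$ such that, for all $n\ge N$ and $I\in\pi_n$, the set $\{s\in I\cap[0,t]:\|\Delta Z_s\|>\varepsilon\}$ has at most one element; (C2) $\delta Z_t(\pi_n(s))\to\Delta Z_s$ whenever $\Delta Z_s\neq0$ and $t\ge s$; (C3) $\limsup_{\varepsilon\downarrow0}\limsup_{n}\sup_{I\in\pi_n}\sup_{x,y\in I\cap[0,t]}\|(Z-J_\varepsilon(Z))_x-(Z-J_\varepsilon(Z))_y\|=0$ for all $t\ge0$. Assume that $X$ has finite 2-variation along $(\pi_n)$, i.e. $\sup_n\sum_{I\in\pi_n}\|\delta X_t(I)\|^2<\infty$ for all $t$, and that $X$ has the strong (resp. weak) $\alpha$-tensor quadratic variation ${}^\alpha[X,X]$ along $(\pi_n)$. Here the strong (resp. weak) $\alpha$-tensor quadratic variation of a path $Z$ is a càdlàg path of finite variation ${}^\alpha[Z,Z]$ in the completed $\alpha$-tensor square such that $\sum_{I\in\pi_n}\delta Z_t(I)\otimes\delta Z_t(I)\to{}^\alpha[Z,Z]_t$ in norm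 (resp. weakly) and $\Delta\,{}^\alpha[Z,Z]_t=\Delta Z_t\otimes\Delta Z_t$ for all $t\ge0$. Let $f:F\times E\to G$ be once Gâteaux differentiable in the first variable $a$ and twice Gâteaux differentiable in the second variable $x$, such that $D_af:F\times E\to\mathcal L(F,G)$ and $D_xf:F\times E\to\mathcal L(E,G)$ are continuous on every compact set, and $D_x^2f$ extends to a function $F\times E\to\mathcal L(E\widehat\otimes_\alpha E,G)$ that is continuous on every compact set. Then there are paths $Y,C,D:\mathbb R_{\ge0}\to G$ with $$f(A_t,X_t)=Y_t+C_t+D_t\qquad(t\ge0)$$ such that: (1) $Y$ is the Itô–Föllmer integral $Y_t=\int_0^tD_xf(A_{s-},X_{s-})\,\mathrm dX_s$, that is, for every $t\geq 0$, $\sum_{]r,s]\in\pi_n}D_xf(A_r,X_r)(X_{s\wedge t}-X_{r\wedge t})\to Y_t$ in norm (resp. weakly) as $n\to\infty$. The path $Y$ is càdlàg and has the strong (resp. weak) $\alpha$-tensor quadratic variation along $(\pi_n)$ given by $${}^\alpha[Y,Y]_t=\int_{]0,t]}D_xf(A_{s-},X_{s-})^{\otimes2}\,\mathrm d\,{}^\alpha[X,X]_s\qquad(t\ge0),$$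 where $D_xf(a,x)^{\otimes 2}\in\mathcal L(E\widehat\otimes_\alpha E,G\widehat\otimes_\alpha G)$ is the tensor square of the operator $D_xf(a,x)$ and the integral is a vector Stieltjes integral, whose integrand is integrable with respect to the total variation of $\mathrm d\,{}^\alpha[X,X]$ on $]0,t]$; (2) $C$ is continuous and of finite variation; (3) $D$ is càdlàg, of finite variation and purely discontinuous: $D_t=\sum_{0<s\le t}\Delta D_s$ (unconditionally convergent) for all $t\ge0$. -/

import Mathlib

open Filter Set MeasureTheory
open scoped Topology NNReal ENNReal TensorProduct

universe u v

noncomputable section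

namespace ItoFollmer

/-! ### Paths indexed by the nonnegative half-line -/

section Paths

variable {V : Type*} [NormedAddCommGroup V]

/-- A càdlàg path: right-continuous everywhere, with left limits at every `t > 0`. -/
def IsCadlag (X : ℝ≥0 → V) : Prop :=
  (∀ t, ContinuousWithinAt X (Ici t) t) ∧
    ∀ t, 0 < t → ∃ l, Tendsto X (𝓝[<] t) (𝓝 l)

/-- The jump `ΔX t = X t - X (t-)`; since `Function.leftLim X 0 = X 0`, one has `ΔX 0 = 0`. -/
def jump (X : ℝ≥0 → V) (t : ℝ≥0) : V := X t - Function.leftLim X t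

/-- Finite variation on every compact interval. -/
def HasFiniteVariation (X : ℝ≥0 → V) : Prop := LocallyBoundedVariationOn X univ

/-- `J_ε(X) t`, the (finite) sum of the jumps of norm greater than `ε` in `]0,t]`. -/
def bigJumps (ε : ℝ) (X : ℝ≥0 → V) (t : ℝ≥0) : V :=
  ∑ᶠ s ∈ {s : ℝ≥0 | 0 < s ∧ s ≤ t ∧ ε < ‖jump X s‖}, jump X s

/-- A purely discontinuous càdlàg path: it is the (unconditionally convergent) sum of its jumps,
`D t = ∑_{0 < s ≤ t} ΔD s`. -/
def IsPurelyDiscontinuous (D : ℝ≥0 → V) : Prop :=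
  IsCadlag D ∧ ∀ t, HasSum (fun s : Ioc (0 : ℝ≥0) t => jump D s) (D t)

end Paths

/-! ### Partitions -/

/-- A partition `{]t_i, t_{i+1}] ; i ∈ ℕ}` of the half-line, with
`0 = t_0 < t_1 < ⋯ → ∞`. -/
structure TimePartition where
  pt : ℕ → ℝ≥0
  pt_zero : pt 0 = 0
  strictMono : StrictMono pt
  tendsto_atTop : Tendsto pt atTop atTop

namespace TimePartition

variable {V W : Type*} [NormedAddCommGroup V] [NormedSpace ℝ V]
  [NormedAddCommGroup W] [NormedSpace ℝ W]

lemma exists_le_pt_succ (π : TimePartition) (t : ℝ≥0) : ∃ i, t ≤ π.pt (i + 1) :=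
  (((tendsto_add_atTop_iff_nat 1).2 π.tendsto_atTop).eventually_ge_atTop t).exists

open Classical in
/-- For `t > 0`, the index `i` such that `t ∈ ]t_i, t_{i+1}]`. -/
def idx (π : TimePartition) (t : ℝ≥0) : ℕ := Nat.find (π.exists_le_pt_succ t)

/-- The left endpoint of the interval of `π` that contains `t > 0`. -/
def lower (π : TimePartition) (t : ℝ≥0) : ℝ≥0 := π.pt (π.idx t)

/-- The right endpoint of the interval of `π` that contains `t > 0`. -/
def upper (π : TimePartition) (t : ℝ≥0) : ℝ≥0 := π.pt (π.idx t + 1)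

lemma mem_Ioc_lower_upper (π : TimePartition) {t : ℝ≥0} (ht : 0 < t) :
    t ∈ Ioc (π.lower t) (π.upper t) := by
  classical
  refine ⟨?_, Nat.find_spec (π.exists_le_pt_succ t)⟩
  unfold lower
  rcases h : π.idx t with _ | k
  · rw [π.pt_zero]; exact ht
  · have hk : k < Nat.find (π.exists_le_pt_succ t) := by
      change k < π.idx t
      omega
    exact lt_of_not_ge (Nat.find_min (π.exists_le_pt_succ t) hk)

/-- `δX_t(]t_i, t_{i+1}]) = X (t_{i+1} ∧ t) - X (t_i ∧ t)`. -/
def incr (π : TimePartition) (X : ℝ≥0 → V) (t : ℝ≥0) (i : ℕ) : V :=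
  X (min (π.pt (i + 1)) t) - X (min (π.pt i) t)

/-- `∑_{I ∈ π} B(δX_t(I), δX_t(I))`; only finitely many terms are nonzero. -/
def discreteQV (π : TimePartition) (B : V →L[ℝ] V →L[ℝ] W) (X : ℝ≥0 → V) (t : ℝ≥0) : W :=
  ∑' i, B (π.incr X t i) (π.incr X t i)

/-- `∑_{I ∈ π} ‖δX_t(I)‖ ^ 2`; only finitely many terms are nonzero. -/
def discreteScalarQV (π : TimePartition) (X : ℝ≥0 → V) (t : ℝ≥0) : ℝ :=
  ∑' i, ‖π.incr X t i‖ ^ 2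

/-- The left Riemann sum `∑_{]r,s] ∈ π} H_r (X_{s ∧ t} - X_{r ∧ t})`; only finitely many terms
are nonzero. -/
def leftSum (π : TimePartition) (H : ℝ≥0 → V →L[ℝ] W) (X : ℝ≥0 → V) (t : ℝ≥0) : W :=
  ∑' i, H (π.pt i) (π.incr X t i)

/-- The oscillation `O⁺_t(X, π) = sup_{I ∈ π} sup_{x, y ∈ I ∩ [0,t]} ‖X x - X y‖`. -/
def osc (π : TimePartition) (X : ℝ≥0 → V) (t : ℝ≥0) : ℝ≥0∞ :=
  ⨆ i, ⨆ x ∈ Ioc (π.pt i) (π.pt (i + 1)) ∩ Iic t,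
    ⨆ y ∈ Ioc (π.pt i) (π.pt (i + 1)) ∩ Iic t, edist (X x) (X y)

end TimePartition

section Conditions

variable {V : Type*} [NormedAddCommGroup V]

/-- Condition (C) for the path `X` along the sequence of partitions `π`. -/
structure ConditionC (π : ℕ → TimePartition) (X : ℝ≥0 → V) : Prop where
  c1 : ∀ t : ℝ≥0, ∀ ε : ℝ, 0 < ε → ∃ N, ∀ n ≥ N, ∀ i,
    (Ioc ((π n).pt i) ((π n).pt (i + 1)) ∩ Iic t ∩ {s | ε < ‖jump X s‖}).Subsingleton
  c2 : ∀ s t : ℝ≥0, jump X s ≠ 0 → s ≤ t →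
    Tendsto (fun n => X (min ((π n).upper s) t) - X (min ((π n).lower s) t)) atTop
      (𝓝 (jump X s))
  c3 : ∀ t : ℝ≥0,
    limsup (fun ε : ℝ =>
      limsup (fun n => (π n).osc (fun s => X s - bigJumps ε X s) t) atTop) (𝓝[>] 0) = 0

/-- The sequence of partitions `π` approximates `X` from the left. -/
def ApproximatesFromLeft (π : ℕ → TimePartition) (X : ℝ≥0 → V) : Prop :=
  ∀ t, 0 < t → Tendsto (fun n => X ((π n).lower t)) atTop (𝓝 (Function.leftLim X t))

/-- Finite 2-variation along `π`: `sup_n ∑_{I ∈ π_n} ‖δX_t(I)‖ ^ 2 < ∞` for all `t`. -/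
def HasFiniteTwoVariation (π : ℕ → TimePartition) (X : ℝ≥0 → V) : Prop :=
  ∀ t, BddAbove (range fun n => (π n).discreteScalarQV X t)

end Conditions

/-! ### Strong and weak convergence, quadratic variation -/

/-- The two modes of convergence in a Banach space: in norm, or weakly. -/
inductive Mode
  | strong
  | weak

/-- Convergence of a sequence in the norm topology or in the weak topology. -/
def Mode.Converges {V : Type*} [NormedAddCommGroup V] [NormedSpace ℝ V] :
    Mode → (ℕ → V) → V → Prop
  | .strong, x, l => Tendsto x atTop (𝓝 l)
  | .weak, x, l => ∀ φ : V →L[ℝ] ℝ, Tendsto (fun n => φ (x n)) atTop (𝓝 (φ l))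

/-- `Q` is the strong (resp. weak) `B`-quadratic variation of `X` along `π`. -/
structure IsQuadraticVariation {V W : Type*} [NormedAddCommGroup V] [NormedSpace ℝ V]
    [NormedAddCommGroup W] [NormedSpace ℝ W] (m : Mode) (B : V →L[ℝ] V →L[ℝ] W)
    (π : ℕ → TimePartition) (X : ℝ≥0 → V) (Q : ℝ≥0 → W) : Prop where
  cadlag : IsCadlag Q
  finiteVariation : HasFiniteVariation Q
  converges : ∀ t, m.Converges (fun n => (π n).discreteQV B X t) (Q t)
  jump_eq : ∀ t, jump Q t = B (jump X t) (jump X t)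

/-! ### Vector Stieltjes integrals -/

section Stieltjes

variable {V W : Type*} [NormedAddCommGroup V] [NormedSpace ℝ V] [CompleteSpace V]
  [NormedAddCommGroup W] [NormedSpace ℝ W]

lemma boundedVariationOn_stopped {Z : Type*} [NormedAddCommGroup Z] {Q : ℝ≥0 → Z}
    (hQ : HasFiniteVariation Q) (t : ℝ≥0) :
    BoundedVariationOn (fun s => Q (min s t)) univ := by
  have h := hQ 0 t (mem_univ _) (mem_univ _)
  refine ne_top_of_le_ne_top h ?_
  exact eVariationOn.comp_le_of_monotoneOn Q (fun s => min s t)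
    (fun a _ b _ hab => min_le_min_right t hab)
    (fun s _ => ⟨mem_univ _, zero_le, min_le_right _ _⟩)

/-- The vector measure `dQ` on `[0,t]` of a càdlàg path `Q` of finite variation: it is built from
the path stopped at `t`, and gives mass `Q b - Q a` to `]a,b]` for `a ≤ b ≤ t`. -/
def stieltjesMeasure (Q : ℝ≥0 → V) (hQ : HasFiniteVariation Q) (t : ℝ≥0) :
    VectorMeasure ℝ≥0 V :=
  (boundedVariationOn_stopped hQ t).vectorMeasure

/-- The integral `∫_{]0,t]} η_s dQ_s` of an operator-valued function `η`. -/
def stieltjesIntegral (η : ℝ≥0 → V →L[ℝ] W) (Q : ℝ≥0 → V) (hQ : HasFiniteVariation Q)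
    (t : ℝ≥0) : W :=
  ((stieltjesMeasure Q hQ t).restrict (Ioc 0 t)).integral η (ContinuousLinearMap.id ℝ (V →L[ℝ] W))

/-- Integrability of `η` over `]0,t]` with respect to the total variation of `dQ`. -/
def StieltjesIntegrable (η : ℝ≥0 → V →L[ℝ] W) (Q : ℝ≥0 → V) (hQ : HasFiniteVariation Q)
    (t : ℝ≥0) : Prop :=
  (stieltjesMeasure Q hQ t).IntegrableOn η (Ioc 0 t)

end Stieltjes

/-! ### Uniform crossnorms and completed tensor products -/

/-- A uniform crossnorm: a reasonable crossnorm on `E ⊗ F` for each pair of real Banach spaces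
(in a fixed universe) such that `‖T ⊗ S‖ ≤ ‖T‖ ‖S‖` for all bounded linear maps `T`, `S`. -/
structure UniformCrossnorm where
  /-- the norm on the algebraic tensor product -/
  nrm : ∀ (E F : Type u) [NormedAddCommGroup E] [NormedSpace ℝ E] [CompleteSpace E]
    [NormedAddCommGroup F] [NormedSpace ℝ F] [CompleteSpace F], E ⊗[ℝ] F → ℝ
  nrm_add_le : ∀ (E F : Type u) [NormedAddCommGroup E] [NormedSpace ℝ E] [CompleteSpace E]
    [NormedAddCommGroup F] [NormedSpace ℝ F] [CompleteSpace F] (z w : E ⊗[ℝ] F),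
    nrm E F (z + w) ≤ nrm E F z + nrm E F w
  nrm_smul : ∀ (E F : Type u) [NormedAddCommGroup E] [NormedSpace ℝ E] [CompleteSpace E]
    [NormedAddCommGroup F] [NormedSpace ℝ F] [CompleteSpace F] (c : ℝ) (z : E ⊗[ℝ] F),
    nrm E F (c • z) = |c| * nrm E F z
  eq_zero_of_nrm : ∀ (E F : Type u) [NormedAddCommGroup E] [NormedSpace ℝ E] [CompleteSpace E]
    [NormedAddCommGroup F] [NormedSpace ℝ F] [CompleteSpace F] (z : E ⊗[ℝ] F),
    nrm E F z = 0 → z = 0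
  /-- first half of reasonableness: `α(x ⊗ y) ≤ ‖x‖ ‖y‖` -/
  nrm_tmul_le : ∀ (E F : Type u) [NormedAddCommGroup E] [NormedSpace ℝ E] [CompleteSpace E]
    [NormedAddCommGroup F] [NormedSpace ℝ F] [CompleteSpace F] (x : E) (y : F),
    nrm E F (x ⊗ₜ[ℝ] y) ≤ ‖x‖ * ‖y‖
  /-- second half of reasonableness: `φ ⊗ ψ` is bounded with norm at most `‖φ‖ ‖ψ‖` -/
  dual_le : ∀ (E F : Type u) [NormedAddCommGroup E] [NormedSpace ℝ E] [CompleteSpace E]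
    [NormedAddCommGroup F] [NormedSpace ℝ F] [CompleteSpace F]
    (φ : E →L[ℝ] ℝ) (ψ : F →L[ℝ] ℝ) (z : E ⊗[ℝ] F),
    |LinearMap.mul' ℝ ℝ (TensorProduct.map (φ : E →ₗ[ℝ] ℝ) (ψ : F →ₗ[ℝ] ℝ) z)|
      ≤ ‖φ‖ * ‖ψ‖ * nrm E F z
  /-- uniformity -/
  nrm_map_le : ∀ (E₁ F₁ E₂ F₂ : Type u)
    [NormedAddCommGroup E₁] [NormedSpace ℝ E₁] [CompleteSpace E₁]
    [NormedAddCommGroup F₁] [NormedSpace ℝ F₁] [CompleteSpace F₁]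
    [NormedAddCommGroup E₂] [NormedSpace ℝ E₂] [CompleteSpace E₂]
    [NormedAddCommGroup F₂] [NormedSpace ℝ F₂] [CompleteSpace F₂]
    (T : E₁ →L[ℝ] E₂) (S : F₁ →L[ℝ] F₂) (z : E₁ ⊗[ℝ] F₁),
    nrm E₂ F₂ (TensorProduct.map (T : E₁ →ₗ[ℝ] E₂) (S : F₁ →ₗ[ℝ] F₂) z)
      ≤ ‖T‖ * ‖S‖ * nrm E₁ F₁ z

namespace UniformCrossnorm

variable (α : UniformCrossnorm.{u})
  (E F : Type u) [NormedAddCommGroup E] [NormedSpace ℝ E] [CompleteSpace E]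
  [NormedAddCommGroup F] [NormedSpace ℝ F] [CompleteSpace F]

/-- The algebraic tensor product `E ⊗ F`, to be normed by `α`. -/
@[nolint unusedArguments]
def AlgTensor (_α : UniformCrossnorm.{u}) (E F : Type u)
    [NormedAddCommGroup E] [NormedSpace ℝ E] [CompleteSpace E]
    [NormedAddCommGroup F] [NormedSpace ℝ F] [CompleteSpace F] : Type u := E ⊗[ℝ] F

lemma normedSpaceCore :
    letI : Norm (E ⊗[ℝ] F) := ⟨α.nrm E F⟩
    NormedSpace.Core ℝ (E ⊗[ℝ] F) := by
  let _ : Norm (E ⊗[ℝ] F) := ⟨α.nrm E F⟩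
  have h0 : α.nrm E F 0 = 0 := by
    have := α.nrm_smul E F 0 0
    simpa using this
  refine { norm_nonneg := fun z => ?_, norm_smul := fun c z => α.nrm_smul E F c z,
           norm_triangle := fun z w => α.nrm_add_le E F z w, norm_eq_zero_iff := fun z => ?_ }
  · have h1 := α.nrm_add_le E F z ((-1 : ℝ) • z)
    have h2 := α.nrm_smul E F (-1) z
    have h3 : z + (-1 : ℝ) • z = 0 := by simp
    rw [h3, h0, h2] at h1
    simp only [abs_neg, abs_one, one_mul] at h1
    change 0 ≤ α.nrm E F z
    linarith
  · exact ⟨α.eq_zero_of_nrm E F z, fun h => by subst h; exact h0⟩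

instance : NormedAddCommGroup (α.AlgTensor E F) :=
  letI : Norm (E ⊗[ℝ] F) := ⟨α.nrm E F⟩
  (NormedAddCommGroup.ofCore (𝕜 := ℝ) (α.normedSpaceCore E F) : NormedAddCommGroup (E ⊗[ℝ] F))

instance : NormedSpace ℝ (α.AlgTensor E F) :=
  letI : Norm (E ⊗[ℝ] F) := ⟨α.nrm E F⟩
  letI : NormedAddCommGroup (E ⊗[ℝ] F) := NormedAddCommGroup.ofCore (α.normedSpaceCore E F)
  (NormedSpace.ofCore (α.normedSpaceCore E F) : NormedSpace ℝ (E ⊗[ℝ] F))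

/-- The completion of `E ⊗ F` for the norm `α`. -/
abbrev Tensor : Type u := UniformSpace.Completion (α.AlgTensor E F)

/-- The algebraic bilinear map `(x, y) ↦ x ⊗ y`. -/
def algMk : E →ₗ[ℝ] F →ₗ[ℝ] α.AlgTensor E F := TensorProduct.mk ℝ E F

variable {E F}

/-- The canonical bounded bilinear map `E × F → E ⊗̂_α F`. -/
def tmul : E →L[ℝ] F →L[ℝ] α.Tensor E F :=
  LinearMap.mkContinuous₂
    ((algMk α E F).compr₂
      (UniformSpace.Completion.toComplL (𝕜 := ℝ) (E := α.AlgTensor E F)).toLinearMap) 1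
    (fun x y => by
      have h : ‖algMk α E F x y‖ ≤ ‖x‖ * ‖y‖ := α.nrm_tmul_le E F x y
      simpa using h)

lemma tmul_apply (x : E) (y : F) :
    α.tmul x y = ((algMk α E F x y : α.AlgTensor E F) : α.Tensor E F) := rfl

variable {E₂ F₂ : Type u} [NormedAddCommGroup E₂] [NormedSpace ℝ E₂] [CompleteSpace E₂]
  [NormedAddCommGroup F₂] [NormedSpace ℝ F₂] [CompleteSpace F₂]

/-- `T ⊗ S` as a bounded operator on the algebraic tensor products normed by `α`. -/
def algMap (T : E →L[ℝ] E₂) (S : F →L[ℝ] F₂) : α.AlgTensor E F →L[ℝ] α.AlgTensor E₂ F₂ :=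
  LinearMap.mkContinuous
    (TensorProduct.map (T : E →ₗ[ℝ] E₂) (S : F →ₗ[ℝ] F₂) : E ⊗[ℝ] F →ₗ[ℝ] E₂ ⊗[ℝ] F₂)
    (‖T‖ * ‖S‖) (fun z => α.nrm_map_le E F E₂ F₂ T S z)

/-- `T ⊗ S` as a bounded operator `E ⊗̂_α F → E₂ ⊗̂_α F₂`. -/
def map (T : E →L[ℝ] E₂) (S : F →L[ℝ] F₂) : α.Tensor E F →L[ℝ] α.Tensor E₂ F₂ :=
  (α.algMap T S).completion

end UniformCrossnorm

/-! ### Differentiability -/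

/-- `f` is Gâteaux differentiable at `x` with (bounded linear) Gâteaux derivative `f'`. -/
def HasGateauxDerivAt {V W : Type*} [NormedAddCommGroup V] [NormedSpace ℝ V]
    [NormedAddCommGroup W] [NormedSpace ℝ W] (f : V → W) (f' : V →L[ℝ] W) (x : V) : Prop :=
  ∀ v, HasLineDerivAt ℝ f (f' v) x v

/-- The class `C_𝒦`: the restriction to every compact set is continuous. -/
def ContinuousOnCompacts {S T : Type*} [TopologicalSpace S] [TopologicalSpace T] (g : S → T) :
    Prop :=
  ∀ K, IsCompact K → ContinuousOn g K

end ItoFollmer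

end

open ItoFollmer

/-!
The proof writes the increments of `f(Z)`, `Z = (A, X)`, over a partition interval `]r, s]` as
`D_x f(Z_r) δX + D_a f(Z_r) δA + ½ D_x² f(Z_r) (δX ⊗ δX) + ρ(Z_r, Z_s)` and sums over the intervals.
Since `f(Z_t) - f(Z_0)` telescopes, the left Riemann sums of `D_x f(Z)` against `X` converge as soon
as the other three sums do (`exists_ito_correction`). The limit is `Y = f(Z) - f(Z_0) - V`, where
`V = ∫ D_a f(Z_-) dA + ½ ∫ D_x² f(Z_-) d[X, X] + ∑ ρ(Z_{s-}, Z_s)` is càdlàg of finite variation.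
Splitting `V` into its continuous part and the sum of its jumps gives `C` and `D`.

* The two Riemann sums (`converges_sum_comp`). The mesh of the partitions need not tend to zero, so
  they detect a time `τ` only if `Z` jumps at `τ` or is not constant to the right of `τ`
  (`IsRegularTime`). At such times the right endpoint of the interval containing `τ` acts like `τ`
  for every right-continuous path that is constant where `Z` is (`ConditionC.tendsto_upper`), so the
  discrete measures converge on `[0, τ]`. Finitely many steps between regular times suffice to
  reach `t` with `Z` moving by at most `ε` on each step (`reachable_self`), so that `Φ(Z_-)` is
  uniformly close to a step function with regular steps. The masses of the finitely many steps
  converge in the given mode and the error is small in norm, which treats both modes at once.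

* The Taylor remainders (`tendsto_sum_jumpSum`). On compact sets
  `‖ρ(z, z')‖ = o(‖a' - a‖ + ‖x' - x‖²)` as `z' → z` (`exists_taylor_bounds`), and the sums of
  these weights along the partitions are bounded. Outside the finitely many intervals that contain a
  jump larger than `ε`, Condition (C3) makes the increments uniformly small, and the large jumps
  contribute `ρ(Z_{s-}, Z_s)` in the limit. The range of a càdlàg path on `[0, t]` is relatively
  compact, which is why continuity on compact sets is enough.

* The quadratic variation of `Y` (`isQuadraticVariation_integral`). The remainders
  `δY - D_x f(Z_r) δX` are absolutely summable with bounded sums, because `V` and `A` have finite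
  variation and `X` has finite 2-variation. They are values of a continuous function of the values
  of `(Z, V)` at the ends of the interval which vanishes on the diagonal and at the jumps, as
  `ΔY = D_x f(Z_-) ΔX`; hence they are uniformly small (`eventually_forall_norm_le`). Here `V` is
  constant where `Z` is, so the partitions see `(Z, V)` as they see `Z`. So `∑ δY ⊗ δY` has the same
  limit as `∑ D_x f(Z_r)^{⊗2} (δX ⊗ δX)`, which is again a Riemann sum against `[X, X]`.
-/

noncomputable section

namespace ItoFollmer

/-! ### The Stieltjes measure of a càdlàg path of finite variation -/

lemma measurableSpace_eq_generateFrom_Ioc : (inferInstance : MeasurableSpace ℝ≥0) =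
    MeasurableSpace.generateFrom {s | ∃ u v : ℝ≥0, u ≤ v ∧ s = Ioc u v} := by
  have : (inferInstance : MeasurableSpace ℝ≥0) = borel ℝ≥0 := BorelSpace.measurable_eq
  rw [this]
  convert! borel_eq_generateFrom_Ioc_le ℝ≥0 using 2
  grind only

/-- A vector measure on the half-line is determined by its values on `{0}` and on the half-open
intervals. -/
lemma vectorMeasure_ext_of_Ioc {V : Type*} [NormedAddCommGroup V] {μ ν : VectorMeasure ℝ≥0 V}
    (h0 : μ {0} = ν {0}) (h : ∀ a b : ℝ≥0, a ≤ b → μ (Ioc a b) = ν (Ioc a b)) : μ = ν := by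
  refine VectorMeasure.ext_of_generateFrom _ ?_ measurableSpace_eq_generateFrom_Ioc
    IsSetSemiring.Ioc.isPiSystem ?_
  · rintro s ⟨a, b, hab, rfl⟩
    exact h a b hab
  · have hU : (univ : Set ℝ≥0) = {0} ∪ ⋃ n : ℕ, Ioc 0 (n : ℝ≥0) := by
      ext x
      simp only [mem_univ, singleton_union, mem_insert_iff, mem_iUnion, mem_Ioc, true_iff]
      rcases eq_or_ne x 0 with hx | hx
      · exact Or.inl hx
      · obtain ⟨n, hn⟩ := exists_nat_ge x
        exact Or.inr ⟨n, pos_iff_ne_zero.2 hx, hn⟩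
    have hdisj : Disjoint ({0} : Set ℝ≥0) (⋃ n : ℕ, Ioc 0 (n : ℝ≥0)) := by
      simp
    have hmeas : MeasurableSet (⋃ n : ℕ, Ioc 0 (n : ℝ≥0)) :=
      MeasurableSet.iUnion fun n => measurableSet_Ioc
    rw [hU, VectorMeasure.of_union hdisj (measurableSet_singleton _) hmeas,
      VectorMeasure.of_union hdisj (measurableSet_singleton _) hmeas, h0]
    congr 1
    have key : ∀ ρ : VectorMeasure ℝ≥0 V, Tendsto (fun n : ℕ => ρ (Ioc 0 (n : ℝ≥0))) atTop
        (𝓝 (ρ (⋃ n : ℕ, Ioc 0 (n : ℝ≥0)))) := fun ρ =>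
      ρ.tendsto_vectorMeasure_iUnion_atTop_nat
        (fun i j hij => Ioc_subset_Ioc_right (by exact_mod_cast hij)) fun n => measurableSet_Ioc
    exact tendsto_nhds_unique (key μ) ((key ν).congr fun n => (h _ _ zero_le).symm)

section Variation

variable {V : Type*} [NormedAddCommGroup V]

/-- The total variation of a path on `[0, t]`. -/
def pathVariation (Q : ℝ≥0 → V) (t : ℝ≥0) : ℝ := variationOnFromTo Q univ 0 t

lemma pathVariation_zero (Q : ℝ≥0 → V) : pathVariation Q 0 = 0 := variationOnFromTo.self ..

variable {Q : ℝ≥0 → V}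

lemma HasFiniteVariation.monotone_pathVariation (hQ : HasFiniteVariation Q) :
    Monotone (pathVariation Q) := fun a b hab =>
  variationOnFromTo.monotoneOn hQ (mem_univ 0) (mem_univ a) (mem_univ b) hab

lemma HasFiniteVariation.pathVariation_nonneg (hQ : HasFiniteVariation Q) (t : ℝ≥0) :
    0 ≤ pathVariation Q t := by
  rw [← pathVariation_zero Q]; exact hQ.monotone_pathVariation zero_le

lemma HasFiniteVariation.norm_sub_le (hQ : HasFiniteVariation Q) {a b : ℝ≥0} (hab : a ≤ b) :
    ‖Q b - Q a‖ ≤ pathVariation Q b - pathVariation Q a := by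
  have h : pathVariation Q b - pathVariation Q a = variationOnFromTo Q univ a b := by
    have := variationOnFromTo.add hQ (mem_univ 0) (mem_univ a) (mem_univ b)
    unfold pathVariation; linarith
  rw [h, variationOnFromTo.eq_of_le _ _ hab, ← dist_eq_norm, dist_edist]
  refine ENNReal.toReal_mono (hQ a b (mem_univ _) (mem_univ _)) (eVariationOn.edist_le _ ?_ ?_)
  · exact ⟨mem_univ _, hab, le_rfl⟩
  · exact ⟨mem_univ _, le_rfl, hab⟩

/-- A path whose increments are dominated by those of a monotone function has finite variation. -/
lemma hasFiniteVariation_of_norm_sub_le {g : ℝ≥0 → ℝ} (hg : Monotone g)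
    (h : ∀ a b, a ≤ b → ‖Q b - Q a‖ ≤ g b - g a) : HasFiniteVariation Q := by
  intro a b _ _
  have hgv := (hg.monotoneOn univ).locallyBoundedVariationOn a b (mem_univ _) (mem_univ _)
  refine ne_top_of_le_ne_top hgv ?_
  refine iSup_le fun p => ?_
  refine le_trans (Finset.sum_le_sum fun i _ => ?_) (eVariationOn.sum_le p.2.2.1 p.2.2.2)
  have h1 := h _ _ (p.2.2.1 (Nat.le_succ i))
  rw [edist_dist, edist_dist]
  refine ENNReal.ofReal_le_ofReal ?_
  rw [dist_eq_norm, Real.dist_eq]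
  exact h1.trans (le_abs_self _)

/-- The variation function of a right-continuous path is right-continuous. -/
lemma HasFiniteVariation.continuousWithinAt_pathVariation (hQ : HasFiniteVariation Q) {t : ℝ≥0}
    (ht : ContinuousWithinAt Q (Ici t) t) : ContinuousWithinAt (pathVariation Q) (Ici t) t := by
  have hlim : Tendsto Q (𝓝[univ ∩ Ioi t] t) (𝓝 (Q t)) := by
    rw [univ_inter]
    exact ht.tendsto.mono_left (nhdsWithin_mono _ Ioi_subset_Ici_self)
  have h := variationOnFromTo.tendsto_right (mem_univ (0 : ℝ≥0)) (mem_univ t) hQ hlim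
  rw [univ_inter, dist_self, add_zero] at h
  rw [← continuousWithinAt_Ioi_iff_Ici]
  exact h

end Variation

lemma continuousWithinAt_stopped {S : Type*} [TopologicalSpace S] {X : ℝ≥0 → S} {s t : ℝ≥0}
    (hX : ∀ s, ContinuousWithinAt X (Ici s) s) :
    ContinuousWithinAt (fun s => X (min s t)) (Ici s) s := by
  have h1 : ContinuousWithinAt (fun s : ℝ≥0 => min s t) (Ici s) s :=
    (continuous_id.min continuous_const).continuousWithinAt
  have h2 : MapsTo (fun s : ℝ≥0 => min s t) (Ici s) (Ici (min s t)) :=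
    fun x hx => min_le_min_right t hx
  exact (hX (min s t)).comp (f := fun s : ℝ≥0 => min s t) (x := s) h1 h2

lemma rightLim_stopped {S : Type*} [TopologicalSpace S] [T2Space S] {X : ℝ≥0 → S} {s t : ℝ≥0}
    (hX : ∀ s, ContinuousWithinAt X (Ici s) s) :
    Function.rightLim (fun s => X (min s t)) s = X (min s t) :=
  (continuousWithinAt_stopped hX).rightLim_eq

section StieltjesMeasure

variable {V W : Type*} [NormedAddCommGroup V] [CompleteSpace V] [NormedAddCommGroup W]
  [NormedSpace ℝ W] {Q : ℝ≥0 → V}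

lemma stieltjesMeasure_Ioc (hc : ∀ s, ContinuousWithinAt Q (Ici s) s)
    (hQ : HasFiniteVariation Q) (t : ℝ≥0) {a b : ℝ≥0} (hab : a ≤ b) :
    stieltjesMeasure Q hQ t (Ioc a b) = Q (min b t) - Q (min a t) := by
  unfold stieltjesMeasure
  rw [BoundedVariationOn.vectorMeasure_Ioc _ hab, rightLim_stopped hc, rightLim_stopped hc]

lemma stieltjesMeasure_singleton_zero (hc : ∀ s, ContinuousWithinAt Q (Ici s) s)
    (hQ : HasFiniteVariation Q) (t : ℝ≥0) : stieltjesMeasure Q hQ t {0} = 0 := by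
  unfold stieltjesMeasure
  rw [BoundedVariationOn.vectorMeasure_singleton, rightLim_stopped hc,
    leftLim_eq_of_isBot (a := (0 : ℝ≥0)) isBot_bot]
  simp

/-- Stopping earlier amounts to restricting the Stieltjes measure. -/
lemma stieltjesMeasure_eq_restrict (hc : ∀ s, ContinuousWithinAt Q (Ici s) s)
    (hQ : HasFiniteVariation Q) {s t : ℝ≥0} (hst : s ≤ t) :
    stieltjesMeasure Q hQ s = (stieltjesMeasure Q hQ t).restrict (Ioc 0 s) := by
  refine vectorMeasure_ext_of_Ioc ?_ fun a b hab => ?_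
  · rw [stieltjesMeasure_singleton_zero hc,
      VectorMeasure.restrict_apply _ measurableSet_Ioc (measurableSet_singleton _)]
    have : ({0} : Set ℝ≥0) ∩ Ioc 0 s = ∅ := by ext x; simp
    simp [this]
  · rw [stieltjesMeasure_Ioc hc hQ s hab,
      VectorMeasure.restrict_apply _ measurableSet_Ioc measurableSet_Ioc, Ioc_inter_Ioc,
      sup_of_le_left zero_le]
    rcases le_total a s with has | has
    · rw [stieltjesMeasure_Ioc hc hQ t (le_inf hab has)]
      have h1 : min (b ⊓ s) t = min b s := by
        rw [min_eq_left ((min_le_right b s).trans hst)]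
      rw [h1, min_eq_left has, min_eq_left (has.trans hst)]
    · rw [Ioc_eq_empty (not_lt.2 ((min_le_right b s).trans has)), min_eq_right (has.trans hab),
        min_eq_right has]
      simp

/-- The total variation measure of the Stieltjes measure is dominated on intervals by the
increments of the variation function. -/
lemma variation_stieltjesMeasure_Ioc_le (hc : ∀ s, ContinuousWithinAt Q (Ici s) s)
    (hQ : HasFiniteVariation Q) (t : ℝ≥0) :
    IsFiniteMeasure (stieltjesMeasure Q hQ t).variation ∧
    ∀ a b : ℝ≥0, a ≤ b → b ≤ t → (stieltjesMeasure Q hQ t).variation.real (Ioc a b) ≤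
      pathVariation Q b - pathVariation Q a := by
  let g : StieltjesFunction ℝ≥0 :=
    { toFun := fun x => pathVariation Q (min x t)
      mono' := fun a b hab => hQ.monotone_pathVariation (min_le_min_right t hab)
      right_continuous' := fun x =>
        continuousWithinAt_stopped fun s => hQ.continuousWithinAt_pathVariation (hc s) }
  have hgdef : ∀ x, g x = pathVariation Q (min x t) := fun _ => rfl
  have hfin : IsFiniteMeasure g.measure := by
    refine g.isFiniteMeasure_of_forall_abs_le (C := pathVariation Q t) fun x => ?_
    rw [hgdef, abs_of_nonneg (hQ.pathVariation_nonneg _)]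
    exact hQ.monotone_pathVariation (min_le_right _ _)
  obtain ⟨ν, hν, hνg⟩ :=
    VectorMeasure.exists_extension_of_isSetSemiring_of_le_measure_of_generateFrom
      (μ := g.measure) (m := AddContent.onIoc fun s => Q (min s t)) IsSetSemiring.Ioc
      (by
        rintro s ⟨a, b, hab, rfl⟩
        rw [AddContent.onIoc_apply hab, g.measure_Ioc, hgdef, hgdef, ← ofReal_norm]
        exact ENNReal.ofReal_le_ofReal (hQ.norm_sub_le (min_le_min_right t hab)))
      measurableSpace_eq_generateFrom_Ioc
  have heq : stieltjesMeasure Q hQ t = ν := by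
    refine vectorMeasure_ext_of_Ioc ?_ fun a b hab => ?_
    · rw [stieltjesMeasure_singleton_zero hc, eq_comm, ← enorm_eq_zero, ← nonpos_iff_eq_zero]
      refine (hνg _).trans ?_
      rw [← botSet_eq_singleton_of_isBot (x := (0 : ℝ≥0)) isBot_bot, g.measure_botSet]
    · rw [stieltjesMeasure_Ioc hc hQ t hab, hν _ ⟨a, b, hab, rfl⟩, AddContent.onIoc_apply hab]
  have hle : (stieltjesMeasure Q hQ t).variation ≤ g.measure := by
    rw [heq]
    exact VectorMeasure.variation_le_of_forall_enorm_le fun s _ => hνg s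
  refine ⟨isFiniteMeasure_of_le _ hle, fun a b hab hbt => ?_⟩
  have h1 : g.measure (Ioc a b) = ENNReal.ofReal (pathVariation Q b - pathVariation Q a) := by
    rw [g.measure_Ioc, hgdef, hgdef, min_eq_left hbt, min_eq_left (hab.trans hbt)]
  refine ENNReal.toReal_le_of_le_ofReal ?_ ((hle _).trans_eq h1)
  exact sub_nonneg.2 (hQ.monotone_pathVariation hab)

variable [NormedSpace ℝ V]

lemma stieltjesIntegrable_of_bound (hc : ∀ s, ContinuousWithinAt Q (Ici s) s)
    (hQ : HasFiniteVariation Q) {η : ℝ≥0 → V →L[ℝ] W} {t : ℝ≥0} {M : ℝ}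
    (hη : StronglyMeasurable ((Ioc 0 t).indicator η)) (hM : ∀ s ∈ Ioc 0 t, ‖η s‖ ≤ M) :
    StieltjesIntegrable η Q hQ t := by
  have := (variation_stieltjesMeasure_Ioc_le hc hQ t).1
  unfold StieltjesIntegrable
  rw [VectorMeasure.IntegrableOn, VectorMeasure.Integrable,
    VectorMeasure.variation_restrict measurableSet_Ioc]
  refine Integrable.of_bound (C := M) ?_ ?_
  · exact (aestronglyMeasurable_indicator_iff measurableSet_Ioc).1 hη.aestronglyMeasurable
  · exact (ae_restrict_iff' measurableSet_Ioc).2 (Eventually.of_forall hM)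

/-- If `η` is within `K` of the constant operator `c` on `]a, b]`, then the integral of `η` over
`]a, b]` is within `K` times the variation of `Q` of `c (Q b - Q a)`. -/
lemma norm_stieltjesIntegral_sub_le [CompleteSpace W] (hc : ∀ s, ContinuousWithinAt Q (Ici s) s)
    (hQ : HasFiniteVariation Q) {η : ℝ≥0 → V →L[ℝ] W}
    (hη : ∀ t, StieltjesIntegrable η Q hQ t) {a b : ℝ≥0} (hab : a ≤ b) (c : V →L[ℝ] W) {K : ℝ}
    (hK : 0 ≤ K) (h : ∀ s ∈ Ioc a b, ‖η s - c‖ ≤ K) :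
    ‖stieltjesIntegral η Q hQ b - stieltjesIntegral η Q hQ a - c (Q b - Q a)‖ ≤
      K * (pathVariation Q b - pathVariation Q a) := by
  obtain ⟨hfin, hvar⟩ := variation_stieltjesMeasure_Ioc_le hc hQ b
  set μ := stieltjesMeasure Q hQ b with hμ
  have ha : stieltjesIntegral η Q hQ a =
      (μ.restrict (Ioc 0 a)).integral η (ContinuousLinearMap.id ℝ (V →L[ℝ] W)) := by
    unfold stieltjesIntegral
    rw [stieltjesMeasure_eq_restrict hc hQ hab, ← hμ,
      VectorMeasure.restrict_restrict _ measurableSet_Ioc measurableSet_Ioc, inter_self]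
  have hib : μ.IntegrableOn η (Ioc 0 b) := hη b
  have hdiff : Ioc (0 : ℝ≥0) b \ Ioc 0 a = Ioc a b := by
    ext x
    simp only [Set.mem_sdiff, mem_Ioc, not_and, not_le]
    exact ⟨fun h => ⟨h.2 h.1.1, h.1.2⟩, fun h => ⟨⟨zero_le.trans_lt h.1, h.2⟩, fun _ => h.1⟩⟩
  have hsub := VectorMeasure.setIntegral_sdiff (B := ContinuousLinearMap.id ℝ (V →L[ℝ] W))
    (measurableSet_Ioc (a := (0 : ℝ≥0)) (b := b)) (measurableSet_Ioc (a := (0 : ℝ≥0)) (b := a)) hib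
    (Ioc_subset_Ioc_right hab)
  rw [hdiff] at hsub
  have hiab : μ.IntegrableOn η (Ioc a b) :=
    hib.mono measurableSet_Ioc (Ioc_subset_Ioc_left zero_le)
  have hconst : (μ.restrict (Ioc a b)).integral (fun _ => c)
      (ContinuousLinearMap.id ℝ (V →L[ℝ] W)) = c (Q b - Q a) := by
    rw [VectorMeasure.setIntegral_const, stieltjesMeasure_Ioc hc hQ b hab, min_self,
      min_eq_left hab]
    rfl
  have hfin2 : IsFiniteMeasure (μ.restrict (Ioc a b)).variation := by
    rw [VectorMeasure.variation_restrict measurableSet_Ioc]; infer_instance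
  have hic : (μ.restrict (Ioc a b)).Integrable (fun _ => c) := integrable_const c
  rw [ha, show stieltjesIntegral η Q hQ b = (μ.restrict (Ioc 0 b)).integral η
    (ContinuousLinearMap.id ℝ (V →L[ℝ] W)) from rfl, ← hsub, ← hconst,
    ← VectorMeasure.integral_sub hiab hic]
  refine (VectorMeasure.norm_setIntegral_le_of_norm_le_const h).trans ?_
  have h1 : ‖ContinuousLinearMap.id ℝ (V →L[ℝ] W)‖ ≤ 1 := ContinuousLinearMap.norm_id_le
  calc K * ‖ContinuousLinearMap.id ℝ (V →L[ℝ] W)‖ * μ.variation.real (Ioc a b)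
      ≤ K * 1 * μ.variation.real (Ioc a b) := by gcongr
    _ = K * μ.variation.real (Ioc a b) := by ring
    _ ≤ _ := by gcongr; exact hvar a b hab le_rfl

lemma stieltjesIntegral_zero (hQ : HasFiniteVariation Q) (η : ℝ≥0 → V →L[ℝ] W) :
    stieltjesIntegral η Q hQ 0 = 0 := by
  unfold stieltjesIntegral
  simp

end StieltjesMeasure

/-! ### Càdlàg paths -/

lemma nhdsLT_neBot {t : ℝ≥0} (ht : 0 < t) : (𝓝[<] t).NeBot := nhdsLT_neBot_of_exists_lt ⟨0, ht⟩

section Cadlag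

variable {V W : Type*} [NormedAddCommGroup V] [NormedAddCommGroup W]
  {X : ℝ≥0 → V} {Y : ℝ≥0 → W}

lemma IsCadlag.tendsto_leftLim (hX : IsCadlag X) (t : ℝ≥0) :
    Tendsto X (𝓝[<] t) (𝓝 (Function.leftLim X t)) := by
  rcases eq_or_ne t 0 with rfl | ht
  · simp
  · exact tendsto_leftLim_of_tendsto (hX.2 t (pos_iff_ne_zero.2 ht))

lemma leftLim_eq {t : ℝ≥0} (ht : 0 < t) {l : V} (h : Tendsto X (𝓝[<] t) (𝓝 l)) :
    Function.leftLim X t = l :=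
  have := nhdsLT_neBot ht
  leftLim_eq_of_tendsto h

lemma leftLim_zero (X : ℝ≥0 → V) : Function.leftLim X 0 = X 0 :=
  leftLim_eq_of_isBot (a := (0 : ℝ≥0)) isBot_bot

lemma jump_zero (X : ℝ≥0 → V) : jump X 0 = 0 := by simp [jump, leftLim_zero]

lemma IsCadlag.prodMk (hX : IsCadlag X) (hY : IsCadlag Y) : IsCadlag fun t => (X t, Y t) :=
  ⟨fun t => (hX.1 t).prodMk (hY.1 t), fun t ht =>
    let ⟨l, hl⟩ := hX.2 t ht
    let ⟨m, hm⟩ := hY.2 t ht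
    ⟨(l, m), hl.prodMk_nhds hm⟩⟩

lemma leftLim_prodMk (hX : IsCadlag X) (hY : IsCadlag Y) (t : ℝ≥0) :
    Function.leftLim (fun t => (X t, Y t)) t = (Function.leftLim X t, Function.leftLim Y t) := by
  rcases eq_or_ne t 0 with rfl | ht
  · simp only [leftLim_zero]
  · exact leftLim_eq (pos_iff_ne_zero.2 ht)
      ((hX.tendsto_leftLim t).prodMk_nhds (hY.tendsto_leftLim t))

lemma jump_prodMk (hX : IsCadlag X) (hY : IsCadlag Y) (t : ℝ≥0) :
    jump (fun t => (X t, Y t)) t = (jump X t, jump Y t) := by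
  simp [jump, leftLim_prodMk hX hY]

lemma IsCadlag.add {X' : ℝ≥0 → V} (hX : IsCadlag X) (hX' : IsCadlag X') :
    IsCadlag fun t => X t + X' t :=
  ⟨fun t => (hX.1 t).add (hX'.1 t), fun _ _ =>
    ⟨_, (hX.tendsto_leftLim _).add (hX'.tendsto_leftLim _)⟩⟩

lemma IsCadlag.sub {X' : ℝ≥0 → V} (hX : IsCadlag X) (hX' : IsCadlag X') :
    IsCadlag fun t => X t - X' t :=
  ⟨fun t => (hX.1 t).sub (hX'.1 t), fun _ _ =>
    ⟨_, (hX.tendsto_leftLim _).sub (hX'.tendsto_leftLim _)⟩⟩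

lemma IsCadlag.const_smul [NormedSpace ℝ V] (hX : IsCadlag X) (c : ℝ) :
    IsCadlag fun t => c • X t :=
  ⟨fun t => (hX.1 t).const_smul c, fun _ _ => ⟨_, (hX.tendsto_leftLim _).const_smul c⟩⟩

lemma isCadlag_const (c : V) : IsCadlag fun _ => c :=
  ⟨fun _ => continuousWithinAt_const, fun _ _ => ⟨c, tendsto_const_nhds⟩⟩

lemma jump_eq_sub {t : ℝ≥0} (ht : 0 < t) {l : V} (h : Tendsto X (𝓝[<] t) (𝓝 l)) :
    jump X t = X t - l := by
  rw [jump, leftLim_eq ht h]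

lemma jump_add {X' : ℝ≥0 → V} (hX : IsCadlag X) (hX' : IsCadlag X') (t : ℝ≥0) :
    jump (fun t => X t + X' t) t = jump X t + jump X' t := by
  rcases eq_or_ne t 0 with rfl | ht
  · simp [jump_zero]
  · rw [jump_eq_sub (pos_iff_ne_zero.2 ht) ((hX.tendsto_leftLim t).add (hX'.tendsto_leftLim t)),
      jump, jump]
    abel

lemma jump_sub {X' : ℝ≥0 → V} (hX : IsCadlag X) (hX' : IsCadlag X') (t : ℝ≥0) :
    jump (fun t => X t - X' t) t = jump X t - jump X' t := by
  rcases eq_or_ne t 0 with rfl | ht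
  · simp [jump_zero]
  · rw [jump_eq_sub (pos_iff_ne_zero.2 ht) ((hX.tendsto_leftLim t).sub (hX'.tendsto_leftLim t)),
      jump, jump]
    abel

lemma jump_const (c : V) (t : ℝ≥0) : jump (fun _ => c) t = 0 := by
  rcases eq_or_ne t 0 with rfl | ht
  · simp [jump_zero]
  · rw [jump_eq_sub (pos_iff_ne_zero.2 ht) tendsto_const_nhds, sub_self]

lemma jump_const_smul [NormedSpace ℝ V] (hX : IsCadlag X) (c : ℝ) (t : ℝ≥0) :
    jump (fun t => c • X t) t = c • jump X t := by
  rcases eq_or_ne t 0 with rfl | ht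
  · simp [jump_zero]
  · rw [jump_eq_sub (pos_iff_ne_zero.2 ht) ((hX.tendsto_leftLim t).const_smul c), jump, smul_sub]

/-- A càdlàg path without jumps is continuous. -/
lemma IsCadlag.continuous (hX : IsCadlag X) (h : ∀ t, jump X t = 0) : Continuous X := by
  refine continuous_iff_continuousAt.2 fun t => ?_
  have hl : ContinuousWithinAt X (Iic t) t := by
    rw [← continuousWithinAt_Iio_iff_Iic]
    have := hX.tendsto_leftLim t
    rwa [← sub_eq_zero.1 (h t)] at this
  exact continuousAt_iff_continuous_left_right.2 ⟨hl, hX.1 t⟩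

/-- On compact intervals the range of a càdlàg path is relatively compact. -/
lemma IsCadlag.isCompact_closure_image [CompleteSpace V] (hX : IsCadlag X) (t : ℝ≥0) :
    IsCompact (closure (X '' Iic t)) := by
  have hT : TotallyBounded (X '' Iic t) := by
    rw [Metric.totallyBounded_iff]
    intro ε hε
    have hI : IsCompact (Iic t) := by
      have : Iic t = Icc 0 t := by ext; simp
      rw [this]; exact isCompact_Icc
    refine hI.induction_on
      (p := fun S => ∃ T : Set V, T.Finite ∧ X '' S ⊆ ⋃ y ∈ T, Metric.ball y ε) ?_ ?_ ?_ ?_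
    · exact ⟨∅, finite_empty, by simp⟩
    · rintro S S' hS ⟨T, hT, h⟩
      exact ⟨T, hT, (image_mono hS).trans h⟩
    · rintro S S' ⟨T, hT, h⟩ ⟨T', hT', h'⟩
      refine ⟨T ∪ T', hT.union hT', ?_⟩
      rw [image_union, biUnion_union]
      exact union_subset_union h h'
    · intro x _
      have h1 : ∀ᶠ s in 𝓝[≥] x, X s ∈ Metric.ball (X x) ε :=
        (hX.1 x).eventually (Metric.ball_mem_nhds _ hε)
      have h2 : ∀ᶠ s in 𝓝[<] x, X s ∈ Metric.ball (Function.leftLim X x) ε :=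
        (hX.tendsto_leftLim x).eventually (Metric.ball_mem_nhds _ hε)
      refine ⟨{s | X s ∈ Metric.ball (X x) ε ∪ Metric.ball (Function.leftLim X x) ε}, ?_,
        {X x, Function.leftLim X x}, by simp, ?_⟩
      · refine mem_nhdsWithin_of_mem_nhds ?_
        rw [← nhdsLT_sup_nhdsGE]
        exact ⟨h2.mono fun s hs => Or.inr hs, h1.mono fun s hs => Or.inl hs⟩
      · rintro _ ⟨s, hs, rfl⟩
        simpa using hs
  exact isCompact_iff_totallyBounded_isComplete.2 ⟨hT.closure, isClosed_closure.isComplete⟩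

lemma mem_closure_image (X : ℝ≥0 → V) {s t : ℝ≥0} (hst : s ≤ t) : X s ∈ closure (X '' Iic t) :=
  subset_closure ⟨s, hst, rfl⟩

lemma IsCadlag.leftLim_mem_closure_image (hX : IsCadlag X) {s t : ℝ≥0} (hst : s ≤ t) :
    Function.leftLim X s ∈ closure (X '' Iic t) := by
  rcases eq_or_ne s 0 with rfl | hs
  · rw [leftLim_zero]; exact mem_closure_image X hst
  · have := nhdsLT_neBot (pos_iff_ne_zero.2 hs)
    exact mem_closure_of_tendsto (hX.tendsto_leftLim s)
      (eventually_nhdsWithin_of_forall fun r hr => ⟨r, (le_of_lt hr).trans hst, rfl⟩)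

/-- The path of left limits is left-continuous. -/
lemma IsCadlag.continuousWithinAt_leftLim (hX : IsCadlag X) (t : ℝ≥0) :
    ContinuousWithinAt (Function.leftLim X) (Iic t) t := by
  exact continuousWithinAt_leftLim_Iic (hX.tendsto_leftLim t)

/-- Composition with a map that is continuous on compact sets. -/
lemma IsCadlag.tendsto_comp_of_continuousOnCompacts [CompleteSpace V] {T : Type*}
    [TopologicalSpace T] (hX : IsCadlag X) {g : V → T} (hg : ContinuousOnCompacts g) {t : ℝ≥0}
    {ι : Type*} {l : Filter ι} {z : ι → V} {w : V} (hz : Tendsto z l (𝓝 w))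
    (hzt : ∀ᶠ i in l, z i ∈ closure (X '' Iic t)) (hw : w ∈ closure (X '' Iic t)) :
    Tendsto (fun i => g (z i)) l (𝓝 (g w)) :=
  (hg _ (hX.isCompact_closure_image t) w hw).tendsto.comp
    (tendsto_nhdsWithin_iff.2 ⟨hz, hzt⟩)

lemma IsCadlag.tendsto_comp_left [CompleteSpace V] {T : Type*}
    [TopologicalSpace T] (hX : IsCadlag X) {g : V → T} (hg : ContinuousOnCompacts g) (t : ℝ≥0) :
    Tendsto (fun s => g (X s)) (𝓝[<] t) (𝓝 (g (Function.leftLim X t))) :=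
  hX.tendsto_comp_of_continuousOnCompacts hg (hX.tendsto_leftLim t)
    (eventually_nhdsWithin_of_forall fun _ hs => mem_closure_image X (le_of_lt hs))
    (hX.leftLim_mem_closure_image le_rfl)

lemma IsCadlag.comp [CompleteSpace V] (hX : IsCadlag X) {g : V → W} (hg : ContinuousOnCompacts g) :
    IsCadlag fun t => g (X t) := by
  refine ⟨fun t => ?_, fun t _ => ⟨_, hX.tendsto_comp_left hg t⟩⟩
  refine hX.tendsto_comp_of_continuousOnCompacts hg (t := t + 1) (hX.1 t) ?_
    (mem_closure_image X (by simp))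
  have : ∀ᶠ s in 𝓝[≥] t, s ≤ t + 1 :=
    mem_nhdsWithin_of_mem_nhds (Iic_mem_nhds (lt_add_of_pos_right t one_pos))
  exact this.mono fun s hs => mem_closure_image X hs

lemma IsCadlag.leftLim_comp [CompleteSpace V] (hX : IsCadlag X) {g : V → W}
    (hg : ContinuousOnCompacts g) (t : ℝ≥0) :
    Function.leftLim (fun t => g (X t)) t = g (Function.leftLim X t) := by
  rcases eq_or_ne t 0 with rfl | ht
  · simp only [leftLim_zero]
  · exact leftLim_eq (pos_iff_ne_zero.2 ht) (hX.tendsto_comp_left hg t)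

lemma continuousWithinAt_comp_leftLim [CompleteSpace V] (hX : IsCadlag X) {g : V → W}
    (hg : ContinuousOnCompacts g) (t : ℝ≥0) :
    ContinuousWithinAt (fun t => g (Function.leftLim X t)) (Iic t) t :=
  hX.tendsto_comp_of_continuousOnCompacts hg (t := t) (hX.continuousWithinAt_leftLim t)
    (eventually_nhdsWithin_of_forall fun _ hs => hX.leftLim_mem_closure_image hs)
    (hX.leftLim_mem_closure_image le_rfl)

end Cadlag

/-! ### Finite variation and jumps -/

section FiniteVariation

variable {V W : Type*} [NormedAddCommGroup V] [NormedAddCommGroup W] {X Q : ℝ≥0 → V}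

lemma HasFiniteVariation.add {Q' : ℝ≥0 → V} (hQ : HasFiniteVariation Q)
    (hQ' : HasFiniteVariation Q') : HasFiniteVariation fun t => Q t + Q' t := by
  refine hasFiniteVariation_of_norm_sub_le (g := fun t => pathVariation Q t + pathVariation Q' t)
    (hQ.monotone_pathVariation.add hQ'.monotone_pathVariation) fun a b hab => ?_
  have h1 := hQ.norm_sub_le hab
  have h2 := hQ'.norm_sub_le hab
  calc ‖Q b + Q' b - (Q a + Q' a)‖ = ‖(Q b - Q a) + (Q' b - Q' a)‖ := by congr 1; abel
    _ ≤ _ := norm_add_le _ _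
    _ ≤ _ := by linarith

lemma HasFiniteVariation.const_smul [NormedSpace ℝ V] (hQ : HasFiniteVariation Q) (c : ℝ) :
    HasFiniteVariation fun t => c • Q t := by
  refine hasFiniteVariation_of_norm_sub_le (g := fun t => |c| * pathVariation Q t)
    (hQ.monotone_pathVariation.const_mul (abs_nonneg c)) fun a b hab => ?_
  rw [← smul_sub, norm_smul, Real.norm_eq_abs, ← mul_sub]
  exact mul_le_mul_of_nonneg_left (hQ.norm_sub_le hab) (abs_nonneg c)

lemma hasFiniteVariation_const (c : V) : HasFiniteVariation fun _ => c :=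
  hasFiniteVariation_of_norm_sub_le (g := fun _ => 0) monotone_const fun a b _ => by simp

lemma HasFiniteVariation.sub {Q' : ℝ≥0 → V} (hQ : HasFiniteVariation Q)
    (hQ' : HasFiniteVariation Q') : HasFiniteVariation fun t => Q t - Q' t := by
  refine hasFiniteVariation_of_norm_sub_le (g := fun t => pathVariation Q t + pathVariation Q' t)
    (hQ.monotone_pathVariation.add hQ'.monotone_pathVariation) fun a b hab => ?_
  have h1 := hQ.norm_sub_le hab
  have h2 := hQ'.norm_sub_le hab
  calc ‖Q b - Q' b - (Q a - Q' a)‖ = ‖(Q b - Q a) - (Q' b - Q' a)‖ := by congr 1; abel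
    _ ≤ _ := _root_.norm_sub_le _ _
    _ ≤ _ := by linarith

/-- The jumps of a càdlàg path of finite variation are absolutely summable on compact intervals. -/
lemma HasFiniteVariation.summable_norm_jump (hc : IsCadlag Q) (hQ : HasFiniteVariation Q)
    (t : ℝ≥0) : Summable ((Ioc 0 t).indicator fun s => ‖jump Q s‖) := by
  let g : StieltjesFunction ℝ≥0 :=
    { toFun := pathVariation Q
      mono' := hQ.monotone_pathVariation
      right_continuous' := fun x => hQ.continuousWithinAt_pathVariation (hc.1 x) }
  have hg : ∀ x, g x = pathVariation Q x := fun _ => rfl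
  have hsing : ∀ s, 0 < s → g.measure {s} = ENNReal.ofReal ‖jump Q s‖ := by
    intro s hs
    have hlim := variationOnFromTo.tendsto_left (mem_univ (0 : ℝ≥0)) (mem_univ s) hQ
      (l := Function.leftLim Q s) (by rw [univ_inter]; exact hc.tendsto_leftLim s)
    rw [univ_inter] at hlim
    have hne := nhdsLT_neBot hs
    have h2 : Function.leftLim g s = pathVariation Q s - ‖jump Q s‖ := by
      rw [jump, ← dist_eq_norm]
      exact leftLim_eq_of_tendsto hlim
    rw [g.measure_singleton, h2, hg, sub_sub_cancel]
  refine summable_of_sum_le (c := pathVariation Q t)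
    (fun s => indicator_nonneg (fun _ _ => norm_nonneg _) s) fun T => ?_
  classical
  have h1 : ∑ s ∈ T, (Ioc 0 t).indicator (fun s => ‖jump Q s‖) s
      = ∑ s ∈ T with s ∈ Ioc 0 t, ‖jump Q s‖ := by
    simp only [Finset.sum_filter, indicator_apply]
  rw [h1]
  have h2 : ∑ s ∈ T with s ∈ Ioc 0 t, ENNReal.ofReal ‖jump Q s‖ ≤
      ENNReal.ofReal (pathVariation Q t) := by
    have h3 : g.measure (Ioc 0 t) = ENNReal.ofReal (pathVariation Q t) := by
      rw [g.measure_Ioc, hg, hg, pathVariation_zero, sub_zero]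
    rw [← h3]
    have h4 : ∑ s ∈ T with s ∈ Ioc 0 t, ENNReal.ofReal ‖jump Q s‖ =
        ∑ s ∈ T with s ∈ Ioc 0 t, g.measure {s} :=
      Finset.sum_congr rfl fun s hs => (hsing s (Finset.mem_filter.1 hs).2.1).symm
    rw [h4, sum_measure_singleton]
    exact measure_mono fun s hs => (Finset.mem_filter.1 (Finset.mem_coe.1 hs)).2
  rw [← ENNReal.ofReal_sum_of_nonneg fun _ _ => norm_nonneg _] at h2
  exact (ENNReal.ofReal_le_ofReal_iff (hQ.pathVariation_nonneg t)).1 h2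

lemma indicator_Ioc_zero_sub {U : Type*} [AddCommGroup U] {a b : ℝ≥0} (hab : a ≤ b) (K : ℝ≥0 → U)
    (s : ℝ≥0) : (Ioc 0 b).indicator K s - (Ioc 0 a).indicator K s = (Ioc a b).indicator K s := by
  have : Ioc (0 : ℝ≥0) b = Ioc 0 a ∪ Ioc a b := (Ioc_union_Ioc_eq_Ioc zero_le hab).symm
  rw [this, indicator_union_of_disjoint (Ioc_disjoint_Ioc_of_le le_rfl)]
  simp

/-- The path `t ↦ ∑_{0 < s ≤ t} J s`; the sum is unconditional, over an uncountable index set, and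
zero when it does not converge. -/
def jumpSum (J : ℝ≥0 → V) (t : ℝ≥0) : V := ∑' s, (Ioc 0 t).indicator J s

section JumpSum

variable [CompleteSpace V] {J : ℝ≥0 → V}
  (hJ : ∀ t, Summable ((Ioc 0 t).indicator fun s => ‖J s‖))
include hJ

lemma summable_indicator_of_norm (t : ℝ≥0) : Summable ((Ioc 0 t).indicator J) := by
  refine Summable.of_norm ((hJ t).congr fun s => ?_)
  exact (norm_indicator_eq_indicator_norm J s).symm

lemma norm_jumpSum_sub_le {a b : ℝ≥0} (hab : a ≤ b) :
    ‖jumpSum J b - jumpSum J a‖ ≤ jumpSum (fun s => ‖J s‖) b - jumpSum (fun s => ‖J s‖) a := by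
  unfold jumpSum
  rw [← (summable_indicator_of_norm hJ b).tsum_sub (summable_indicator_of_norm hJ a),
    ← (hJ b).tsum_sub (hJ a)]
  simp_rw [indicator_Ioc_zero_sub hab]
  have hs : Summable fun s => ‖(Ioc a b).indicator J s‖ := by
    refine (((hJ b).sub (hJ a)).congr fun s => ?_)
    rw [indicator_Ioc_zero_sub hab, norm_indicator_eq_indicator_norm]
  refine (norm_tsum_le_tsum_norm hs).trans_eq ?_
  exact tsum_congr fun s => norm_indicator_eq_indicator_norm J s

lemma hasFiniteVariation_jumpSum : HasFiniteVariation (jumpSum J) := by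
  refine hasFiniteVariation_of_norm_sub_le (g := jumpSum fun s => ‖J s‖) ?_ fun a b hab =>
    norm_jumpSum_sub_le hJ hab
  intro a b hab
  have := (norm_nonneg _).trans (norm_jumpSum_sub_le hJ hab)
  linarith

lemma tendsto_jumpSum_left {t : ℝ≥0} (ht : 0 < t) :
    Tendsto (jumpSum J) (𝓝[<] t) (𝓝 (jumpSum J t - J t)) := by
  have h1 : jumpSum J t - J t = ∑' s, (Ioo 0 t).indicator J s := by
    unfold jumpSum
    have h2 : (Ioc 0 t).indicator J = (Ioo 0 t).indicator J + (({t} : Set ℝ≥0).indicator J) := by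
      rw [← Ioo_union_right ht, indicator_union_of_disjoint (by simp)]
      rfl
    have h3 : HasSum (({t} : Set ℝ≥0).indicator J) (J t) := by
      have := hasSum_single t (f := ({t} : Set ℝ≥0).indicator J) (fun s hs => by simp [hs])
      simpa using this
    have h4 : Summable ((Ioo 0 t).indicator J) := by
      have := (summable_indicator_of_norm hJ t).sub h3.summable
      refine this.congr fun s => ?_
      rw [h2]; simp
    rw [h2]
    simp only [Pi.add_apply]
    rw [h4.tsum_add h3.summable, h3.tsum_eq]
    abel
  rw [h1]
  refine tendsto_tsum_of_dominated_convergence (hJ t) (fun s => ?_) ?_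
  · rcases lt_or_ge s t with hs | hs
    · refine tendsto_const_nhds.congr' ?_
      filter_upwards [mem_nhdsWithin_of_mem_nhds (Ioi_mem_nhds hs)] with r hr
      by_cases h0 : 0 < s
      · rw [indicator_of_mem (show s ∈ Ioo 0 t from ⟨h0, hs⟩),
          indicator_of_mem (show s ∈ Ioc 0 r from ⟨h0, le_of_lt hr⟩)]
      · rw [indicator_of_notMem (fun h => h0 h.1), indicator_of_notMem (fun h => h0 h.1)]
    · refine tendsto_const_nhds.congr' ?_
      filter_upwards [self_mem_nhdsWithin] with r hr
      rw [indicator_of_notMem (fun h => (h.2.trans_le hs).false),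
        indicator_of_notMem (fun h => (h.2.trans_lt (lt_of_lt_of_le hr hs)).false)]
  · filter_upwards [self_mem_nhdsWithin] with r hr s
    rw [norm_indicator_eq_indicator_norm]
    exact indicator_le_indicator_of_subset (Ioc_subset_Ioc_right (le_of_lt hr))
      (fun _ => norm_nonneg _) s

lemma isCadlag_jumpSum : IsCadlag (jumpSum J) := by
  refine ⟨fun t => ?_, fun t ht => ⟨_, tendsto_jumpSum_left hJ ht⟩⟩
  refine tendsto_tsum_of_dominated_convergence (hJ (t + 1)) (fun s => ?_) ?_
  · rcases le_or_gt s t with hs | hs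
    · refine tendsto_const_nhds.congr' ?_
      filter_upwards [self_mem_nhdsWithin] with r hr
      by_cases h0 : 0 < s
      · rw [indicator_of_mem (show s ∈ Ioc 0 t from ⟨h0, hs⟩),
          indicator_of_mem (show s ∈ Ioc 0 r from ⟨h0, hs.trans hr⟩)]
      · rw [indicator_of_notMem (fun h => h0 h.1), indicator_of_notMem (fun h => h0 h.1)]
    · refine tendsto_const_nhds.congr' ?_
      filter_upwards [mem_nhdsWithin_of_mem_nhds (Iio_mem_nhds hs)] with r hr
      rw [indicator_of_notMem (fun h => (hs.trans_le h.2).false),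
        indicator_of_notMem (fun h => (lt_of_lt_of_le hr h.2).false)]
  · filter_upwards [mem_nhdsWithin_of_mem_nhds
      (Iic_mem_nhds (lt_add_of_pos_right t one_pos))] with r hr s
    rw [norm_indicator_eq_indicator_norm]
    exact indicator_le_indicator_of_subset (Ioc_subset_Ioc_right hr) (fun _ => norm_nonneg _) s

lemma jump_jumpSum {t : ℝ≥0} (ht : 0 < t) : jump (jumpSum J) t = J t := by
  rw [jump_eq_sub ht (tendsto_jumpSum_left hJ ht), sub_sub_cancel]

lemma isPurelyDiscontinuous_jumpSum : IsPurelyDiscontinuous (jumpSum J) := by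
  refine ⟨isCadlag_jumpSum hJ, fun t => ?_⟩
  have h1 : HasSum ((Ioc 0 t).indicator J) (jumpSum J t) :=
    (summable_indicator_of_norm hJ t).hasSum
  have h2 := hasSum_subtype_iff_indicator.2 h1
  refine h2.congr_fun fun s => ?_
  exact (jump_jumpSum hJ s.2.1)

end JumpSum

/-- A càdlàg path of finite variation splits into a continuous and a purely discontinuous part. -/
lemma HasFiniteVariation.exists_continuous_add_purelyDiscontinuous [CompleteSpace V]
    (hc : IsCadlag Q) (hQ : HasFiniteVariation Q) :
    ∃ C D : ℝ≥0 → V, (∀ t, Q t = C t + D t) ∧ Continuous C ∧ HasFiniteVariation C ∧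
      IsPurelyDiscontinuous D ∧ HasFiniteVariation D := by
  have hJ := hQ.summable_norm_jump hc
  refine ⟨fun t => Q t - jumpSum (jump Q) t, jumpSum (jump Q), fun t => by simp, ?_,
    hQ.sub (hasFiniteVariation_jumpSum hJ), isPurelyDiscontinuous_jumpSum hJ,
    hasFiniteVariation_jumpSum hJ⟩
  refine (hc.sub (isCadlag_jumpSum hJ)).continuous fun t => ?_
  rw [jump_sub hc (isCadlag_jumpSum hJ)]
  rcases eq_or_ne t 0 with rfl | ht
  · simp [jump_zero]
  · rw [jump_jumpSum hJ (pos_iff_ne_zero.2 ht), sub_self]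

/-! ### The integral as a path -/

section IntegralPath

variable [NormedSpace ℝ V] [NormedSpace ℝ W] [CompleteSpace V] [CompleteSpace W]
  {η : ℝ≥0 → V →L[ℝ] W}
  (hc : IsCadlag Q) (hQ : HasFiniteVariation Q)
  (hη : ∀ t, StieltjesIntegrable η Q hQ t)
include hc hη

lemma tendsto_stieltjesIntegral_left {t : ℝ≥0} (hl : ContinuousWithinAt η (Iic t) t) :
    Tendsto (stieltjesIntegral η Q hQ) (𝓝[<] t)
      (𝓝 (stieltjesIntegral η Q hQ t - η t (jump Q t))) := by
  have h1 : Tendsto (fun a => stieltjesIntegral η Q hQ t - stieltjesIntegral η Q hQ a -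
      η t (Q t - Q a)) (𝓝[<] t) (𝓝 0) := by
    rw [Metric.tendsto_nhds]
    intro ε hε
    set K : ℝ := ε / (pathVariation Q t + 1) with hK
    have hv := hQ.pathVariation_nonneg t
    have hKpos : 0 < K := by positivity
    have h2 : ∀ᶠ s in 𝓝[≤] t, ‖η s - η t‖ ≤ K := by
      filter_upwards [hl.eventually (Metric.ball_mem_nhds _ hKpos)] with s hs
      rw [← dist_eq_norm]; exact le_of_lt hs
    rcases eq_or_ne t 0 with rfl | ht
    · simp
    obtain ⟨u, hu, hut⟩ := (mem_nhdsLE_iff_exists_Ioc_subset' (pos_iff_ne_zero.2 ht)).1 h2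
    filter_upwards [Ioo_mem_nhdsLT hu] with a ha
    have h3 := norm_stieltjesIntegral_sub_le hc.1 hQ hη ha.2.le (η t) hKpos.le
      (fun s hs => hut ⟨ha.1.trans hs.1, hs.2⟩)
    rw [dist_zero_right]
    refine h3.trans_lt ?_
    have h4 := hQ.pathVariation_nonneg a
    calc K * (pathVariation Q t - pathVariation Q a) ≤ K * pathVariation Q t := by gcongr; linarith
      _ < K * (pathVariation Q t + 1) := by gcongr; linarith
      _ = ε := by rw [hK]; field_simp
  have h5 : Tendsto (fun a => η t (Q t - Q a)) (𝓝[<] t) (𝓝 (η t (jump Q t))) :=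
    ((η t).continuous.tendsto _).comp (tendsto_const_nhds.sub (hc.tendsto_leftLim t))
  have h6 := (tendsto_const_nhds (x := stieltjesIntegral η Q hQ t)).sub (h1.add h5)
  simp only [zero_add] at h6
  refine h6.congr fun a => ?_
  abel

lemma norm_stieltjesIntegral_sub_le_of_bound {M : ℝ} {a b : ℝ≥0} (hab : a ≤ b)
    (hM : ∀ s, s ≤ b → ‖η s‖ ≤ M) :
    ‖stieltjesIntegral η Q hQ b - stieltjesIntegral η Q hQ a‖ ≤
      M * (pathVariation Q b - pathVariation Q a) := by
  have := norm_stieltjesIntegral_sub_le hc.1 hQ hη hab 0 ((norm_nonneg _).trans (hM 0 zero_le))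
    (fun s hs => by simpa using hM s hs.2)
  simpa using this

lemma isCadlag_stieltjesIntegral (hb : ∀ t, ∃ M, ∀ s, s ≤ t → ‖η s‖ ≤ M)
    (hl : ∀ t, ContinuousWithinAt η (Iic t) t) : IsCadlag (stieltjesIntegral η Q hQ) := by
  refine ⟨fun t => ?_, fun t _ => ⟨_, tendsto_stieltjesIntegral_left hc hQ hη (hl t)⟩⟩
  obtain ⟨M, hM⟩ := hb (t + 1)
  have h1 : Tendsto (fun b => M * (pathVariation Q b - pathVariation Q t)) (𝓝[≥] t) (𝓝 0) := by
    have := ((hQ.continuousWithinAt_pathVariation (hc.1 t)).tendsto.sub_const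
      (pathVariation Q t)).const_mul M
    simpa using this
  refine tendsto_iff_norm_sub_tendsto_zero.2 (squeeze_zero' (Eventually.of_forall fun _ =>
    norm_nonneg _) ?_ h1)
  filter_upwards [self_mem_nhdsWithin, mem_nhdsWithin_of_mem_nhds
      (Iic_mem_nhds (lt_add_of_pos_right t one_pos))] with b hb hb1
  exact norm_stieltjesIntegral_sub_le_of_bound hc hQ hη hb fun s hs => hM s (hs.trans hb1)

lemma hasFiniteVariation_stieltjesIntegral (hb : ∀ t, ∃ M, ∀ s, s ≤ t → ‖η s‖ ≤ M) :
    HasFiniteVariation (stieltjesIntegral η Q hQ) := by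
  intro a b _ _
  obtain ⟨M, hM⟩ := hb b
  have hM0 : 0 ≤ M := (norm_nonneg _).trans (hM 0 zero_le)
  have h1 : HasFiniteVariation fun s => stieltjesIntegral η Q hQ (min s b) := by
    refine hasFiniteVariation_of_norm_sub_le (g := fun s => M * pathVariation Q (min s b))
      (fun x y hxy => mul_le_mul_of_nonneg_left
        (hQ.monotone_pathVariation (min_le_min_right b hxy)) hM0) fun x y hxy => ?_
    rw [← mul_sub]
    exact norm_stieltjesIntegral_sub_le_of_bound hc hQ hη (min_le_min_right b hxy)
      fun s hs => hM s (hs.trans (min_le_right _ _))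
  have h2 := h1 a b (mem_univ _) (mem_univ _)
  have h3 : eVariationOn (fun s => stieltjesIntegral η Q hQ (min s b)) (univ ∩ Icc a b) =
      eVariationOn (stieltjesIntegral η Q hQ) (univ ∩ Icc a b) :=
    eVariationOn.congr fun s hs => by simp only [min_eq_left hs.2.2]
  rwa [BoundedVariationOn, h3] at h2

lemma jump_stieltjesIntegral (t : ℝ≥0) (hl : ContinuousWithinAt η (Iic t) t) :
    jump (stieltjesIntegral η Q hQ) t = η t (jump Q t) := by
  rcases eq_or_ne t 0 with rfl | ht
  · simp [jump_zero]
  · rw [jump_eq_sub (pos_iff_ne_zero.2 ht) (tendsto_stieltjesIntegral_left hc hQ hη hl),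
      sub_sub_cancel]

end IntegralPath

end FiniteVariation

/-! ### Sums along partitions -/

namespace TimePartition

variable {V W : Type*} [NormedAddCommGroup V] [NormedAddCommGroup W] (π : TimePartition)

lemma exists_le_pt (t : ℝ≥0) : ∃ i, t ≤ π.pt i :=
  (π.tendsto_atTop.eventually_ge_atTop t).exists

open Classical in
/-- The number of partition points in `[0, t[`. The intervals `]t_i, t_{i+1}]` with `i < cnt t` are
those that start before `t`. -/
def cnt (t : ℝ≥0) : ℕ := Nat.find (π.exists_le_pt t)

lemma cnt_le_iff {t : ℝ≥0} {i : ℕ} : π.cnt t ≤ i ↔ t ≤ π.pt i := by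
  classical
  constructor
  · intro h
    exact (Nat.find_spec (π.exists_le_pt t)).trans (π.strictMono.monotone h)
  · intro h
    exact Nat.find_min' _ h

lemma lt_cnt_iff {t : ℝ≥0} {i : ℕ} : i < π.cnt t ↔ π.pt i < t := by
  rw [← not_le, cnt_le_iff, not_le]

lemma le_pt_cnt (t : ℝ≥0) : t ≤ π.pt (π.cnt t) := π.cnt_le_iff.1 le_rfl

lemma cnt_zero : π.cnt 0 = 0 := Nat.le_zero.1 (π.cnt_le_iff.2 zero_le)

lemma cnt_mono : Monotone π.cnt := fun _ _ h => π.cnt_le_iff.2 (h.trans (π.le_pt_cnt _))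

lemma lower_lt {t : ℝ≥0} (ht : 0 < t) : π.lower t < t := (π.mem_Ioc_lower_upper ht).1

lemma le_upper {t : ℝ≥0} (ht : 0 < t) : t ≤ π.upper t := (π.mem_Ioc_lower_upper ht).2

lemma idx_eq_of_mem {t : ℝ≥0} {i : ℕ} (h : t ∈ Ioc (π.pt i) (π.pt (i + 1))) : π.idx t = i := by
  have h2 := π.mem_Ioc_lower_upper (zero_le.trans_lt h.1)
  have h3 : π.idx t < i + 1 := π.strictMono.lt_iff_lt.1 (h2.1.trans_le h.2)
  have h4 : i < π.idx t + 1 := π.strictMono.lt_iff_lt.1 (h.1.trans_le h2.2)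
  omega

lemma cnt_eq_idx_add_one {t : ℝ≥0} (ht : 0 < t) : π.cnt t = π.idx t + 1 := by
  refine le_antisymm (π.cnt_le_iff.2 (π.le_upper ht)) ?_
  exact π.lt_cnt_iff.2 (π.lower_lt ht)

lemma idx_lt_cnt {s t : ℝ≥0} (hs : 0 < s) (hst : s ≤ t) : π.idx s < π.cnt t :=
  π.lt_cnt_iff.2 ((π.lower_lt hs).trans_le hst)

lemma incr_eq_zero {X : ℝ≥0 → V} {t : ℝ≥0} {i : ℕ} (hi : π.cnt t ≤ i) : π.incr X t i = 0 := by
  have h := π.cnt_le_iff.1 hi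
  rw [incr, min_eq_right h, min_eq_right (h.trans (π.strictMono.monotone (Nat.le_succ i))),
    sub_self]

lemma incr_eq {X : ℝ≥0 → V} {t : ℝ≥0} {i : ℕ} (hi : i < π.cnt t) :
    π.incr X t i = X (min (π.pt (i + 1)) t) - X (π.pt i) := by
  rw [incr, min_eq_left (π.lt_cnt_iff.1 hi).le]

lemma discreteScalarQV_eq_sum (X : ℝ≥0 → V) (t : ℝ≥0) :
    π.discreteScalarQV X t = ∑ i ∈ Finset.range (π.cnt t), ‖π.incr X t i‖ ^ 2 :=
  tsum_eq_sum fun i hi => by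
    rw [π.incr_eq_zero (not_lt.1 fun h => hi (Finset.mem_range.2 h))]; simp

lemma sum_incr (X : ℝ≥0 → V) (t : ℝ≥0) (k : ℕ) :
    ∑ i ∈ Finset.range k, π.incr X t i = X (min (π.pt k) t) - X 0 := by
  unfold incr
  rw [Finset.sum_range_sub (fun i => X (min (π.pt i) t)), π.pt_zero, min_eq_left zero_le]

lemma sum_norm_incr_le {X : ℝ≥0 → V} (hX : HasFiniteVariation X) (t : ℝ≥0) (k : ℕ) :
    ∑ i ∈ Finset.range k, ‖π.incr X t i‖ ≤ pathVariation X t := by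
  have h1 : ∑ i ∈ Finset.range k, ‖π.incr X t i‖ ≤
      ∑ i ∈ Finset.range k, π.incr (pathVariation X) t i :=
    Finset.sum_le_sum fun i _ =>
      hX.norm_sub_le (min_le_min_right t (π.strictMono.monotone (Nat.le_succ i)))
  refine h1.trans ?_
  rw [sum_incr, pathVariation_zero, sub_zero]
  exact hX.monotone_pathVariation (min_le_right _ _)

lemma edist_le_osc {X : ℝ≥0 → V} {t x y : ℝ≥0} {i : ℕ}
    (hx : x ∈ Ioc (π.pt i) (π.pt (i + 1))) (hxt : x ≤ t)
    (hy : y ∈ Ioc (π.pt i) (π.pt (i + 1))) (hyt : y ≤ t) :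
    edist (X x) (X y) ≤ π.osc X t :=
  le_iSup_of_le i <| le_iSup₂_of_le x ⟨hx, hxt⟩ <| le_iSup₂_of_le y ⟨hy, hyt⟩ le_rfl

variable [NormedSpace ℝ V] [NormedSpace ℝ W]

lemma discreteQV_eq_sum (B : V →L[ℝ] V →L[ℝ] W) (X : ℝ≥0 → V) (t : ℝ≥0) :
    π.discreteQV B X t = ∑ i ∈ Finset.range (π.cnt t), B (π.incr X t i) (π.incr X t i) :=
  tsum_eq_sum fun i hi => by
    rw [π.incr_eq_zero (not_lt.1 fun h => hi (Finset.mem_range.2 h))]; simp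

lemma leftSum_eq_sum (H : ℝ≥0 → V →L[ℝ] W) (X : ℝ≥0 → V) (t : ℝ≥0) :
    π.leftSum H X t = ∑ i ∈ Finset.range (π.cnt t), H (π.pt i) (π.incr X t i) :=
  tsum_eq_sum fun i hi => by
    rw [π.incr_eq_zero (not_lt.1 fun h => hi (Finset.mem_range.2 h))]; simp

end TimePartition

/-! ### Consequences of Condition (C) -/

section ConditionC

variable {V W : Type*} [NormedAddCommGroup V] [NormedAddCommGroup W]
  {π : ℕ → TimePartition} {Z : ℝ≥0 → V}

lemma bigJumps_eq {ε : ℝ} {a b : ℝ≥0} (hab : a ≤ b) (h : ∀ r ∈ Ioc a b, ‖jump Z r‖ ≤ ε) :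
    bigJumps ε Z b = bigJumps ε Z a := by
  unfold bigJumps
  refine finsum_congr fun s => ?_
  have : s ∈ {s : ℝ≥0 | 0 < s ∧ s ≤ b ∧ ε < ‖jump Z s‖} ↔
      s ∈ {s : ℝ≥0 | 0 < s ∧ s ≤ a ∧ ε < ‖jump Z s‖} := by
    simp only [mem_ofPred_eq]
    refine ⟨fun ⟨h0, h1, h2⟩ => ⟨h0, ?_, h2⟩, fun ⟨h0, h1, h2⟩ => ⟨h0, h1.trans hab, h2⟩⟩
    by_contra hs
    exact absurd h2 (not_lt.2 (h s ⟨not_le.1 hs, h1⟩))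
  by_cases hs : s ∈ {s : ℝ≥0 | 0 < s ∧ s ≤ a ∧ ε < ‖jump Z s‖}
  · rw [finsum_eq_if, finsum_eq_if, if_pos hs, if_pos (this.2 hs)]
  · rw [finsum_eq_if, finsum_eq_if, if_neg hs, if_neg (mt this.1 hs)]

lemma ConditionC.eventually_osc_lt (hC : ConditionC π Z) (t : ℝ≥0) {κ : ℝ≥0∞} (hκ : 0 < κ) :
    ∀ᶠ ε : ℝ in 𝓝[>] 0, ∀ᶠ n in atTop, (π n).osc (fun s => Z s - bigJumps ε Z s) t < κ := by
  have h := hC.c3 t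
  have h1 : ∀ᶠ ε : ℝ in 𝓝[>] 0,
      limsup (fun n => (π n).osc (fun s => Z s - bigJumps ε Z s) t) atTop < κ :=
    eventually_lt_of_limsup_lt (h.trans_lt hκ)
  exact h1.mono fun ε hε => eventually_lt_of_limsup_lt hε

/-- If there are no jumps larger than `ε` between two points of the same partition interval, then
the increment of the path is controlled by the oscillation. -/
lemma TimePartition.norm_sub_lt_of_osc_lt (p : TimePartition) {t a b : ℝ≥0} {ε κ : ℝ} {i : ℕ}
    (hosc : p.osc (fun s => Z s - bigJumps ε Z s) t < ENNReal.ofReal κ) (hab : a ≤ b) (hbt : b ≤ t)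
    (ha : p.pt i < a) (hb : b ≤ p.pt (i + 1)) (h : ∀ r ∈ Ioc a b, ‖jump Z r‖ ≤ ε) :
    ‖Z b - Z a‖ < κ := by
  have h1 := (p.edist_le_osc (X := fun s => Z s - bigJumps ε Z s) (t := t) (x := b) (y := a)
    ⟨ha.trans_le hab, hb⟩ hbt ⟨ha, hab.trans hb⟩ (hab.trans hbt)).trans_lt hosc
  rw [bigJumps_eq hab h, edist_sub_right, edist_dist, dist_eq_norm] at h1
  exact (ENNReal.ofReal_lt_ofReal_iff_of_nonneg (norm_nonneg _)).1 h1

/-- Two jump times are eventually separated by the partitions. -/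
lemma ConditionC.eventually_upper_lt_of_jumps (hC : ConditionC π Z) {a b : ℝ≥0} (ha : 0 < a)
    (hab : a < b) (hja : jump Z a ≠ 0) (hjb : jump Z b ≠ 0) : ∀ᶠ n in atTop, (π n).upper a < b := by
  set ε := min ‖jump Z a‖ ‖jump Z b‖ / 2 with hε
  have h1 : 0 < min ‖jump Z a‖ ‖jump Z b‖ := lt_min (norm_pos_iff.2 hja) (norm_pos_iff.2 hjb)
  obtain ⟨N, hN⟩ := hC.c1 b ε (half_pos h1)
  filter_upwards [eventually_ge_atTop N] with n hn
  by_contra hlt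
  have hlt := not_lt.1 hlt
  have h2 := (π n).mem_Ioc_lower_upper ha
  have h3 : a = b := hN n hn ((π n).idx a)
    ⟨⟨h2, hab.le⟩, (half_lt_self h1).trans_le (min_le_left _ _)⟩
    ⟨⟨⟨h2.1.trans hab, hlt⟩, mem_Iic.2 le_rfl⟩, (half_lt_self h1).trans_le (min_le_right _ _)⟩
  exact hab.ne h3

lemma ConditionC.eventually_upper_lt_of_no_jumps (hC : ConditionC π Z) {a b : ℝ≥0} (ha : 0 < a)
    (hab : a ≤ b) (hne : Z b ≠ Z a) (hj : ∀ r ∈ Ioc a b, jump Z r = 0) :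
    ∀ᶠ n in atTop, (π n).upper a < b := by
  have hκ : 0 < ‖Z b - Z a‖ := norm_pos_iff.2 (sub_ne_zero.2 hne)
  obtain ⟨ε, hε, hε0⟩ := ((hC.eventually_osc_lt b (ENNReal.ofReal_pos.2 hκ)).and
    self_mem_nhdsWithin).exists
  filter_upwards [hε] with n hn
  by_contra hlt
  have h := (π n).norm_sub_lt_of_osc_lt hn hab le_rfl ((π n).lower_lt ha) (not_lt.1 hlt)
    (fun r hr => by rw [hj r hr, norm_zero]; exact le_of_lt hε0)
  exact h.false

/-- A time is regular for a path if the path jumps there or is not constant on any right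
neighbourhood. The partitions detect such times. -/
def IsRegularTime (Z : ℝ≥0 → V) (τ : ℝ≥0) : Prop :=
  jump Z τ ≠ 0 ∨ ∀ w, τ < w → ∃ s ∈ Ioc τ w, Z s ≠ Z τ

lemma ConditionC.eventually_upper_lt (hC : ConditionC π Z) {τ w : ℝ≥0} (hτ : 0 < τ)
    (hreg : IsRegularTime Z τ) (hw : ∃ s ∈ Ioc τ w, Z s ≠ Z τ) :
    ∀ᶠ n in atTop, (π n).upper τ < w := by
  by_cases hjw : ∀ r ∈ Ioc τ w, jump Z r = 0
  · obtain ⟨s, hs, hne⟩ := hw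
    exact (hC.eventually_upper_lt_of_no_jumps hτ hs.1.le hne
      fun r hr => hjw r ⟨hr.1, hr.2.trans hs.2⟩).mono fun n hn => hn.trans_le hs.2
  push Not at hjw
  obtain ⟨v, hv, hjv⟩ := hjw
  rcases hreg with hj | hreg
  · exact (hC.eventually_upper_lt_of_jumps hτ hv.1 hj hjv).mono fun n hn => hn.trans_le hv.2
  by_cases hjw' : ∀ r ∈ Ioo τ v, jump Z r = 0
  · obtain ⟨x, hx⟩ := exists_between hv.1
    obtain ⟨s, hs, hne⟩ := hreg x hx.1
    refine (hC.eventually_upper_lt_of_no_jumps hτ hs.1.le hne fun r hr => ?_).mono fun n hn =>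
      hn.trans_le (hs.2.trans (hx.2.le.trans hv.2))
    exact hjw' r ⟨hr.1, (hr.2.trans hs.2).trans_lt hx.2⟩
  · push Not at hjw'
    obtain ⟨r, hr, hjr⟩ := hjw'
    refine (hC.eventually_upper_lt_of_jumps (hτ.trans hr.1) hr.2 hjr hjv).mono fun n hn => ?_
    -- the interval containing `τ` ends no later than the one containing `r`
    refine (((π n).strictMono.monotone ?_).trans_lt hn).trans_le hv.2
    have h1 : (π n).idx τ < (π n).idx r + 1 := (π n).strictMono.lt_iff_lt.1
      (((π n).lower_lt hτ).trans_le (hr.1.le.trans ((π n).le_upper (hτ.trans hr.1))))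
    omega

/-- The path `U` is constant on every interval on which `Z` is constant. -/
def ConstantWhere {S T : Type*} (Z : ℝ≥0 → S) (U : ℝ≥0 → T) : Prop :=
  ∀ a b, a ≤ b → (∀ s ∈ Icc a b, Z s = Z a) → U b = U a

lemma constantWhere_self {S : Type*} (Z : ℝ≥0 → S) : ConstantWhere Z Z :=
  fun _ b hab h => h b ⟨hab, le_rfl⟩

lemma IsRegularTime.of_constantWhere {U : ℝ≥0 → W} (hU : ConstantWhere Z U) {τ : ℝ≥0}
    (hj : jump U τ ≠ 0 → jump Z τ ≠ 0) (h : IsRegularTime U τ) : IsRegularTime Z τ := by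
  refine h.imp hj fun h w hw => ?_
  obtain ⟨s, hs, hne⟩ := h w hw
  by_contra hcon
  push Not at hcon
  refine hne (hU τ s hs.1.le fun r hr => ?_)
  rcases eq_or_lt_of_le hr.1 with h1 | h1
  · rw [h1]
  · exact hcon r ⟨h1, hr.2.trans hs.2⟩

/-- At a regular time, the right endpoints of the partition intervals behave like the time itself
from the point of view of every right-continuous path that is constant where `Z` is. Since the mesh
of the partitions need not vanish, the endpoints themselves need not converge. -/
theorem ConditionC.tendsto_upper (hC : ConditionC π Z) {U : ℝ≥0 → W}
    (hU : ∀ t, ContinuousWithinAt U (Ici t) t) (hconst : ConstantWhere Z U) {τ t : ℝ≥0}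
    (hτ : 0 < τ) (hτt : τ ≤ t) (hreg : τ = t ∨ IsRegularTime Z τ) :
    Tendsto (fun n => U (min ((π n).upper τ) t)) atTop (𝓝 (U τ)) := by
  rcases hreg with rfl | hreg
  · refine tendsto_const_nhds.congr fun n => ?_
    rw [min_eq_right ((π n).le_upper hτ)]
  set S : Set ℝ≥0 := {w | ∃ s ∈ Ioc τ w, Z s ≠ Z τ} with hS
  have hconst' : ∀ s, τ ≤ s → s ∉ S → U s = U τ := by
    intro s hs hsS
    refine hconst τ s hs fun r hr => ?_
    by_contra hne
    refine hsS ⟨r, ⟨lt_of_le_of_ne hr.1 ?_, hr.2⟩, hne⟩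
    rintro rfl; exact hne rfl
  have hle : ∀ n, τ ≤ min ((π n).upper τ) t := fun n => le_min ((π n).le_upper hτ) hτt
  by_cases hSe : S.Nonempty
  swap
  · refine tendsto_const_nhds.congr fun n => (hconst' _ (hle n) fun h => hSe ⟨_, h⟩).symm
  have hbdd : BddBelow S := ⟨0, fun _ _ => zero_le⟩
  set σ := sInf S with hσ
  have hlt : ∀ s, s < σ → s ∉ S := fun s hs h => absurd (csInf_le hbdd h) (not_le.2 hs)
  by_cases hσS : σ ∈ S
  · refine tendsto_const_nhds.congr' ?_
    filter_upwards [hC.eventually_upper_lt hτ hreg hσS] with n hn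
    exact (hconst' _ (hle n) (hlt _ ((min_le_left _ _).trans_lt hn))).symm
  · have hτσ : τ ≤ σ := le_csInf hSe fun w ⟨s, hs, _⟩ => hs.1.le.trans hs.2
    have hUσ : U σ = U τ := hconst' σ hτσ hσS
    rw [Metric.tendsto_nhds]
    intro ε hε
    have h1 : ∀ᶠ s in 𝓝[≥] σ, dist (U s) (U σ) < ε := (hU σ).eventually (Metric.ball_mem_nhds _ hε)
    obtain ⟨b, hb, hbsub⟩ := mem_nhdsGE_iff_exists_Ico_subset.1 h1
    obtain ⟨w, hwS, hwb⟩ := exists_lt_of_csInf_lt hSe hb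
    filter_upwards [hC.eventually_upper_lt hτ hreg hwS] with n hn
    rcases lt_or_ge (min ((π n).upper τ) t) σ with hs | hs
    · rw [hconst' _ (hle n) (hlt _ hs), dist_self]; exact hε
    · rw [← hUσ]
      exact hbsub ⟨hs, (min_le_left _ _).trans_lt (hn.trans hwb)⟩

/-- The times in `[0, t]` that can be reached from `0` by finitely many steps, each of them leading
to a regular time (or to `t`), such that the path moves by at most `ε` during each step. -/
inductive Reachable (Z : ℝ≥0 → V) (ε : ℝ) (t : ℝ≥0) : ℝ≥0 → Prop
  | zero : Reachable Z ε t 0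
  | step {τ σ : ℝ≥0} : Reachable Z ε t τ → τ < σ → σ ≤ t → (σ = t ∨ IsRegularTime Z σ) →
      (∀ r ∈ Ico τ σ, ‖Z r - Z τ‖ ≤ ε) → Reachable Z ε t σ

/-- The first time after `τ` at which the path leaves the ball of radius `ε` is regular. -/
lemma Reachable.exists_next (hZ : IsCadlag Z) {ε : ℝ} (hε : 0 < ε) {τ t : ℝ≥0} (hτt : τ < t)
    (h : Reachable Z ε t τ) (hn : ¬ Reachable Z ε t t) : ∃ σ, Reachable Z ε t σ ∧ τ < σ ∧ σ < t ∧
      ∀ s, σ < s → ∃ r ∈ Ico σ s, ε < ‖Z r - Z τ‖ := by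
  set B : Set ℝ≥0 := {r | r ∈ Ico τ t ∧ ε < ‖Z r - Z τ‖} with hB
  have hBne : B.Nonempty := by
    by_contra hBe
    refine hn (h.step hτt le_rfl (Or.inl rfl) fun r hr => ?_)
    by_contra hlt
    exact hBe ⟨r, hr, not_le.1 hlt⟩
  have hbdd : BddBelow B := ⟨0, fun _ _ => zero_le⟩
  set σ := sInf B with hσ
  have hlt : ∀ r ∈ Ico τ σ, ‖Z r - Z τ‖ ≤ ε := by
    intro r hr
    by_contra hcon
    obtain ⟨b, hb⟩ := hBne
    have h1 : σ ≤ b := csInf_le hbdd hb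
    exact absurd (csInf_le hbdd (show r ∈ B from ⟨⟨hr.1, (hr.2.trans_le h1).trans hb.1.2⟩,
      not_le.1 hcon⟩)) (not_le.2 hr.2)
  have hnext : ∀ s, σ < s → ∃ r ∈ Ico σ s, r ∈ B := by
    intro s hs
    obtain ⟨r, hrB, hrs⟩ := exists_lt_of_csInf_lt hBne hs
    exact ⟨r, ⟨csInf_le hbdd hrB, hrs⟩, hrB⟩
  have hσt : σ < t := by
    obtain ⟨b, hb⟩ := hBne
    exact (csInf_le hbdd hb).trans_lt hb.1.2
  have hτσ : τ < σ := by
    have h1 : ∀ᶠ s in 𝓝[≥] τ, Z s ∈ Metric.ball (Z τ) ε :=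
      (hZ.1 τ).eventually (Metric.ball_mem_nhds _ hε)
    obtain ⟨b, hb, hbsub⟩ := mem_nhdsGE_iff_exists_Ico_subset.1 h1
    refine lt_of_lt_of_le hb (le_csInf hBne fun r hr => ?_)
    by_contra hrb
    have h2 : Z r ∈ Metric.ball (Z τ) ε := hbsub ⟨hr.1.1, not_le.1 hrb⟩
    rw [Metric.mem_ball, dist_eq_norm] at h2
    exact (h2.trans hr.2).false
  refine ⟨σ, h.step hτσ hσt.le (Or.inr ?_) hlt, hτσ, hσt, fun s hs => ?_⟩
  · by_cases hj : jump Z σ = 0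
    swap
    · exact Or.inl hj
    refine Or.inr fun w hw => ?_
    by_contra hcon
    push Not at hcon
    obtain ⟨r, hr, hrB⟩ := hnext w hw
    have h1 : Z r = Z σ := by
      rcases eq_or_lt_of_le hr.1 with h1 | h1
      · rw [h1]
      · exact hcon r ⟨h1, hr.2.le⟩
    have h2 : ε < ‖Function.leftLim Z σ - Z τ‖ := by
      rw [← sub_eq_zero.1 hj, ← h1]; exact hrB.2
    have h3 : ∀ᶠ s in 𝓝[<] σ, ε < ‖Z s - Z τ‖ :=
      ((hZ.tendsto_leftLim σ).sub_const (Z τ)).norm.eventually (lt_mem_nhds h2)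
    have := nhdsLT_neBot (zero_le.trans_lt hτσ)
    obtain ⟨s, hs, hsm⟩ := (h3.and (Ioo_mem_nhdsLT hτσ)).exists
    exact absurd (hlt s ⟨hsm.1.le, hsm.2⟩) (not_le.2 hs)
  · obtain ⟨r, hr, hrB⟩ := hnext s hs
    exact ⟨r, hr, hrB.2⟩

theorem reachable_self (hZ : IsCadlag Z) {ε : ℝ} (hε : 0 < ε) (t : ℝ≥0) : Reachable Z ε t t := by
  by_contra hn
  have ht : 0 < t := by
    rw [pos_iff_ne_zero]; rintro rfl; exact hn .zero
  set S : Set ℝ≥0 := {τ | τ ≤ t ∧ Reachable Z ε t τ} with hS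
  have hbdd : BddAbove S := ⟨t, fun _ h => h.1⟩
  have h0 : (0 : ℝ≥0) ∈ S := ⟨zero_le, .zero⟩
  set s := sSup S with hs
  have hst : s ≤ t := csSup_le ⟨0, h0⟩ fun _ h => h.1
  have hspos : 0 < s := by
    obtain ⟨σ, hσ, h1, h2, _⟩ := Reachable.exists_next hZ hε ht .zero hn
    exact h1.trans_le (le_csSup hbdd ⟨h2.le, hσ⟩)
  have hsS : Reachable Z ε t s := by
    have h1 : ∀ᶠ r in 𝓝[<] s, Z r ∈ Metric.ball (Function.leftLim Z s) (ε / 2) :=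
      (hZ.tendsto_leftLim s).eventually (Metric.ball_mem_nhds _ (half_pos hε))
    obtain ⟨u, hu, husub⟩ := (mem_nhdsLT_iff_exists_Ioo_subset' hspos).1 h1
    obtain ⟨τ, hτS, huτ⟩ := exists_lt_of_lt_csSup ⟨0, h0⟩ hu
    rcases eq_or_lt_of_le (le_csSup hbdd hτS) with hτs | hτs
    · rw [hs, ← hτs]; exact hτS.2
    obtain ⟨σ, hσ, h3, h4, h5⟩ := Reachable.exists_next hZ hε (hτs.trans_le hst) hτS.2 hn
    rcases eq_or_lt_of_le (le_csSup hbdd (show σ ∈ S from ⟨h4.le, hσ⟩)) with hσs | hσs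
    · rw [hs, ← hσs]; exact hσ
    obtain ⟨r, hr, hrε⟩ := h5 s hσs
    have h6 : Z r ∈ Metric.ball (Function.leftLim Z s) (ε / 2) :=
      husub ⟨huτ.trans (h3.trans_le hr.1), hr.2⟩
    have h7 : Z τ ∈ Metric.ball (Function.leftLim Z s) (ε / 2) := husub ⟨huτ, hτs⟩
    have h8 : dist (Z r) (Z τ) < ε := by
      have := dist_triangle_right (Z r) (Z τ) (Function.leftLim Z s)
      rw [Metric.mem_ball] at h6 h7
      linarith
    rw [dist_eq_norm] at h8
    exact absurd h8 (not_lt.2 hrε.le)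
  have hslt : s < t := lt_of_le_of_ne hst fun h => hn (by rw [← h]; rw [h] at hsS ⊢; exact hsS)
  obtain ⟨σ, hσ, h1, h2, _⟩ := Reachable.exists_next hZ hε hslt hsS hn
  exact absurd (le_csSup hbdd (show σ ∈ S from ⟨h2.le, hσ⟩)) (not_le.2 h1)

end ConditionC

/-! ### Strong and weak convergence -/

section Mode

variable {V W : Type*} [NormedAddCommGroup V] [NormedSpace ℝ V]
  [NormedAddCommGroup W] [NormedSpace ℝ W] {m : Mode} {x y : ℕ → V} {a b : V}

lemma Mode.Converges.of_tendsto (m : Mode) (h : Tendsto x atTop (𝓝 a)) : m.Converges x a := by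
  cases m
  · exact h
  · exact fun φ => (φ.continuous.tendsto a).comp h

lemma Mode.Converges.congr (h : m.Converges x a) (hxy : ∀ n, x n = y n) : m.Converges y a := by
  rwa [← funext hxy]

lemma Mode.Converges.map (h : m.Converges x a) (L : V →L[ℝ] W) :
    m.Converges (fun n => L (x n)) (L a) := by
  cases m
  · exact (L.continuous.tendsto a).comp h
  · exact fun φ => h (φ.comp L)

lemma Mode.Converges.add (hx : m.Converges x a) (hy : m.Converges y b) :
    m.Converges (fun n => x n + y n) (a + b) := by
  cases m
  · exact Tendsto.add hx hy
  · intro φ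
    simp only [map_add]
    exact (hx φ).add (hy φ)

lemma Mode.Converges.sub (hx : m.Converges x a) (hy : m.Converges y b) :
    m.Converges (fun n => x n - y n) (a - b) := by
  cases m
  · exact Tendsto.sub hx hy
  · intro φ
    simp only [map_sub]
    exact (hx φ).sub (hy φ)

lemma Mode.Converges.unique (hx : m.Converges x a) (hy : m.Converges x b) : a = b := by
  cases m
  · exact tendsto_nhds_unique hx hy
  · by_contra hne
    obtain ⟨φ, hφ⟩ := SeparatingDual.exists_separating_of_ne (R := ℝ) hne
    exact hφ (tendsto_nhds_unique (hx φ) (hy φ))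

/-- Limits may be computed up to uniformly small errors. -/
lemma Mode.Converges.of_approx (h : ∀ η : ℝ, 0 < η → ∃ (y : ℕ → V) (b : V), m.Converges y b ∧
    (∀ n, ‖x n - y n‖ ≤ η) ∧ ‖a - b‖ ≤ η) : m.Converges x a := by
  cases m
  · refine Metric.tendsto_nhds.2 fun ε hε => ?_
    obtain ⟨y, b, hy, hxy, hab⟩ := h (ε / 4) (by positivity)
    filter_upwards [Metric.tendsto_nhds.1 hy (ε / 4) (by positivity)] with n hn
    rw [dist_eq_norm] at hn ⊢
    have h1 : x n - a = (x n - y n) + (y n - b) - (a - b) := by abel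
    have h2 := norm_sub_le ((x n - y n) + (y n - b)) (a - b)
    have h3 := norm_add_le (x n - y n) (y n - b)
    rw [h1]
    linarith [hxy n]
  · intro φ
    refine Metric.tendsto_nhds.2 fun ε hε => ?_
    set η : ℝ := ε / (4 * (‖φ‖ + 1)) with hη
    have hηpos : 0 < η := by positivity
    have hφη : ‖φ‖ * η ≤ ε / 4 := by
      rw [hη, ← mul_div_assoc, div_le_iff₀ (by positivity)]
      nlinarith [norm_nonneg φ]
    obtain ⟨y, b, hy, hxy, hab⟩ := h η hηpos
    filter_upwards [Metric.tendsto_nhds.1 (hy φ) (ε / 4) (by positivity)] with n hn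
    rw [dist_eq_norm] at hn ⊢
    have h1 : φ (x n) - φ a = φ (x n - y n) + (φ (y n) - φ b) - φ (a - b) := by
      simp only [map_sub]; ring
    have h2 := norm_sub_le (φ (x n - y n) + (φ (y n) - φ b)) (φ (a - b))
    have h3 := norm_add_le (φ (x n - y n)) (φ (y n) - φ b)
    have h4 := (φ.le_opNorm (x n - y n)).trans
      ((mul_le_mul_of_nonneg_left (hxy n) (norm_nonneg φ)).trans hφη)
    have h5 := (φ.le_opNorm (a - b)).trans
      ((mul_le_mul_of_nonneg_left hab (norm_nonneg φ)).trans hφη)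
    rw [h1]
    linarith

end Mode

/-! ### Riemann sums -/

section Riemann

variable {V W U : Type*} [NormedAddCommGroup V] [CompleteSpace V]
  [NormedAddCommGroup W] [NormedSpace ℝ W] [NormedAddCommGroup U] [NormedSpace ℝ U]
  {π : ℕ → TimePartition} {Z : ℝ≥0 → V} {Φ : V → W →L[ℝ] U}

omit [CompleteSpace V] in
lemma norm_leftLim_sub_le (hZ : IsCadlag Z) {τ σ s : ℝ≥0} {c : V} {ε : ℝ}
    (h : ∀ r ∈ Ico τ σ, ‖Z r - c‖ ≤ ε) (hs : s ∈ Ioc τ σ) : ‖Function.leftLim Z s - c‖ ≤ ε := by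
  have := nhdsLT_neBot (zero_le.trans_lt hs.1)
  refine le_of_tendsto ((hZ.tendsto_leftLim s).sub_const c).norm ?_
  filter_upwards [Ioo_mem_nhdsLT hs.1] with r hr
  exact h r ⟨hr.1.le, hr.2.trans_le hs.2⟩

lemma exists_bound_comp (hZ : IsCadlag Z) (hΦ : ContinuousOnCompacts Φ) (t : ℝ≥0) :
    ∃ M, ∀ z ∈ closure (Z '' Iic t), ‖Φ z‖ ≤ M :=
  (hZ.isCompact_closure_image t).exists_bound_of_continuousOn (hΦ _ (hZ.isCompact_closure_image t))

lemma exists_bound_comp_leftLim (hZ : IsCadlag Z) (hΦ : ContinuousOnCompacts Φ) (t : ℝ≥0) :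
    ∃ M, ∀ s, s ≤ t → ‖Φ (Function.leftLim Z s)‖ ≤ M :=
  let ⟨M, hM⟩ := exists_bound_comp hZ hΦ t
  ⟨M, fun _ hs => hM _ (hZ.leftLim_mem_closure_image hs)⟩

/-- The integrand `Φ(Z_{s-})` is the pointwise limit of functions that are constant on the intervals
of the partitions; this makes it strongly measurable although the target need not be separable. -/
lemma stronglyMeasurable_comp_leftLim (hZ : IsCadlag Z) (hleft : ApproximatesFromLeft π Z)
    (hΦ : ContinuousOnCompacts Φ) (t : ℝ≥0) :
    StronglyMeasurable ((Ioc 0 t).indicator fun s => Φ (Function.leftLim Z s)) := by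
  refine stronglyMeasurable_of_tendsto atTop (f := fun n =>
    (Ioc 0 t).indicator fun s => Φ (Z ((π n).pt ((π n).cnt s - 1)))) (fun n => ?_) ?_
  · have h1 : Measurable (π n).cnt := (π n).cnt_mono.measurable
    have h2 : StronglyMeasurable fun k : ℕ => Φ (Z ((π n).pt (k - 1))) :=
      StronglyMeasurable.of_discrete
    exact (h2.comp_measurable h1).indicator measurableSet_Ioc
  · refine tendsto_pi_nhds.2 fun s => ?_
    by_cases hs : s ∈ Ioc 0 t
    · simp only [indicator_of_mem hs, (π _).cnt_eq_idx_add_one hs.1, Nat.add_sub_cancel]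
      exact hZ.tendsto_comp_of_continuousOnCompacts hΦ (hleft s hs.1)
        (Eventually.of_forall fun n => mem_closure_image Z (((π n).lower_lt hs.1).le.trans hs.2))
        (hZ.leftLim_mem_closure_image hs.2)
    · simp only [indicator_of_notMem hs]
      exact tendsto_const_nhds

variable [CompleteSpace W]

lemma stieltjesIntegrable_comp_leftLim (hZ : IsCadlag Z) (hleft : ApproximatesFromLeft π Z)
    (hΦ : ContinuousOnCompacts Φ) {Q : ℝ≥0 → W} (hc : IsCadlag Q) (hQ : HasFiniteVariation Q)
    (t : ℝ≥0) : StieltjesIntegrable (fun s => Φ (Function.leftLim Z s)) Q hQ t := by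
  obtain ⟨M, hM⟩ := exists_bound_comp_leftLim hZ hΦ t
  exact stieltjesIntegrable_of_bound hc.1 hQ (stronglyMeasurable_comp_leftLim hZ hleft hΦ t)
    fun s hs => hM s hs.2

/-- If the partial sums of an array `q n i`, taken over the partition intervals starting before `τ`,
converge to `Q τ - Q 0` at all regular times `τ` of `Z`, then the weighted sums of `q` with weights
`Φ(Z)` at the left endpoints converge to the Stieltjes integral of `Φ(Z_-)` against `Q`. -/
theorem converges_sum_comp [CompleteSpace U] {m : Mode} (hZ : IsCadlag Z)
    (hleft : ApproximatesFromLeft π Z)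
    (hΦ : ContinuousOnCompacts Φ) {Q : ℝ≥0 → W} (hc : IsCadlag Q) (hQ : HasFiniteVariation Q)
    {t : ℝ≥0} {q : ℕ → ℕ → W} {M : ℝ}
    (hM : ∀ n, ∑ i ∈ Finset.range ((π n).cnt t), ‖q n i‖ ≤ M)
    (hq : ∀ τ, 0 < τ → τ ≤ t → (τ = t ∨ IsRegularTime Z τ) →
      m.Converges (fun n => ∑ i ∈ Finset.range ((π n).cnt τ), q n i) (Q τ - Q 0)) :
    m.Converges (fun n => ∑ i ∈ Finset.range ((π n).cnt t), Φ (Z ((π n).pt i)) (q n i))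
      (stieltjesIntegral (fun s => Φ (Function.leftLim Z s)) Q hQ t) := by
  have hint := stieltjesIntegrable_comp_leftLim hZ hleft hΦ hc hQ
  have hM0 : 0 ≤ M := (Finset.sum_nonneg fun _ _ => norm_nonneg _).trans (hM 0)
  have hv0 := hQ.pathVariation_nonneg t
  refine Mode.Converges.of_approx fun η hη => ?_
  set K : ℝ := η / (M + pathVariation Q t + 1) with hK
  have hKpos : 0 < K := by positivity
  have hcomp := hZ.isCompact_closure_image t
  obtain ⟨δ, hδ, hδK⟩ := Metric.uniformContinuousOn_iff.1
    (hcomp.uniformContinuousOn_of_continuous (hΦ _ hcomp)) K hKpos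
  have hclose : ∀ z ∈ closure (Z '' Iic t), ∀ τ ≤ t, ‖z - Z τ‖ ≤ δ / 2 → ‖Φ z - Φ (Z τ)‖ ≤ K := by
    intro z hz τ hτ h
    rw [← dist_eq_norm]
    refine (hδK z hz (Z τ) (mem_closure_image Z hτ) ?_).le
    rw [dist_eq_norm]; linarith
  have key : ∀ τ, Reachable Z (δ / 2) t τ → τ ≤ t ∧
      m.Converges (fun n => ∑ i ∈ Finset.range ((π n).cnt τ), q n i) (Q τ - Q 0) ∧
      ∃ (y : ℕ → U) (b : U), m.Converges y b ∧
        (∀ n, ‖∑ i ∈ Finset.range ((π n).cnt τ), Φ (Z ((π n).pt i)) (q n i) - y n‖ ≤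
          K * ∑ i ∈ Finset.range ((π n).cnt τ), ‖q n i‖) ∧
        ‖stieltjesIntegral (fun s => Φ (Function.leftLim Z s)) Q hQ τ - b‖ ≤
          K * pathVariation Q τ := by
    intro τ hτ
    induction hτ with
    | zero =>
      refine ⟨zero_le, ?_, fun _ => 0, 0, .of_tendsto m tendsto_const_nhds, fun n => ?_, ?_⟩
      · rw [sub_self]
        refine (Mode.Converges.of_tendsto m tendsto_const_nhds).congr fun n => ?_
        simp [(π n).cnt_zero]
      · simp [(π n).cnt_zero]
      · simp [stieltjesIntegral_zero, pathVariation_zero]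
    | @step τ σ _ hτσ hσt hσ hosc ih =>
      obtain ⟨hτt, hTτ, y, b, hyb, hy, hb⟩ := ih
      have hTσ := hq σ (zero_le.trans_lt hτσ) hσt hσ
      refine ⟨hσt, hTσ, fun n => y n + Φ (Z τ) (∑ i ∈ Finset.range ((π n).cnt σ), q n i -
        ∑ i ∈ Finset.range ((π n).cnt τ), q n i), b + Φ (Z τ) (Q σ - Q 0 - (Q τ - Q 0)),
        hyb.add ((hTσ.sub hTτ).map _), fun n => ?_, ?_⟩
      · have hIco : ‖∑ i ∈ Finset.Ico ((π n).cnt τ) ((π n).cnt σ),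
            (Φ (Z ((π n).pt i)) - Φ (Z τ)) (q n i)‖ ≤
            K * ∑ i ∈ Finset.Ico ((π n).cnt τ) ((π n).cnt σ), ‖q n i‖ := by
          rw [Finset.mul_sum]
          refine norm_sum_le_of_le _ fun i hi => ?_
          have h1 := Finset.mem_Ico.1 hi
          have h2 : (π n).pt i ∈ Ico τ σ := ⟨(π n).cnt_le_iff.1 h1.1, (π n).lt_cnt_iff.1 h1.2⟩
          refine (ContinuousLinearMap.le_opNorm _ _).trans ?_
          gcongr
          exact hclose _ (mem_closure_image Z (h2.2.le.trans hσt)) τ hτt (hosc _ h2)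
        have h3 : ∑ i ∈ Finset.range ((π n).cnt σ), Φ (Z ((π n).pt i)) (q n i) -
            (y n + Φ (Z τ) (∑ i ∈ Finset.range ((π n).cnt σ), q n i -
              ∑ i ∈ Finset.range ((π n).cnt τ), q n i)) =
            (∑ i ∈ Finset.range ((π n).cnt τ), Φ (Z ((π n).pt i)) (q n i) - y n) +
            ∑ i ∈ Finset.Ico ((π n).cnt τ) ((π n).cnt σ),
              (Φ (Z ((π n).pt i)) - Φ (Z τ)) (q n i) := by
          rw [← Finset.sum_range_add_sum_Ico _ ((π n).cnt_mono hτσ.le),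
            ← Finset.sum_range_add_sum_Ico (q n) ((π n).cnt_mono hτσ.le), add_sub_cancel_left,
            map_sum]
          simp only [_root_.sub_apply, Finset.sum_sub_distrib]
          abel
        rw [h3, ← Finset.sum_range_add_sum_Ico (fun i => ‖q n i‖) ((π n).cnt_mono hτσ.le), mul_add]
        exact (norm_add_le _ _).trans (add_le_add (hy n) hIco)
      · have h4 := norm_stieltjesIntegral_sub_le hc.1 hQ hint hτσ.le (Φ (Z τ)) hKpos.le
          (fun s hs => hclose _ (hZ.leftLim_mem_closure_image (hs.2.trans hσt)) τ hτt
            (norm_leftLim_sub_le hZ hosc hs))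
        rw [sub_sub_sub_cancel_right]
        have h5 := norm_add_le
          (stieltjesIntegral (fun s => Φ (Function.leftLim Z s)) Q hQ τ - b)
          (stieltjesIntegral (fun s => Φ (Function.leftLim Z s)) Q hQ σ -
            stieltjesIntegral (fun s => Φ (Function.leftLim Z s)) Q hQ τ - Φ (Z τ) (Q σ - Q τ))
        calc _ = _ := by congr 1; abel
          _ ≤ _ := h5
          _ ≤ K * pathVariation Q τ + K * (pathVariation Q σ - pathVariation Q τ) :=
            add_le_add hb h4
          _ = _ := by ring
  obtain ⟨-, -, y, b, hyb, hy, hb⟩ := key t (reachable_self hZ (half_pos hδ) t)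
  have hKη : K * (M + pathVariation Q t + 1) = η := by rw [hK]; field_simp
  refine ⟨y, b, hyb, fun n => (hy n).trans ?_, hb.trans ?_⟩
  · calc K * ∑ i ∈ Finset.range ((π n).cnt t), ‖q n i‖ ≤ K * (M + pathVariation Q t + 1) := by
          gcongr; linarith [hM n]
      _ = η := hKη
  · calc K * pathVariation Q t ≤ K * (M + pathVariation Q t + 1) := by gcongr; linarith
      _ = η := hKη

lemma TimePartition.pt_cnt (p : TimePartition) {τ : ℝ≥0} (hτ : 0 < τ) :
    p.pt (p.cnt τ) = p.upper τ := by
  rw [p.cnt_eq_idx_add_one hτ]; rfl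

/-- Left Riemann sums against a path of finite variation. -/
theorem tendsto_leftSum_of_finiteVariation [CompleteSpace U] (hZ : IsCadlag Z)
    (hC : ConditionC π Z) (hleft : ApproximatesFromLeft π Z)
    (hΦ : ContinuousOnCompacts Φ) {A : ℝ≥0 → W} (hA : IsCadlag A) (hAV : HasFiniteVariation A)
    (hZA : ConstantWhere Z A) (t : ℝ≥0) :
    Tendsto (fun n => ∑ i ∈ Finset.range ((π n).cnt t), Φ (Z ((π n).pt i)) ((π n).incr A t i)) atTop
      (𝓝 (stieltjesIntegral (fun s => Φ (Function.leftLim Z s)) A hAV t)) := by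
  refine converges_sum_comp (m := .strong) hZ hleft hΦ hA hAV
    (fun n => (π n).sum_norm_incr_le hAV t _) fun τ hτ hτt hreg => ?_
  simp only [TimePartition.sum_incr, (π _).pt_cnt hτ]
  exact (hC.tendsto_upper hA.1 hZA hτ hτt hreg).sub_const (A 0)

/-- Weighted sums of the squared increments of a path with quadratic variation `Q`. -/
theorem converges_sum_quadratic {X' : Type*} [NormedAddCommGroup X'] [NormedSpace ℝ X']
    [CompleteSpace U] {m : Mode} {B : X' →L[ℝ] X' →L[ℝ] W} {X : ℝ≥0 → X'} {Q : ℝ≥0 → W}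
    (hZ : IsCadlag Z) (hC : ConditionC π Z) (hleft : ApproximatesFromLeft π Z)
    (hΦ : ContinuousOnCompacts Φ) (hX : IsCadlag X) (hZX : ConstantWhere Z X)
    (hXleft : ApproximatesFromLeft π X) (hX2 : HasFiniteTwoVariation π X)
    (hQ : IsQuadraticVariation m B π X Q) (t : ℝ≥0) :
    m.Converges (fun n => ∑ i ∈ Finset.range ((π n).cnt t),
        Φ (Z ((π n).pt i)) (B ((π n).incr X t i) ((π n).incr X t i)))
      (stieltjesIntegral (fun s => Φ (Function.leftLim Z s)) Q hQ.finiteVariation t) := by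
  obtain ⟨M, hM⟩ := hX2 t
  have hQ0 : Q 0 = 0 := by
    refine (hQ.converges 0).unique ?_
    refine (Mode.Converges.of_tendsto m tendsto_const_nhds).congr fun n => ?_
    simp [TimePartition.discreteQV_eq_sum, (π n).cnt_zero]
  refine converges_sum_comp hZ hleft hΦ hQ.cadlag hQ.finiteVariation (M := ‖B‖ * M)
    (fun n => ?_) fun τ hτ hτt hreg => ?_
  · have h1 : (π n).discreteScalarQV X t ≤ M := hM ⟨n, rfl⟩
    rw [TimePartition.discreteScalarQV_eq_sum] at h1
    calc ∑ i ∈ Finset.range ((π n).cnt t), ‖B ((π n).incr X t i) ((π n).incr X t i)‖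
        ≤ ∑ i ∈ Finset.range ((π n).cnt t), ‖B‖ * ‖(π n).incr X t i‖ ^ 2 :=
          Finset.sum_le_sum fun i _ => (B.le_opNorm₂ _ _).trans_eq (by ring)
      _ = ‖B‖ * ∑ i ∈ Finset.range ((π n).cnt t), ‖(π n).incr X t i‖ ^ 2 := by
          rw [Finset.mul_sum]
      _ ≤ ‖B‖ * M := by gcongr
  · have hlow := hXleft τ hτ
    have hup := hC.tendsto_upper hX.1 hZX hτ hτt hreg
    have hB : Continuous fun p : X' × X' => B p.1 p.2 :=
      B.isBoundedBilinearMap.continuous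
    -- stopping at `t` instead of `τ` only changes the term of the interval containing `τ`
    have hdiff : Tendsto (fun n =>
        B (X (min ((π n).upper τ) t) - X ((π n).lower τ))
          (X (min ((π n).upper τ) t) - X ((π n).lower τ)) -
        B (X τ - X ((π n).lower τ)) (X τ - X ((π n).lower τ))) atTop (𝓝 0) := by
      have h1 := hup.sub hlow
      have h2 := (tendsto_const_nhds (x := X τ)).sub hlow
      have h3 := (hB.tendsto _).comp (h1.prodMk_nhds h1)
      have h4 := (hB.tendsto _).comp (h2.prodMk_nhds h2)
      have h5 := h3.sub h4
      rwa [sub_self] at h5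
    have hconv := (hQ.converges τ).add (Mode.Converges.of_tendsto m hdiff)
    rw [hQ0, sub_zero]
    rw [add_zero] at hconv
    refine hconv.congr fun n => ?_
    rw [TimePartition.discreteQV_eq_sum, (π n).cnt_eq_idx_add_one hτ, Finset.sum_range_succ,
      Finset.sum_range_succ]
    have h6 : ∀ i ∈ Finset.range ((π n).idx τ), (π n).incr X τ i = (π n).incr X t i := by
      intro i hi
      have h7 : (π n).pt (i + 1) ≤ τ :=
        ((π n).strictMono.monotone (Finset.mem_range.1 hi)).trans ((π n).lower_lt hτ).le
      have h8 : (π n).pt i ≤ τ := ((π n).strictMono.monotone (Nat.le_succ i)).trans h7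
      rw [TimePartition.incr, TimePartition.incr, min_eq_left h7, min_eq_left h8,
        min_eq_left (h7.trans hτt), min_eq_left (h8.trans hτt)]
    rw [Finset.sum_congr rfl fun i hi => by rw [h6 i hi]]
    have h9 : (π n).incr X τ ((π n).idx τ) = X τ - X ((π n).lower τ) := by
      rw [(π n).incr_eq ((π n).idx_lt_cnt hτ le_rfl)]
      change X (min ((π n).upper τ) τ) - _ = _
      rw [min_eq_right ((π n).le_upper hτ)]
      rfl
    have h10 : (π n).incr X t ((π n).idx τ) = X (min ((π n).upper τ) t) - X ((π n).lower τ) :=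
      (π n).incr_eq ((π n).idx_lt_cnt hτ hτt)
    rw [h9, h10]
    abel

end Riemann

/-! ### Taylor's formula for Gâteaux differentiable functions -/

section Taylor

section Line

variable {V W T : Type*} [NormedAddCommGroup V] [NormedSpace ℝ V]
  [NormedAddCommGroup W] [NormedSpace ℝ W] [NormedAddCommGroup T] [NormedSpace ℝ T]
  {g : V → W} {g' : V → V →L[ℝ] W}

lemma HasGateauxDerivAt.hasDerivAt_line {x h : V} {θ : ℝ} {L : V →L[ℝ] W}
    (hg : HasGateauxDerivAt g L (x + θ • h)) :
    HasDerivAt (fun t : ℝ => g (x + t • h)) (L h) θ := by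
  have h1 : HasDerivAt (fun t : ℝ => g (x + θ • h + t • h)) (L h) (θ - θ) := by
    rw [sub_self]; exact hg h
  refine (h1.comp_sub_const θ θ).congr_of_eventuallyEq (Eventually.of_forall fun t => ?_)
  change g _ = g _
  congr 1
  rw [sub_smul]; abel

lemma norm_sub_sub_le_of_gateaux {x h : V} {L : V →L[ℝ] W} {K : ℝ}
    (hg : ∀ y, HasGateauxDerivAt g (g' y) y)
    (hK : ∀ θ ∈ Icc (0 : ℝ) 1, ‖g' (x + θ • h) h - L h‖ ≤ K) :
    ‖g (x + h) - g x - L h‖ ≤ K := by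
  have hd : ∀ θ ∈ Icc (0 : ℝ) 1, HasDerivWithinAt (fun t : ℝ => g (x + t • h) - t • L h)
      (g' (x + θ • h) h - L h) (Icc 0 1) θ := by
    intro θ _
    have h1 := (hg (x + θ • h)).hasDerivAt_line
    have h2 : HasDerivAt (fun t : ℝ => t • L h) (L h) θ := by
      simpa using (hasDerivAt_id θ).smul_const (L h)
    exact (h1.sub h2).hasDerivWithinAt
  have h3 := norm_image_sub_le_of_norm_deriv_le_segment_01' hd
    fun θ hθ => hK θ (Ico_subset_Icc_self hθ)
  convert h3 using 2
  simp only [one_smul, zero_smul, add_zero, sub_zero]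
  abel

/-- Second-order Taylor estimate. The second derivative `g''` factors through a bounded bilinear map
`B` of norm at most one, and only the oscillation of the factor `D` along the segment enters. -/
lemma norm_taylor_two_le {g'' : V → V →L[ℝ] V →L[ℝ] W} {B : V →L[ℝ] V →L[ℝ] T}
    {D : V → T →L[ℝ] W} (hB : ∀ v w, ‖B v w‖ ≤ ‖v‖ * ‖w‖) (hD : ∀ x v w, D x (B v w) = g'' x v w)
    (hg : ∀ y, HasGateauxDerivAt g (g' y) y) (hg' : ∀ y, HasGateauxDerivAt g' (g'' y) y)
    {x h : V} {K : ℝ} (hK : ∀ θ ∈ Icc (0 : ℝ) 1, ‖D (x + θ • h) - D x‖ ≤ K) :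
    ‖g (x + h) - g x - g' x h - (1 / 2 : ℝ) • D x (B h h)‖ ≤ K * ‖h‖ ^ 2 := by
  have hK0 : 0 ≤ K := (norm_nonneg _).trans (hK 0 (by simp))
  have hfirst : ∀ θ ∈ Icc (0 : ℝ) 1,
      ‖g' (x + θ • h) - g' x - g'' x (θ • h)‖ ≤ K * ‖h‖ := by
    intro θ hθ
    refine norm_sub_sub_le_of_gateaux hg' fun θ' hθ' => ?_
    refine ContinuousLinearMap.opNorm_le_bound _ (by positivity) fun w => ?_
    have h1 : (g'' (x + θ' • θ • h) (θ • h) - g'' x (θ • h)) w =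
        (D (x + (θ' * θ) • h) - D x) (B (θ • h) w) := by
      rw [_root_.sub_apply, _root_.sub_apply, hD, hD, smul_smul]
    rw [h1]
    have hθθ : θ' * θ ∈ Icc (0 : ℝ) 1 :=
      ⟨mul_nonneg hθ'.1 hθ.1, mul_le_one₀ hθ'.2 hθ.1 hθ.2⟩
    calc ‖(D (x + (θ' * θ) • h) - D x) (B (θ • h) w)‖
        ≤ ‖D (x + (θ' * θ) • h) - D x‖ * ‖B (θ • h) w‖ := ContinuousLinearMap.le_opNorm _ _
      _ ≤ K * (‖h‖ * ‖w‖) := by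
          refine mul_le_mul (hK _ hθθ) ((hB _ _).trans ?_) (norm_nonneg _) hK0
          rw [norm_smul, Real.norm_of_nonneg hθ.1]
          gcongr
          exact mul_le_of_le_one_left (norm_nonneg _) hθ.2
      _ = K * ‖h‖ * ‖w‖ := by ring
  have hd : ∀ θ ∈ Icc (0 : ℝ) 1, HasDerivWithinAt
      (fun t : ℝ => g (x + t • h) - t • g' x h - (t ^ 2 / 2) • D x (B h h))
      (g' (x + θ • h) h - g' x h - θ • D x (B h h)) (Icc 0 1) θ := by
    intro θ _
    have h1 := (hg (x + θ • h)).hasDerivAt_line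
    have h2 : HasDerivAt (fun t : ℝ => t • g' x h) (g' x h) θ := by
      simpa using (hasDerivAt_id θ).smul_const (g' x h)
    have h3 : HasDerivAt (fun t : ℝ => (t ^ 2 / 2) • D x (B h h)) (θ • D x (B h h)) θ := by
      have h4 : HasDerivAt (fun t : ℝ => t ^ 2 / 2) θ θ := by
        have := (hasDerivAt_pow 2 θ).div_const 2
        simpa using this
      exact h4.smul_const _
    exact ((h1.sub h2).sub h3).hasDerivWithinAt
  have h5 := norm_image_sub_le_of_norm_deriv_le_segment_01' (C := K * ‖h‖ ^ 2) hd fun θ hθ => by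
    have h6 : g' (x + θ • h) h - g' x h - θ • D x (B h h) =
        (g' (x + θ • h) - g' x - g'' x (θ • h)) h := by
      rw [_root_.sub_apply, _root_.sub_apply, hD]
      simp
    rw [h6]
    calc _ ≤ ‖g' (x + θ • h) - g' x - g'' x (θ • h)‖ * ‖h‖ := ContinuousLinearMap.le_opNorm _ _
      _ ≤ K * ‖h‖ * ‖h‖ := by gcongr; exact hfirst θ (Ico_subset_Icc_self hθ)
      _ = K * ‖h‖ ^ 2 := by ring
  convert h5 using 2
  simp only [one_smul, zero_smul, add_zero, sub_zero]
  norm_num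
  abel

end Line

variable {E F G T : Type*} [NormedAddCommGroup E] [NormedSpace ℝ E]
  [NormedAddCommGroup F] [NormedSpace ℝ F] [NormedAddCommGroup G] [NormedSpace ℝ G]
  [NormedAddCommGroup T] [NormedSpace ℝ T]

/-- The remainder of the Taylor expansion of `f` at `z` in the direction of `z'`, of first order in
the first variable and of second order in the second one. -/
def taylorRemainder (B : E →L[ℝ] E →L[ℝ] T) (f : F × E → G) (Da : F × E → F →L[ℝ] G)
    (Dx : F × E → E →L[ℝ] G) (Dα : F × E → T →L[ℝ] G) (z z' : F × E) : G :=
  f z' - f z - Dx z (z'.2 - z.2) - Da z (z'.1 - z.1) -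
    (1 / 2 : ℝ) • Dα z (B (z'.2 - z.2) (z'.2 - z.2))

/-- The union of the segments joining the points of a set. -/
def segmentHull (K : Set E) : Set E :=
  (fun p : (E × E) × ℝ => p.1.1 + p.2 • (p.1.2 - p.1.1)) '' ((K ×ˢ K) ×ˢ Icc (0 : ℝ) 1)

lemma isCompact_segmentHull {K : Set E} (hK : IsCompact K) : IsCompact (segmentHull K) :=
  ((hK.prod hK).prod isCompact_Icc).image (by fun_prop)

lemma mem_segmentHull {K : Set E} {x y : E} (hx : x ∈ K) (hy : y ∈ K) {θ : ℝ}
    (hθ : θ ∈ Icc (0 : ℝ) 1) : x + θ • (y - x) ∈ segmentHull K :=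
  ⟨((x, y), θ), ⟨⟨hx, hy⟩, hθ⟩, rfl⟩

lemma subset_segmentHull (K : Set E) : K ⊆ segmentHull K := fun x hx => by
  simpa using mem_segmentHull hx hx (θ := 0) (by simp)

variable {B : E →L[ℝ] E →L[ℝ] T} {f : F × E → G} {Da : F × E → F →L[ℝ] G}
  {Dx : F × E → E →L[ℝ] G} {Dxx : F × E → E →L[ℝ] E →L[ℝ] G} {Dα : F × E → T →L[ℝ] G}
  (hB : ∀ v w, ‖B v w‖ ≤ ‖v‖ * ‖w‖)
  (hDa : ∀ a x, HasGateauxDerivAt (fun b => f (b, x)) (Da (a, x)) a)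
  (hDx : ∀ a x, HasGateauxDerivAt (fun y => f (a, y)) (Dx (a, x)) x)
  (hDxx : ∀ a x, HasGateauxDerivAt (fun y => Dx (a, y)) (Dxx (a, x)) x)
  (hDaK : ContinuousOnCompacts Da) (hDxK : ContinuousOnCompacts Dx)
  (hDα : ∀ p v w, Dα p (B v w) = Dxx p v w) (hDαK : ContinuousOnCompacts Dα)
include hB hDa hDx hDxx hDaK hDxK hDα hDαK

/-- Uniform Taylor estimates on products of compact sets. -/
theorem exists_taylor_bounds {KA : Set F} {KX : Set E} (hKA : IsCompact KA) (hKX : IsCompact KX) :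
    ∃ M : ℝ, 0 ≤ M ∧ (∀ z ∈ KA ×ˢ KX, ∀ z' ∈ KA ×ˢ KX,
      ‖f z' - f z‖ ≤ M * (‖z'.1 - z.1‖ + ‖z'.2 - z.2‖) ∧
      ‖f z' - f z - Dx z (z'.2 - z.2)‖ ≤ M * (‖z'.1 - z.1‖ + ‖z'.2 - z.2‖ ^ 2) ∧
      ‖taylorRemainder B f Da Dx Dα z z'‖ ≤ M * (‖z'.1 - z.1‖ + ‖z'.2 - z.2‖ ^ 2)) ∧
    ∀ ε : ℝ, 0 < ε → ∃ δ : ℝ, 0 < δ ∧ ∀ z ∈ KA ×ˢ KX, ∀ z' ∈ KA ×ˢ KX, ‖z' - z‖ < δ →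
      ‖taylorRemainder B f Da Dx Dα z z'‖ ≤ ε * (‖z'.1 - z.1‖ + ‖z'.2 - z.2‖ ^ 2) := by
  have hS : IsCompact (segmentHull KA ×ˢ segmentHull KX) :=
    (isCompact_segmentHull hKA).prod (isCompact_segmentHull hKX)
  obtain ⟨N₁, hN₁⟩ := hS.exists_bound_of_continuousOn (hDaK _ hS)
  obtain ⟨N₂, hN₂⟩ := hS.exists_bound_of_continuousOn (hDxK _ hS)
  obtain ⟨N₃, hN₃⟩ := hS.exists_bound_of_continuousOn (hDαK _ hS)
  set N : ℝ := max (max N₁ N₂) (max N₃ 0) with hN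
  have hN0 : 0 ≤ N := (le_max_right _ _).trans (le_max_right _ _)
  replace hN₁ : ∀ z ∈ segmentHull KA ×ˢ segmentHull KX, ‖Da z‖ ≤ N := fun z hz =>
    (hN₁ z hz).trans ((le_max_left _ _).trans (le_max_left _ _))
  replace hN₂ : ∀ z ∈ segmentHull KA ×ˢ segmentHull KX, ‖Dx z‖ ≤ N := fun z hz =>
    (hN₂ z hz).trans ((le_max_right _ _).trans (le_max_left _ _))
  replace hN₃ : ∀ z ∈ segmentHull KA ×ˢ segmentHull KX, ‖Dα z‖ ≤ N := fun z hz =>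
    (hN₃ z hz).trans ((le_max_left _ _).trans (le_max_right _ _))
  have hmem : ∀ {a a' : F} {x x' : E}, a ∈ KA → a' ∈ KA → x ∈ KX → x' ∈ KX →
      ∀ θ ∈ Icc (0 : ℝ) 1, ∀ θ' ∈ Icc (0 : ℝ) 1,
      (a + θ • (a' - a), x + θ' • (x' - x)) ∈ segmentHull KA ×ˢ segmentHull KX :=
    fun ha ha' hx hx' θ hθ θ' hθ' => ⟨mem_segmentHull ha ha' hθ, mem_segmentHull hx hx' hθ'⟩
  -- the increment in the first variable
  have hfa : ∀ {a a' : F} {x' : E} (L : F →L[ℝ] G) {K : ℝ},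
      (∀ θ ∈ Icc (0 : ℝ) 1, ‖Da (a + θ • (a' - a), x') - L‖ ≤ K) →
      ‖f (a', x') - f (a, x') - L (a' - a)‖ ≤ K * ‖a' - a‖ := by
    intro a a' x' L K hK
    have h1 := norm_sub_sub_le_of_gateaux (g := fun b => f (b, x')) (g' := fun b => Da (b, x'))
      (x := a) (h := a' - a) (L := L) (K := K * ‖a' - a‖) (fun b => hDa b x') fun θ hθ => by
        rw [← _root_.sub_apply]
        exact (ContinuousLinearMap.le_opNorm _ _).trans (by gcongr; exact hK θ hθ)
    simpa only [add_sub_cancel] using h1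
  have hfx : ∀ {a : F} {x x' : E} {K : ℝ},
      (∀ θ ∈ Icc (0 : ℝ) 1, ‖Dα (a, x + θ • (x' - x)) - Dα (a, x)‖ ≤ K) →
      ‖f (a, x') - f (a, x) - Dx (a, x) (x' - x) -
        (1 / 2 : ℝ) • Dα (a, x) (B (x' - x) (x' - x))‖ ≤ K * ‖x' - x‖ ^ 2 := by
    intro a x x' K hK
    have h1 := norm_taylor_two_le (g := fun y => f (a, y)) (g' := fun y => Dx (a, y))
      (g'' := fun y => Dxx (a, y)) (B := B) (D := fun y => Dα (a, y)) (x := x) (h := x' - x) hB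
      (fun y => hDα (a, y)) (hDx a) (hDxx a) hK
    simpa only [add_sub_cancel] using h1
  have hone : (1 : ℝ) ∈ Icc (0 : ℝ) 1 := ⟨zero_le_one, le_rfl⟩
  have hzero : (0 : ℝ) ∈ Icc (0 : ℝ) 1 := ⟨le_rfl, zero_le_one⟩
  have hrem : ∀ {a a' : F} {x x' : E} {K : ℝ},
      (∀ θ ∈ Icc (0 : ℝ) 1, ‖Da (a + θ • (a' - a), x') - Da (a, x)‖ ≤ K) →
      (∀ θ ∈ Icc (0 : ℝ) 1, ‖Dα (a, x + θ • (x' - x)) - Dα (a, x)‖ ≤ K) →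
      ‖taylorRemainder B f Da Dx Dα (a, x) (a', x')‖ ≤ K * (‖a' - a‖ + ‖x' - x‖ ^ 2) := by
    intro a a' x x' K h1 h2
    have h3 : taylorRemainder B f Da Dx Dα (a, x) (a', x') =
        (f (a', x') - f (a, x') - Da (a, x) (a' - a)) +
        (f (a, x') - f (a, x) - Dx (a, x) (x' - x) -
          (1 / 2 : ℝ) • Dα (a, x) (B (x' - x) (x' - x))) := by
      simp only [taylorRemainder]; abel
    rw [h3, mul_add]
    exact (norm_add_le _ _).trans (add_le_add (hfa _ h1) (hfx h2))
  refine ⟨3 * N, by positivity, ?_, fun ε hε => ?_⟩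
  · rintro ⟨a, x⟩ ⟨ha, hx⟩ ⟨a', x'⟩ ⟨ha', hx'⟩
    simp only at ha hx ha' hx' ⊢
    have hA : ∀ θ ∈ Icc (0 : ℝ) 1, ‖Da (a + θ • (a' - a), x')‖ ≤ N := fun θ hθ => by
      simpa using hN₁ _ (hmem ha ha' hx hx' θ hθ 1 hone)
    have hX : ∀ θ ∈ Icc (0 : ℝ) 1, ‖Dα (a, x + θ • (x' - x))‖ ≤ N := fun θ hθ => by
      simpa using hN₃ _ (hmem ha ha' hx hx' 0 hzero θ hθ)
    have hX1 : ∀ θ ∈ Icc (0 : ℝ) 1, ‖Dx (a, x + θ • (x' - x))‖ ≤ N := fun θ hθ => by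
      simpa using hN₂ _ (hmem ha ha' hx hx' 0 hzero θ hθ)
    have hA0 : ‖Da (a, x)‖ ≤ N := by simpa using hN₁ _ (hmem ha ha' hx hx' 0 hzero 0 hzero)
    have hX0 : ‖Dα (a, x)‖ ≤ N := by simpa using hX 0 hzero
    have e1 : ‖f (a', x') - f (a, x')‖ ≤ N * ‖a' - a‖ := by
      simpa using hfa (a := a) (a' := a') (x' := x') 0 (K := N) (by simpa using hA)
    have e2 : ‖f (a, x') - f (a, x)‖ ≤ N * ‖x' - x‖ := by
      have h1 := norm_sub_sub_le_of_gateaux (g := fun y => f (a, y)) (g' := fun y => Dx (a, y))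
        (x := x) (h := x' - x) (L := 0) (K := N * ‖x' - x‖) (fun y => hDx a y) fun θ hθ => by
          simpa using (ContinuousLinearMap.le_opNorm _ _).trans
            (mul_le_mul_of_nonneg_right (hX1 θ hθ) (norm_nonneg (x' - x)))
      simpa using h1
    have e3 := hfx (a := a) (x := x) (x' := x') (K := 2 * N) fun θ hθ =>
      (norm_sub_le _ _).trans (by linarith [hX θ hθ])
    have e4 : ‖(1 / 2 : ℝ) • Dα (a, x) (B (x' - x) (x' - x))‖ ≤ N * ‖x' - x‖ ^ 2 := by
      rw [norm_smul]
      have h1 : ‖Dα (a, x) (B (x' - x) (x' - x))‖ ≤ N * ‖x' - x‖ ^ 2 := by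
        refine (ContinuousLinearMap.le_opNorm _ _).trans ?_
        rw [pow_two]
        exact mul_le_mul hX0 (hB _ _) (norm_nonneg _) hN0
      have h2 : ‖(1 / 2 : ℝ)‖ ≤ 1 := by norm_num
      calc _ ≤ 1 * ‖Dα (a, x) (B (x' - x) (x' - x))‖ := by gcongr
        _ ≤ _ := by rw [one_mul]; exact h1
    have p1 : 0 ≤ N * ‖a' - a‖ := by positivity
    have p2 : 0 ≤ N * ‖x' - x‖ := by positivity
    have p3 : 0 ≤ N * ‖x' - x‖ ^ 2 := by positivity
    refine ⟨?_, ?_, ?_⟩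
    · have h1 : f (a', x') - f (a, x) = (f (a', x') - f (a, x')) + (f (a, x') - f (a, x)) := by abel
      rw [h1]
      refine (norm_add_le _ _).trans ?_
      linarith
    · have h1 : f (a', x') - f (a, x) - Dx (a, x) (x' - x) = (f (a', x') - f (a, x')) +
          ((f (a, x') - f (a, x) - Dx (a, x) (x' - x) -
            (1 / 2 : ℝ) • Dα (a, x) (B (x' - x) (x' - x))) +
            (1 / 2 : ℝ) • Dα (a, x) (B (x' - x) (x' - x))) := by abel
      rw [h1]
      refine (norm_add_le _ _).trans ?_
      have h2 := norm_add_le (f (a, x') - f (a, x) - Dx (a, x) (x' - x) -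
            (1 / 2 : ℝ) • Dα (a, x) (B (x' - x) (x' - x)))
            ((1 / 2 : ℝ) • Dα (a, x) (B (x' - x) (x' - x)))
      linarith
    · refine (hrem (K := 2 * N) (fun θ hθ => (norm_sub_le _ _).trans (by linarith [hA θ hθ]))
        fun θ hθ => (norm_sub_le _ _).trans (by linarith [hX θ hθ])).trans ?_
      rw [mul_assoc, mul_assoc]
      linarith
  · obtain ⟨δ₁, hδ₁, h₁⟩ := Metric.uniformContinuousOn_iff.1
      (hS.uniformContinuousOn_of_continuous (hDaK _ hS)) ε hε
    obtain ⟨δ₂, hδ₂, h₂⟩ := Metric.uniformContinuousOn_iff.1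
      (hS.uniformContinuousOn_of_continuous (hDαK _ hS)) ε hε
    refine ⟨min δ₁ δ₂, lt_min hδ₁ hδ₂, ?_⟩
    rintro ⟨a, x⟩ ⟨ha, hx⟩ ⟨a', x'⟩ ⟨ha', hx'⟩ hlt
    simp only at ha hx ha' hx' ⊢
    have hda : ‖a' - a‖ < min δ₁ δ₂ := (norm_fst_le ((a', x') - (a, x))).trans_lt hlt
    have hdx : ‖x' - x‖ < min δ₁ δ₂ := (norm_snd_le ((a', x') - (a, x))).trans_lt hlt
    have h00 : (a, x) ∈ segmentHull KA ×ˢ segmentHull KX :=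
      ⟨subset_segmentHull KA ha, subset_segmentHull KX hx⟩
    refine hrem (fun θ hθ => ?_) fun θ hθ => ?_
    · rw [← dist_eq_norm]
      refine (h₁ _ ⟨mem_segmentHull ha ha' hθ, subset_segmentHull KX hx'⟩ _ h00 ?_).le
      rw [Prod.dist_eq]
      refine max_lt ?_ ?_
      · simp only [dist_self_add_left]
        refine lt_of_le_of_lt ?_ (hda.trans_le (min_le_left _ _))
        rw [norm_smul, Real.norm_of_nonneg hθ.1]
        exact mul_le_of_le_one_left (norm_nonneg _) hθ.2
      · rw [dist_eq_norm]; exact hdx.trans_le (min_le_left _ _)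
    · rw [← dist_eq_norm]
      refine (h₂ _ ⟨subset_segmentHull KA ha, mem_segmentHull hx hx' hθ⟩ _ h00 ?_).le
      rw [Prod.dist_eq]
      refine max_lt ?_ ?_
      · simpa using hδ₂
      · simp only [dist_self_add_left]
        refine lt_of_le_of_lt ?_ (hdx.trans_le (min_le_right _ _))
        rw [norm_smul, Real.norm_of_nonneg hθ.1]
        exact mul_le_of_le_one_left (norm_nonneg _) hθ.2

lemma continuousOnCompacts_of_partial : ContinuousOnCompacts f := by
  intro K hK z hz
  obtain ⟨M, hM0, hM, -⟩ := exists_taylor_bounds hB hDa hDx hDxx hDaK hDxK hDα hDαK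
    (hK.image continuous_fst) (hK.image continuous_snd)
  have hmem : ∀ z ∈ K, z ∈ (Prod.fst '' K) ×ˢ (Prod.snd '' K) := fun z hz =>
    ⟨mem_image_of_mem _ hz, mem_image_of_mem _ hz⟩
  refine tendsto_iff_norm_sub_tendsto_zero.2 ?_
  have h1 : Tendsto (fun z' : F × E => M * (‖z'.1 - z.1‖ + ‖z'.2 - z.2‖)) (𝓝[K] z) (𝓝 0) := by
    have : Continuous fun z' : F × E => M * (‖z'.1 - z.1‖ + ‖z'.2 - z.2‖) := by fun_prop
    have h2 := this.tendsto z
    simp only [sub_self, norm_zero, add_zero, mul_zero] at h2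
    exact h2.mono_left nhdsWithin_le_nhds
  refine squeeze_zero' (Eventually.of_forall fun _ => norm_nonneg _) ?_ h1
  filter_upwards [self_mem_nhdsWithin] with z' hz'
  exact (hM z (hmem z hz) z' (hmem z' hz')).1

end Taylor

/-! ### Sums of small remainders and sums over jumps -/

section JumpLimit

variable {V U : Type*} [NormedAddCommGroup V] {π : ℕ → TimePartition} {Z : ℝ≥0 → V}

lemma ConditionC.finite_bigJumps (hC : ConditionC π Z) (t : ℝ≥0) {ε : ℝ} (hε : 0 < ε) :
    {s | s ∈ Ioc 0 t ∧ ε < ‖jump Z s‖}.Finite := by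
  obtain ⟨N, hN⟩ := hC.c1 t ε hε
  refine Set.Finite.of_injOn (f := (π N).idx) (t := Iio ((π N).cnt t))
    (fun s hs => (π N).idx_lt_cnt hs.1.1 hs.1.2) (fun a ha b hb hab => ?_) (finite_Iio _)
  refine hN N le_rfl ((π N).idx a) ⟨⟨(π N).mem_Ioc_lower_upper ha.1.1, ha.1.2⟩, ha.2⟩
    ⟨⟨?_, hb.1.2⟩, hb.2⟩
  rw [hab]
  exact (π N).mem_Ioc_lower_upper hb.1.1

lemma ConditionC.eventually_injOn_idx (hC : ConditionC π Z) (T : Finset ℝ≥0)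
    (hT : ∀ s ∈ T, 0 < s ∧ jump Z s ≠ 0) : ∀ᶠ n in atTop, InjOn (π n).idx T := by
  have h : ∀ a ∈ T, ∀ b ∈ T, a < b → ∀ᶠ n in atTop, (π n).upper a < b := fun a ha b hb hab =>
    hC.eventually_upper_lt_of_jumps (hT a ha).1 hab (hT a ha).2 (hT b hb).2
  have h2 : ∀ᶠ n in atTop, ∀ a ∈ T, ∀ b ∈ T, a < b → (π n).upper a < b := by
    refine (Filter.eventually_all_finset T).2 fun a ha => (Filter.eventually_all_finset T).2
      fun b hb => ?_
    by_cases hab : a < b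
    · exact (h a ha b hb hab).mono fun n hn _ => hn
    · exact Eventually.of_forall fun n hn => absurd hn hab
  filter_upwards [h2] with n hn
  have h3 : ∀ a ∈ T, ∀ b ∈ T, a < b → (π n).idx a ≠ (π n).idx b := by
    intro a ha b hb hab heq
    have h4 := (π n).le_upper (hT b hb).1
    rw [TimePartition.upper, ← heq] at h4
    exact absurd (hn a ha b hb hab) (not_lt.2 h4)
  intro a ha b hb hab
  by_contra hne
  rcases lt_or_gt_of_ne hne with hlt | hlt
  · exact h3 a ha b hb hlt hab
  · exact h3 b hb a ha hlt hab.symm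

/-- An interval of a partition that contains no jump larger than `ε` contributes a small
increment. -/
lemma TimePartition.norm_incr_le_of_osc_lt (p : TimePartition)
    (hZ : ∀ t, ContinuousWithinAt Z (Ici t) t) {t : ℝ≥0} {ε κ : ℝ} {i : ℕ}
    (hosc : p.osc (fun s => Z s - bigJumps ε Z s) t < ENNReal.ofReal κ) (hi : i < p.cnt t)
    (h : ∀ s ∈ Ioc 0 t, p.idx s = i → ‖jump Z s‖ ≤ ε) :
    ‖Z (min (p.pt (i + 1)) t) - Z (p.pt i)‖ ≤ κ := by
  have hlt : p.pt i < min (p.pt (i + 1)) t :=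
    lt_min (p.strictMono (Nat.lt_succ_self i)) (p.lt_cnt_iff.1 hi)
  have h1 : Tendsto (fun x => ‖Z (min (p.pt (i + 1)) t) - Z x‖) (𝓝[>] (p.pt i))
      (𝓝 ‖Z (min (p.pt (i + 1)) t) - Z (p.pt i)‖) :=
    ((tendsto_const_nhds).sub ((hZ (p.pt i)).mono Ioi_subset_Ici_self).tendsto).norm
  have hne : (𝓝[>] (p.pt i)).NeBot := nhdsGT_neBot_of_exists_gt ⟨_, hlt⟩
  refine le_of_tendsto h1 ?_
  filter_upwards [Ioo_mem_nhdsGT hlt] with x hx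
  refine (p.norm_sub_lt_of_osc_lt hosc hx.2.le (min_le_right _ _) hx.1 (min_le_left _ _)
    fun r hr => ?_).le
  exact h r ⟨(zero_le.trans_lt hr.1), hr.2.trans (min_le_right _ _)⟩
    (p.idx_eq_of_mem ⟨hx.1.trans hr.1, hr.2.trans (min_le_left _ _)⟩)

variable [NormedAddCommGroup U]
  {ψ : V → V → U} {c : V → V → ℝ} {t : ℝ≥0} {M N : ℝ}

lemma ConditionC.tendsto_at_jump {T : Type*} [TopologicalSpace T] {g : V → V → T}
    (hC : ConditionC π Z) (hZ : IsCadlag Z)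
    (hleft : ApproximatesFromLeft π Z)
    (hg : ContinuousOn (fun p : V × V => g p.1 p.2)
      (closure (Z '' Iic t) ×ˢ closure (Z '' Iic t)))
    {s : ℝ≥0} (hs : s ∈ Ioc 0 t) (hj : s = t ∨ IsRegularTime Z s) :
    Tendsto (fun n => g (Z ((π n).lower s)) (Z (min ((π n).upper s) t))) atTop
      (𝓝 (g (Function.leftLim Z s) (Z s))) := by
  have h1 := (hleft s hs.1).prodMk_nhds
    (hC.tendsto_upper hZ.1 (constantWhere_self Z) hs.1 hs.2 hj)
  refine (hg (Function.leftLim Z s, Z s) ⟨hZ.leftLim_mem_closure_image hs.2,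
    mem_closure_image Z hs.2⟩).tendsto.comp (tendsto_nhdsWithin_iff.2 ⟨h1, ?_⟩)
  exact Eventually.of_forall fun n => ⟨mem_closure_image Z (((π n).lower_lt hs.1).le.trans hs.2),
    mem_closure_image Z (min_le_right _ _)⟩

section Weights

variable (hC : ConditionC π Z) (hZ : IsCadlag Z) (hleft : ApproximatesFromLeft π Z)
  (hc : Continuous fun p : V × V => c p.1 p.2) (hc0 : ∀ z z', 0 ≤ c z z') (hcd : ∀ z, c z z = 0)
  (hM : ∀ n, ∑ i ∈ Finset.range ((π n).cnt t),
    c (Z ((π n).pt i)) (Z (min ((π n).pt (i + 1)) t)) ≤ M)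
include hC hZ hleft hc hc0 hcd hM

/-- A bound on the sums of nonnegative weights of the increments along the partitions is inherited
by the weights of the jumps. -/
lemma sum_weight_jump_le (T : Finset ℝ≥0) :
    ∑ s ∈ T, (Ioc 0 t).indicator (fun s => c (Function.leftLim Z s) (Z s)) s ≤ M := by
  classical
  set T' := T.filter fun s => s ∈ Ioc 0 t ∧ jump Z s ≠ 0 with hT'
  have h1 : ∑ s ∈ T, (Ioc 0 t).indicator (fun s => c (Function.leftLim Z s) (Z s)) s =
      ∑ s ∈ T', c (Function.leftLim Z s) (Z s) := by
    rw [hT', Finset.sum_filter]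
    refine Finset.sum_congr rfl fun s _ => ?_
    by_cases hs : s ∈ Ioc 0 t
    · rw [indicator_of_mem hs]
      by_cases hj : jump Z s = 0
      · rw [if_neg fun h => h.2 hj, ← sub_eq_zero.1 hj, hcd]
      · rw [if_pos ⟨hs, hj⟩]
    · rw [indicator_of_notMem hs, if_neg fun h => hs h.1]
  rw [h1]
  have hmem : ∀ s ∈ T', s ∈ Ioc 0 t ∧ jump Z s ≠ 0 := fun s hs => (Finset.mem_filter.1 hs).2
  refine le_of_tendsto (tendsto_finsetSum T' fun s hs =>
    hC.tendsto_at_jump hZ hleft hc.continuousOn (hmem s hs).1 (Or.inr (Or.inl (hmem s hs).2))) ?_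
  filter_upwards [hC.eventually_injOn_idx T' fun s hs => ⟨(hmem s hs).1.1, (hmem s hs).2⟩] with n hn
  calc ∑ s ∈ T', c (Z ((π n).lower s)) (Z (min ((π n).upper s) t))
      = ∑ i ∈ T'.image (π n).idx, c (Z ((π n).pt i)) (Z (min ((π n).pt (i + 1)) t)) :=
        (Finset.sum_image (f := fun i => c (Z ((π n).pt i)) (Z (min ((π n).pt (i + 1)) t))) hn).symm
    _ ≤ ∑ i ∈ Finset.range ((π n).cnt t), c (Z ((π n).pt i)) (Z (min ((π n).pt (i + 1)) t)) := by
        refine Finset.sum_le_sum_of_subset_of_nonneg (fun i hi => ?_) fun _ _ _ => hc0 _ _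
        obtain ⟨s, hs, rfl⟩ := Finset.mem_image.1 hi
        exact Finset.mem_range.2 ((π n).idx_lt_cnt (hmem s hs).1.1 (hmem s hs).1.2)
    _ ≤ M := hM n

lemma summable_weight_jump :
    Summable ((Ioc 0 t).indicator fun s => c (Function.leftLim Z s) (Z s)) :=
  summable_of_sum_le (fun s => indicator_nonneg (fun _ _ => hc0 _ _) s)
    (sum_weight_jump_le hC hZ hleft hc hc0 hcd hM)

lemma summable_norm_jump_comp (hψ : ∀ z ∈ closure (Z '' Iic t), ∀ z' ∈ closure (Z '' Iic t),
    ‖ψ z z'‖ ≤ N * c z z') :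
    Summable ((Ioc 0 t).indicator fun s => ‖ψ (Function.leftLim Z s) (Z s)‖) := by
  refine Summable.of_nonneg_of_le (fun s => indicator_nonneg (fun s _ => norm_nonneg _) s)
    (fun s => ?_) ((summable_weight_jump hC hZ hleft hc hc0 hcd hM).mul_left N)
  by_cases hs : s ∈ Ioc 0 t
  · rw [indicator_of_mem hs, indicator_of_mem hs]
    exact hψ _ (hZ.leftLim_mem_closure_image hs.2) _ (mem_closure_image Z hs.2)
  · rw [indicator_of_notMem hs, indicator_of_notMem hs, mul_zero]

/-- If `ψ z z'` is negligible with respect to the weight `c z z'` as `z' - z → 0`, and the sums of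
the weights along the partitions are bounded, then the sums of `ψ` along the partitions converge to
the sum of `ψ` over the jumps. Only the finitely many intervals that contain a large jump contribute
in the limit. -/
theorem tendsto_sum_jumpSum [CompleteSpace U]
    (hψc : ContinuousOn (fun p : V × V => ψ p.1 p.2)
      (closure (Z '' Iic t) ×ˢ closure (Z '' Iic t)))
    (hψ : ∀ z ∈ closure (Z '' Iic t), ∀ z' ∈ closure (Z '' Iic t), ‖ψ z z'‖ ≤ N * c z z')
    (hψo : ∀ ε : ℝ, 0 < ε → ∃ δ : ℝ, 0 < δ ∧ ∀ z ∈ closure (Z '' Iic t),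
      ∀ z' ∈ closure (Z '' Iic t), ‖z' - z‖ < δ → ‖ψ z z'‖ ≤ ε * c z z') :
    Tendsto (fun n => ∑ i ∈ Finset.range ((π n).cnt t),
        ψ (Z ((π n).pt i)) (Z (min ((π n).pt (i + 1)) t))) atTop
      (𝓝 (jumpSum (fun s => ψ (Function.leftLim Z s) (Z s)) t)) := by
  classical
  set J : ℝ≥0 → U := fun s => ψ (Function.leftLim Z s) (Z s) with hJ
  set cJ : ℝ≥0 → ℝ := fun s => c (Function.leftLim Z s) (Z s) with hcJ
  have hcs : Summable ((Ioc 0 t).indicator cJ) := summable_weight_jump hC hZ hleft hc hc0 hcd hM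
  have hcle : ∑' s, (Ioc 0 t).indicator cJ s ≤ M :=
    hcs.tsum_le_of_sum_le (sum_weight_jump_le hC hZ hleft hc hc0 hcd hM)
  have hJs : Summable ((Ioc 0 t).indicator J) :=
    Summable.of_norm ((summable_norm_jump_comp hC hZ hleft hc hc0 hcd hM hψ).congr fun s =>
      (norm_indicator_eq_indicator_norm J s).symm)
  have hM0 : 0 ≤ M := (Finset.sum_nonneg fun _ _ => hc0 _ _).trans (hM 0)
  refine Metric.tendsto_nhds.2 fun η hη => ?_
  set ε₁ : ℝ := η / (3 * (M + 1)) with hε₁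
  have hε₁0 : 0 < ε₁ := by positivity
  have hε₁M : ε₁ * M ≤ η / 3 := by
    rw [hε₁, div_mul_eq_mul_div, div_le_div_iff₀ (by positivity) (by norm_num)]
    nlinarith
  obtain ⟨δ, hδ, hδψ⟩ := hψo ε₁ hε₁0
  obtain ⟨ε, ⟨hosc, hε0⟩, hεδ⟩ := (((hC.eventually_osc_lt t
    (ENNReal.ofReal_pos.2 (half_pos hδ))).and self_mem_nhdsWithin).and
    (mem_nhdsWithin_of_mem_nhds (Iio_mem_nhds hδ))).exists
  replace hε0 : 0 < ε := hε0
  replace hεδ : ε < δ := hεδ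
  set S : Finset ℝ≥0 := (hC.finite_bigJumps t hε0).toFinset with hS
  have hSmem : ∀ s, s ∈ S ↔ s ∈ Ioc 0 t ∧ ε < ‖jump Z s‖ := fun s => by
    rw [hS, Set.Finite.mem_toFinset, mem_ofPred_eq]
  have hSj : ∀ s ∈ S, s ∈ Ioc 0 t ∧ jump Z s ≠ 0 := fun s hs =>
    ⟨((hSmem s).1 hs).1, norm_pos_iff.1 (hε0.trans ((hSmem s).1 hs).2)⟩
  -- the small jumps
  have htail : ‖jumpSum J t - ∑ s ∈ S, J s‖ ≤ ε₁ * M := by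
    have h1 : jumpSum J t - ∑ s ∈ S, J s =
        ∑' s, ((Ioc 0 t).indicator J s - (S : Set ℝ≥0).indicator J s) := by
      rw [sum_eq_tsum_indicator, jumpSum, hJs.tsum_sub]
      exact (hasSum_sum_of_ne_finset_zero (s := S) fun s hs =>
        indicator_of_notMem (fun h => hs (Finset.mem_coe.1 h)) _).summable
    rw [h1]
    refine (tsum_of_norm_bounded (hcs.mul_left ε₁).hasSum fun s => ?_).trans ?_
    · by_cases hs : s ∈ Ioc 0 t
      · rw [indicator_of_mem hs, indicator_of_mem hs]
        by_cases hsS : s ∈ S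
        · rw [indicator_of_mem (Finset.mem_coe.2 hsS), sub_self, norm_zero]
          exact mul_nonneg hε₁0.le (hc0 _ _)
        · rw [indicator_of_notMem (fun h => hsS (Finset.mem_coe.1 h)), sub_zero]
          refine hδψ _ (hZ.leftLim_mem_closure_image hs.2) _ (mem_closure_image Z hs.2) ?_
          exact lt_of_le_of_lt (not_lt.1 fun h => hsS ((hSmem s).2 ⟨hs, h⟩)) hεδ
      · have hsS : s ∉ S := fun h => hs (hSj s h).1
        rw [indicator_of_notMem hs, indicator_of_notMem hs,
          indicator_of_notMem (fun h => hsS (Finset.mem_coe.1 h))]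
        simp
    · rw [tsum_mul_left]
      gcongr
  -- the large jumps
  have hlim : Tendsto (fun n => ∑ s ∈ S, ψ (Z ((π n).lower s)) (Z (min ((π n).upper s) t))) atTop
      (𝓝 (∑ s ∈ S, J s)) := tendsto_finsetSum S fun s hs =>
    hC.tendsto_at_jump hZ hleft hψc (hSj s hs).1 (Or.inr (Or.inl (hSj s hs).2))
  filter_upwards [Metric.tendsto_nhds.1 hlim (η / 3) (by positivity), hosc,
    hC.eventually_injOn_idx S fun s hs => ⟨(hSj s hs).1.1, (hSj s hs).2⟩] with n hn hoscn hinj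
  set q : ℕ → U := fun i => ψ (Z ((π n).pt i)) (Z (min ((π n).pt (i + 1)) t)) with hq
  have hsub : S.image (π n).idx ⊆ Finset.range ((π n).cnt t) := fun i hi => by
    obtain ⟨s, hs, rfl⟩ := Finset.mem_image.1 hi
    exact Finset.mem_range.2 ((π n).idx_lt_cnt (hSj s hs).1.1 (hSj s hs).1.2)
  have hsplit := Finset.sum_sdiff (f := q) hsub
  have himage : ∑ i ∈ S.image (π n).idx, q i =
      ∑ s ∈ S, ψ (Z ((π n).lower s)) (Z (min ((π n).upper s) t)) := Finset.sum_image hinj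
  -- the intervals without large jumps
  have hrest : ‖∑ i ∈ Finset.range ((π n).cnt t) \ S.image (π n).idx, q i‖ ≤ ε₁ * M := by
    calc ‖∑ i ∈ Finset.range ((π n).cnt t) \ S.image (π n).idx, q i‖
        ≤ ∑ i ∈ Finset.range ((π n).cnt t) \ S.image (π n).idx,
          ε₁ * c (Z ((π n).pt i)) (Z (min ((π n).pt (i + 1)) t)) := by
          refine norm_sum_le_of_le _ fun i hi => ?_
          obtain ⟨hi, hiS⟩ := Finset.mem_sdiff.1 hi
          have hi := Finset.mem_range.1 hi
          refine hδψ _ (mem_closure_image Z ((π n).lt_cnt_iff.1 hi).le) _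
            (mem_closure_image Z (min_le_right _ _)) ?_
          refine ((π n).norm_incr_le_of_osc_lt hZ.1 hoscn hi fun s hs hsi => ?_).trans_lt
            (half_lt_self hδ)
          by_contra hcon
          exact hiS (Finset.mem_image.2 ⟨s, (hSmem s).2 ⟨hs, not_le.1 hcon⟩, hsi⟩)
      _ ≤ ∑ i ∈ Finset.range ((π n).cnt t),
          ε₁ * c (Z ((π n).pt i)) (Z (min ((π n).pt (i + 1)) t)) :=
          Finset.sum_le_sum_of_subset_of_nonneg Finset.sdiff_subset fun _ _ _ =>
            mul_nonneg hε₁0.le (hc0 _ _)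
      _ ≤ ε₁ * M := by
          rw [← Finset.mul_sum]
          exact mul_le_mul_of_nonneg_left (hM n) hε₁0.le
  rw [dist_eq_norm] at hn ⊢
  rw [← hsplit, himage]
  have h1 : ∀ a b d e : U, a + b - d = a + (b - e) - (d - e) := fun a b d e => by abel
  rw [h1 _ _ _ (∑ s ∈ S, J s)]
  have h2 := norm_sub_le (∑ i ∈ Finset.range ((π n).cnt t) \ S.image (π n).idx, q i +
    (∑ s ∈ S, ψ (Z ((π n).lower s)) (Z (min ((π n).upper s) t)) - ∑ s ∈ S, J s))
    (jumpSum J t - ∑ s ∈ S, J s)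
  have h3 := norm_add_le (∑ i ∈ Finset.range ((π n).cnt t) \ S.image (π n).idx, q i)
    (∑ s ∈ S, ψ (Z ((π n).lower s)) (Z (min ((π n).upper s) t)) - ∑ s ∈ S, J s)
  linarith

end Weights

end JumpLimit

/-! ### The Itô–Föllmer formula -/

section Ito

variable {E F G T : Type*} [NormedAddCommGroup E] [NormedSpace ℝ E] [CompleteSpace E]
  [NormedAddCommGroup F] [NormedSpace ℝ F] [CompleteSpace F]
  [NormedAddCommGroup G] [NormedSpace ℝ G] [CompleteSpace G]
  [NormedAddCommGroup T] [NormedSpace ℝ T] [CompleteSpace T]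
  {m : Mode} {π : ℕ → TimePartition} {A : ℝ≥0 → F} {X : ℝ≥0 → E}
  {B : E →L[ℝ] E →L[ℝ] T} {Q : ℝ≥0 → T} {f : F × E → G} {Da : F × E → F →L[ℝ] G}
  {Dx : F × E → E →L[ℝ] G} {Dα : F × E → T →L[ℝ] G}

omit [NormedSpace ℝ F] [CompleteSpace F] [NormedSpace ℝ E] [CompleteSpace E] in
lemma closure_image_prodMk_subset (t : ℝ≥0) : closure ((fun s => (A s, X s)) '' Iic t) ⊆
    closure (A '' Iic t) ×ˢ closure (X '' Iic t) := by
  rw [← closure_prod_eq]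
  refine closure_mono ?_
  rintro _ ⟨s, hs, rfl⟩
  exact ⟨⟨s, hs, rfl⟩, ⟨s, hs, rfl⟩⟩

omit [NormedSpace ℝ F] [CompleteSpace F] [NormedSpace ℝ E] [CompleteSpace E] in
/-- The weights that control the Taylor remainders have bounded sums along the partitions. -/
lemma exists_sum_weight_le (hAV : HasFiniteVariation A) (hX2 : HasFiniteTwoVariation π X)
    (t : ℝ≥0) : ∃ M : ℝ, ∀ n, ∑ i ∈ Finset.range ((π n).cnt t),
      (‖A (min ((π n).pt (i + 1)) t) - A ((π n).pt i)‖ +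
        ‖X (min ((π n).pt (i + 1)) t) - X ((π n).pt i)‖ ^ 2) ≤ M := by
  obtain ⟨M, hM⟩ := hX2 t
  refine ⟨pathVariation A t + M, fun n => ?_⟩
  have h1 : (π n).discreteScalarQV X t ≤ M := hM ⟨n, rfl⟩
  rw [TimePartition.discreteScalarQV_eq_sum] at h1
  refine le_trans (le_of_eq ?_) (add_le_add ((π n).sum_norm_incr_le hAV t ((π n).cnt t)) h1)
  rw [← Finset.sum_add_distrib]
  refine Finset.sum_congr rfl fun i hi => ?_
  rw [(π n).incr_eq (Finset.mem_range.1 hi), (π n).incr_eq (Finset.mem_range.1 hi)]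

omit [CompleteSpace E] [CompleteSpace F] [CompleteSpace G] [CompleteSpace T] in
lemma continuousOn_taylorRemainder (hf : ContinuousOnCompacts f) (hDaK : ContinuousOnCompacts Da)
    (hDxK : ContinuousOnCompacts Dx) (hDαK : ContinuousOnCompacts Dα) {K : Set (F × E)}
    (hK : IsCompact K) : ContinuousOn
      (fun p : (F × E) × (F × E) => taylorRemainder B f Da Dx Dα p.1 p.2) (K ×ˢ K) := by
  have h1 : MapsTo Prod.fst (K ×ˢ K) K := fun p hp => hp.1
  have h2 : MapsTo Prod.snd (K ×ˢ K) K := fun p hp => hp.2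
  have c1 : ContinuousOn (Prod.fst : (F × E) × (F × E) → F × E) (K ×ˢ K) := continuousOn_fst
  have c2 : ContinuousOn (Prod.snd : (F × E) × (F × E) → F × E) (K ×ˢ K) := continuousOn_snd
  have hB : Continuous fun p : E × E => B p.1 p.2 := B.isBoundedBilinearMap.continuous
  have d1 : Continuous fun p : (F × E) × (F × E) => p.2.2 - p.1.2 := by fun_prop
  have d2 : Continuous fun p : (F × E) × (F × E) => p.2.1 - p.1.1 := by fun_prop
  refine ((((hf K hK).comp c2 h2).sub ((hf K hK).comp c1 h1)).sub
    (((hDxK K hK).comp c1 h1).clm_apply d1.continuousOn)).sub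
    (((hDaK K hK).comp c1 h1).clm_apply d2.continuousOn) |>.sub ?_
  exact (((hDαK K hK).comp c1 h1).clm_apply
    (hB.comp (d1.prodMk d1)).continuousOn).const_smul (1 / 2 : ℝ)

omit [NormedSpace ℝ F] [CompleteSpace F] [CompleteSpace E] [CompleteSpace G] in
lemma leftSum_eq_of_constant (p : TimePartition) (H : ℝ≥0 → E →L[ℝ] G) {a b : ℝ≥0} (hab : a ≤ b)
    (h : ∀ s ∈ Icc a b, X s = X a) : p.leftSum H X b = p.leftSum H X a := by
  have h1 : ∀ r, X (min r b) = X (min r a) := by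
    intro r
    rcases le_total r a with hr | hr
    · rw [min_eq_left hr, min_eq_left (hr.trans hab)]
    · rw [min_eq_right hr]
      exact h _ ⟨le_min hr hab, min_le_right _ _⟩
  simp only [TimePartition.leftSum, TimePartition.incr, h1]

/-- The Itô–Föllmer formula: the left Riemann sums converge, and their limit differs from
`f(A, X)` by a path `V` of finite variation, made of the two Stieltjes integrals of the formula and
of the sum of the Taylor remainders at the jumps. -/
theorem exists_ito_correction {Dxx : F × E → E →L[ℝ] E →L[ℝ] G}
    (hB : ∀ v w, ‖B v w‖ ≤ ‖v‖ * ‖w‖)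
    (hA : IsCadlag A) (hAV : HasFiniteVariation A) (hX : IsCadlag X)
    (hC : ConditionC π (fun t => (A t, X t)))
    (hleft : ApproximatesFromLeft π (fun t => (A t, X t)))
    (hX2 : HasFiniteTwoVariation π X) (hQ : IsQuadraticVariation m B π X Q)
    (hDa : ∀ a x, HasGateauxDerivAt (fun b => f (b, x)) (Da (a, x)) a)
    (hDx : ∀ a x, HasGateauxDerivAt (fun y => f (a, y)) (Dx (a, x)) x)
    (hDxx : ∀ a x, HasGateauxDerivAt (fun y => Dx (a, y)) (Dxx (a, x)) x)
    (hDaK : ContinuousOnCompacts Da) (hDxK : ContinuousOnCompacts Dx)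
    (hDα : ∀ p v w, Dα p (B v w) = Dxx p v w) (hDαK : ContinuousOnCompacts Dα) :
    ∃ V : ℝ≥0 → G, IsCadlag V ∧ HasFiniteVariation V ∧
      ConstantWhere (fun t => (A t, X t)) V ∧
      (∀ t, jump V t = jump (fun s => f (A s, X s)) t -
        Dx (Function.leftLim A t, Function.leftLim X t) (jump X t)) ∧
      ∀ t, m.Converges (fun n => (π n).leftSum (fun s => Dx (A s, X s)) X t)
        (f (A t, X t) - f (A 0, X 0) - V t) := by
  set Z : ℝ≥0 → F × E := fun t => (A t, X t) with hZdef
  have hZ : IsCadlag Z := hA.prodMk hX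
  have hf : ContinuousOnCompacts f :=
    continuousOnCompacts_of_partial hB hDa hDx hDxx hDaK hDxK hDα hDαK
  have hZA : ConstantWhere Z A := fun a b hab h => congrArg Prod.fst (h b ⟨hab, le_rfl⟩)
  have hZX : ConstantWhere Z X := fun a b hab h => congrArg Prod.snd (h b ⟨hab, le_rfl⟩)
  have hXleft : ApproximatesFromLeft π X := fun t ht => by
    have h1 := hleft t ht
    rw [leftLim_prodMk hA hX] at h1
    exact h1.snd_nhds
  -- the sum over the jumps
  set ψ := taylorRemainder B f Da Dx Dα with hψ
  set c : F × E → F × E → ℝ := fun z z' => ‖z'.1 - z.1‖ + ‖z'.2 - z.2‖ ^ 2 with hc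
  have hcc : Continuous fun p : (F × E) × (F × E) => c p.1 p.2 := by simp only [hc]; fun_prop
  have hc0 : ∀ z z', 0 ≤ c z z' := fun z z' => by positivity
  have hcd : ∀ z, c z z = 0 := fun z => by simp [hc]
  have htaylor := fun t => exists_taylor_bounds hB hDa hDx hDxx hDaK hDxK hDα hDαK
    (hA.isCompact_closure_image t) (hX.isCompact_closure_image t)
  choose N _ hN hNo using htaylor
  choose M hM using exists_sum_weight_le (A := A) (X := X) hAV hX2
  have hψN : ∀ t, ∀ z ∈ closure (Z '' Iic t), ∀ z' ∈ closure (Z '' Iic t),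
      ‖ψ z z'‖ ≤ N t * c z z' := fun t z hz z' hz' =>
    (hN t z (closure_image_prodMk_subset t hz) z' (closure_image_prodMk_subset t hz')).2.2
  set J : ℝ≥0 → G := fun s => ψ (Function.leftLim Z s) (Z s) with hJdef
  have hJ : ∀ t, Summable ((Ioc 0 t).indicator fun s => ‖J s‖) := fun t =>
    summable_norm_jump_comp (ψ := ψ) (c := c) (N := N t) hC hZ hleft hcc hc0 hcd (hM t) (hψN t)
  have hJlim : ∀ t, Tendsto (fun n => ∑ i ∈ Finset.range ((π n).cnt t),
        ψ (Z ((π n).pt i)) (Z (min ((π n).pt (i + 1)) t))) atTop (𝓝 (jumpSum J t)) := by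
    intro t
    refine tendsto_sum_jumpSum (ψ := ψ) (c := c) (N := N t) hC hZ hleft hcc hc0 hcd (hM t)
      (continuousOn_taylorRemainder hf hDaK hDxK hDαK (hZ.isCompact_closure_image t)) (hψN t)
      fun ε hε => ?_
    obtain ⟨δ, hδ, h⟩ := hNo t ε hε
    exact ⟨δ, hδ, fun z hz z' hz' => h z (closure_image_prodMk_subset t hz) z'
      (closure_image_prodMk_subset t hz')⟩
  -- the two Stieltjes integrals
  have hiA := stieltjesIntegrable_comp_leftLim hZ hleft hDaK hA hAV
  have hiQ := stieltjesIntegrable_comp_leftLim hZ hleft hDαK hQ.cadlag hQ.finiteVariation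
  have hbA := exists_bound_comp_leftLim hZ hDaK
  have hbQ := exists_bound_comp_leftLim hZ hDαK
  have hlA := continuousWithinAt_comp_leftLim hZ hDaK
  have hlQ := continuousWithinAt_comp_leftLim hZ hDαK
  set IA := stieltjesIntegral (fun s => Da (Function.leftLim Z s)) A hAV with hIA
  set IQ := stieltjesIntegral (fun s => Dα (Function.leftLim Z s)) Q hQ.finiteVariation with hIQ
  have cA : IsCadlag IA := isCadlag_stieltjesIntegral hA hAV hiA hbA hlA
  have cQ : IsCadlag IQ := isCadlag_stieltjesIntegral hQ.cadlag hQ.finiteVariation hiQ hbQ hlQ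
  have cJ : IsCadlag (jumpSum J) := isCadlag_jumpSum hJ
  have hconv : ∀ t, m.Converges (fun n => (π n).leftSum (fun s => Dx (A s, X s)) X t)
      (f (A t, X t) - f (A 0, X 0) - (IA t + (1 / 2 : ℝ) • IQ t + jumpSum J t)) := by
    intro t
    have l1 := Mode.Converges.of_tendsto m
      (tendsto_leftSum_of_finiteVariation hZ hC hleft hDaK hA hAV hZA t)
    have l2 := (converges_sum_quadratic hZ hC hleft hDαK hX hZX hXleft hX2 hQ t).map
      ((1 / 2 : ℝ) • ContinuousLinearMap.id ℝ G)
    have l3 := Mode.Converges.of_tendsto m (hJlim t)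
    have l4 := Mode.Converges.of_tendsto m
      (tendsto_const_nhds (x := f (Z t) - f (Z 0)) (f := (atTop : Filter ℕ)))
    refine (l4.sub ((l1.add l2).add l3)).congr fun n => ?_
    have h1 : f (Z t) - f (Z 0) =
        ∑ i ∈ Finset.range ((π n).cnt t), (π n).incr (fun s => f (Z s)) t i := by
      rw [TimePartition.sum_incr, min_eq_right ((π n).le_pt_cnt t)]
    rw [h1, TimePartition.leftSum_eq_sum, map_sum, ← Finset.sum_add_distrib,
      ← Finset.sum_add_distrib, ← Finset.sum_sub_distrib]
    refine Finset.sum_congr rfl fun i hi => ?_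
    have hi := Finset.mem_range.1 hi
    rw [(π n).incr_eq hi, (π n).incr_eq hi, (π n).incr_eq hi]
    simp only [hψ, taylorRemainder, _root_.smul_apply, ContinuousLinearMap.id_apply]
    abel
  refine ⟨fun t => IA t + (1 / 2 : ℝ) • IQ t + jumpSum J t, (cA.add (cQ.const_smul _)).add cJ,
    ((hasFiniteVariation_stieltjesIntegral hA hAV hiA hbA).add
      ((hasFiniteVariation_stieltjesIntegral hQ.cadlag hQ.finiteVariation hiQ hbQ).const_smul
        _)).add (hasFiniteVariation_jumpSum hJ), fun a b hab h => ?_, fun t => ?_, hconv⟩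
  · -- on an interval of constancy neither the Riemann sums nor `f(Z)` move
    have h1 := (hconv b).congr fun n => leftSum_eq_of_constant (π n) (fun s => Dx (A s, X s)) hab
      fun s hs => congrArg Prod.snd (h s hs)
    have h2 := h1.unique (hconv a)
    have h3 : (A b, X b) = (A a, X a) := h b ⟨hab, le_rfl⟩
    rw [h3] at h2
    exact sub_right_injective h2
  · rcases eq_or_ne t 0 with rfl | ht
    · simp [jump_zero]
    rw [jump_add (cA.add (cQ.const_smul _)) cJ, jump_add cA (cQ.const_smul _),
      jump_const_smul cQ, jump_stieltjesIntegral hA hAV hiA t (hlA t),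
      jump_stieltjesIntegral hQ.cadlag hQ.finiteVariation hiQ t (hlQ t),
      jump_jumpSum hJ (pos_iff_ne_zero.2 ht), hQ.jump_eq]
    have h1 : jump (fun s => f (A s, X s)) t = f (Z t) - f (Function.leftLim Z t) := by
      rw [jump]
      exact congrArg _ (hZ.leftLim_comp hf t)
    rw [h1, hJdef, hψ]
    simp only [taylorRemainder, hZdef, leftLim_prodMk hA hX, jump]
    abel

end Ito

/-! ### Uniformly small remainders -/

section UniformlySmall

variable {V U : Type*} [NormedAddCommGroup V] [CompleteSpace V] [NormedAddCommGroup U]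
  {π : ℕ → TimePartition} {Z : ℝ≥0 → V} {g : V → V → U} {t : ℝ≥0}

/-- A continuous function of the two end values of a path over a partition interval is uniformly
small if it vanishes on the diagonal and at the jumps of the path. -/
theorem eventually_forall_norm_le (hZ : IsCadlag Z)
    (hup : ∀ τ ∈ Ioc 0 t, (τ = t ∨ IsRegularTime Z τ) →
      Tendsto (fun n => Z (min ((π n).upper τ) t)) atTop (𝓝 (Z τ)))
    (hg : ContinuousOn (fun p : V × V => g p.1 p.2)
      (closure (Z '' Iic t) ×ˢ closure (Z '' Iic t)))
    (hdiag : ∀ z, g z z = 0) (hjump : ∀ s ∈ Ioc 0 t, g (Function.leftLim Z s) (Z s) = 0)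
    {η : ℝ} (hη : 0 < η) :
    ∀ᶠ n in atTop, ∀ i < (π n).cnt t,
      ‖g (Z ((π n).pt i)) (Z (min ((π n).pt (i + 1)) t))‖ ≤ η := by
  have hK := hZ.isCompact_closure_image t
  obtain ⟨δ, hδ, hδg⟩ := Metric.uniformContinuousOn_iff.1
    ((hK.prod hK).uniformContinuousOn_of_continuous hg) η hη
  have hclose : ∀ z ∈ closure (Z '' Iic t), ∀ z' ∈ closure (Z '' Iic t),
      ∀ w ∈ closure (Z '' Iic t), ∀ w' ∈ closure (Z '' Iic t), ‖z - w‖ < δ → ‖z' - w'‖ < δ →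
      g w w' = 0 → ‖g z z'‖ ≤ η := by
    intro z hz z' hz' w hw w' hw' h1 h2 h0
    have h3 := hδg (z, z') ⟨hz, hz'⟩ (w, w') ⟨hw, hw'⟩
      (by rw [Prod.dist_eq, dist_eq_norm, dist_eq_norm]; exact max_lt h1 h2)
    rw [h0, dist_zero_right] at h3
    exact h3.le
  have key : ∀ τ, Reachable Z (δ / 3) t τ → τ ≤ t ∧ ∀ᶠ n in atTop, ∀ i < (π n).cnt τ,
      ‖g (Z ((π n).pt i)) (Z (min ((π n).pt (i + 1)) t))‖ ≤ η := by
    intro τ hτ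
    induction hτ with
    | zero =>
      refine ⟨zero_le, Eventually.of_forall fun n i hi => ?_⟩
      rw [(π n).cnt_zero] at hi
      exact absurd hi (Nat.not_lt_zero i)
    | @step τ σ _ hτσ hσt hσ hosc ih =>
      have hσ0 : 0 < σ := zero_le.trans_lt hτσ
      refine ⟨hσt, ?_⟩
      filter_upwards [ih.2, Metric.tendsto_nhds.1 (hup σ ⟨hσ0, hσt⟩ hσ) δ hδ] with n hn hnσ
      intro i hi
      rcases lt_or_ge i ((π n).cnt τ) with hiτ | hiτ
      · exact hn i hiτ
      have hr : (π n).pt i ∈ Ico τ σ := ⟨(π n).cnt_le_iff.1 hiτ, (π n).lt_cnt_iff.1 hi⟩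
      have hrt := mem_closure_image Z (hr.2.le.trans hσt)
      rcases lt_or_ge ((π n).pt (i + 1)) σ with hs | hs
      · -- the interval stays within the step
        rw [min_eq_left (hs.le.trans hσt)]
        have hs' : (π n).pt (i + 1) ∈ Ico τ σ :=
          ⟨hr.1.trans ((π n).strictMono.monotone (Nat.le_succ i)), hs⟩
        refine hclose _ hrt _ (mem_closure_image Z (hs.le.trans hσt)) _ hrt _ hrt
          (by simpa using hδ) ?_ (hdiag _)
        have h1 := norm_sub_le (Z ((π n).pt (i + 1)) - Z τ) (Z ((π n).pt i) - Z τ)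
        rw [sub_sub_sub_cancel_right] at h1
        linarith [hosc _ hr, hosc _ hs']
      · -- the interval contains the end of the step
        have hidx : (π n).idx σ = i := (π n).idx_eq_of_mem ⟨hr.2, hs⟩
        refine hclose _ hrt _ (mem_closure_image Z (min_le_right _ _)) _
          (hZ.leftLim_mem_closure_image hσt) _ (mem_closure_image Z hσt) ?_ ?_
          (hjump σ ⟨hσ0, hσt⟩)
        · have h1 := norm_sub_le (Z ((π n).pt i) - Z τ) (Function.leftLim Z σ - Z τ)
          rw [sub_sub_sub_cancel_right] at h1
          linarith [hosc _ hr, norm_leftLim_sub_le hZ hosc ⟨hτσ, le_rfl⟩]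
        · rw [dist_eq_norm, TimePartition.upper, hidx] at hnσ
          exact hnσ
  exact (key t (reachable_self hZ (by positivity) t)).2

end UniformlySmall

section Remainder

variable {V W : Type*} [NormedAddCommGroup V] [NormedSpace ℝ V]
  [NormedAddCommGroup W] [NormedSpace ℝ W]

/-- Perturbing the summands by uniformly small and absolutely summable errors does not change the
limits of quadratic sums. -/
lemma Mode.Converges.quadratic_perturb {m : Mode} (B : V →L[ℝ] V →L[ℝ] W) {k : ℕ → ℕ}
    {x y : ℕ → ℕ → V} {M N : ℝ} {l : W}
    (hx : ∀ n, ∑ i ∈ Finset.range (k n), ‖x n i‖ ^ 2 ≤ M)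
    (hxy : ∀ n, ∑ i ∈ Finset.range (k n), ‖y n i - x n i‖ ≤ N)
    (hsmall : ∀ η : ℝ, 0 < η → ∀ᶠ n in atTop, ∀ i < k n, ‖y n i - x n i‖ ≤ η)
    (h : m.Converges (fun n => ∑ i ∈ Finset.range (k n), B (x n i) (x n i)) l) :
    m.Converges (fun n => ∑ i ∈ Finset.range (k n), B (y n i) (y n i)) l := by
  have hM0 : 0 ≤ M := (Finset.sum_nonneg fun _ _ => by positivity).trans (hx 0)
  have hN0 : 0 ≤ N := (Finset.sum_nonneg fun _ _ => norm_nonneg _).trans (hxy 0)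
  have hdiff : Tendsto (fun n => ∑ i ∈ Finset.range (k n), B (y n i) (y n i) -
      ∑ i ∈ Finset.range (k n), B (x n i) (x n i)) atTop (𝓝 0) := by
    rw [Metric.tendsto_nhds]
    intro ε hε
    set C : ℝ := ‖B‖ * (M + 2 * N) + 1 with hC
    have hC0 : 0 < C := by positivity
    set κ : ℝ := min 1 (ε / (2 * C)) with hκ
    have hκ0 : 0 < κ := lt_min one_pos (by positivity)
    have hκ1 : κ ≤ 1 := min_le_left _ _
    have hκC : κ * C < ε := by
      have h1 : κ * C ≤ ε / (2 * C) * C := by gcongr; exact min_le_right _ _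
      have h2 : ε / (2 * C) * C = ε / 2 := by field_simp
      linarith
    filter_upwards [hsmall (κ ^ 2) (by positivity)] with n hn
    rw [dist_zero_right, ← Finset.sum_sub_distrib]
    refine lt_of_le_of_lt ?_ hκC
    have hterm : ∀ i ∈ Finset.range (k n), ‖B (y n i) (y n i) - B (x n i) (x n i)‖ ≤
        ‖B‖ * κ * ‖x n i‖ ^ 2 + 2 * ‖B‖ * κ * ‖y n i - x n i‖ := by
      intro i hi
      obtain ⟨r, hr⟩ : ∃ r, r = y n i - x n i := ⟨_, rfl⟩
      have hrκ : ‖r‖ ≤ κ ^ 2 := hr ▸ hn i (Finset.mem_range.1 hi)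
      have hy : y n i = x n i + r := by rw [hr]; abel
      have h1 : B (y n i) (y n i) - B (x n i) (x n i) =
          B (x n i) r + B r (x n i) + B r r := by
        rw [hy]; simp only [map_add, _root_.add_apply]; abel
      rw [h1, ← hr]
      have h2 := B.le_opNorm₂ (x n i) r
      have h3 := B.le_opNorm₂ r (x n i)
      have h4 := B.le_opNorm₂ r r
      have h5 := norm_add₃_le (a := B (x n i) r) (b := B r (x n i)) (c := B r r)
      -- by the weighted inequality `2ab ≤ κ a² + b² / κ` and `b ≤ κ²`
      have h6 : 2 * (‖x n i‖ * ‖r‖) ≤ κ * ‖x n i‖ ^ 2 + κ * ‖r‖ := by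
        have h7 : 2 * (κ * ‖x n i‖) * ‖r‖ ≤ (κ * ‖x n i‖) ^ 2 + ‖r‖ ^ 2 :=
          two_mul_le_add_sq _ _
        have h8 : ‖r‖ ^ 2 ≤ κ ^ 2 * ‖r‖ := by
          rw [pow_two]; exact mul_le_mul_of_nonneg_right hrκ (norm_nonneg r)
        refine le_of_mul_le_mul_left ?_ hκ0
        nlinarith
      have h9 : ‖r‖ * ‖r‖ ≤ κ * ‖r‖ := by
        refine mul_le_mul_of_nonneg_right (hrκ.trans ?_) (norm_nonneg r)
        rw [pow_two]; exact mul_le_of_le_one_right hκ0.le hκ1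
      have hB0 := norm_nonneg B
      calc _ ≤ ‖B‖ * (2 * (‖x n i‖ * ‖r‖) + ‖r‖ * ‖r‖) := by linarith
        _ ≤ ‖B‖ * (κ * ‖x n i‖ ^ 2 + κ * ‖r‖ + κ * ‖r‖) := by gcongr
        _ = _ := by ring
    calc _ ≤ ∑ i ∈ Finset.range (k n),
          (‖B‖ * κ * ‖x n i‖ ^ 2 + 2 * ‖B‖ * κ * ‖y n i - x n i‖) := norm_sum_le_of_le _ hterm
      _ = ‖B‖ * κ * ∑ i ∈ Finset.range (k n), ‖x n i‖ ^ 2 +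
          2 * ‖B‖ * κ * ∑ i ∈ Finset.range (k n), ‖y n i - x n i‖ := by
          rw [Finset.sum_add_distrib, Finset.mul_sum, Finset.mul_sum]
      _ ≤ ‖B‖ * κ * M + 2 * ‖B‖ * κ * N := by
          gcongr
          · exact hx n
          · exact hxy n
      _ ≤ κ * C := by rw [hC]; nlinarith
  have h1 := h.add (Mode.Converges.of_tendsto m hdiff)
  rw [add_zero] at h1
  exact h1.congr fun n => by abel

end Remainder

/-! ### Tensor products of operators -/

namespace UniformCrossnorm

variable (α : UniformCrossnorm.{u}) {E F E₂ F₂ : Type u}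
  [NormedAddCommGroup E] [NormedSpace ℝ E] [CompleteSpace E]
  [NormedAddCommGroup F] [NormedSpace ℝ F] [CompleteSpace F]
  [NormedAddCommGroup E₂] [NormedSpace ℝ E₂] [CompleteSpace E₂]
  [NormedAddCommGroup F₂] [NormedSpace ℝ F₂] [CompleteSpace F₂]

lemma norm_tmul_le (x : E) (y : F) : ‖α.tmul x y‖ ≤ ‖x‖ * ‖y‖ := by
  rw [tmul_apply, UniformSpace.Completion.norm_coe]
  exact α.nrm_tmul_le E F x y

lemma map_coe (T : E →L[ℝ] E₂) (S : F →L[ℝ] F₂) (z : α.AlgTensor E F) :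
    α.map T S (z : α.Tensor E F) = ((α.algMap T S z : α.AlgTensor E₂ F₂) : α.Tensor E₂ F₂) :=
  ContinuousLinearMap.completion_apply_coe _ _

lemma map_tmul (T : E →L[ℝ] E₂) (S : F →L[ℝ] F₂) (x : E) (y : F) :
    α.map T S (α.tmul x y) = α.tmul (T x) (S y) := by
  rw [tmul_apply, map_coe, tmul_apply]
  rfl

lemma norm_map_le (T : E →L[ℝ] E₂) (S : F →L[ℝ] F₂) : ‖α.map T S‖ ≤ ‖T‖ * ‖S‖ := by
  refine ContinuousLinearMap.opNorm_le_bound _ (by positivity) fun z => ?_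
  induction z using UniformSpace.Completion.induction_on with
  | hp => exact isClosed_le (by fun_prop) (by fun_prop)
  | ih z =>
    rw [map_coe, UniformSpace.Completion.norm_coe, UniformSpace.Completion.norm_coe]
    exact α.nrm_map_le E F E₂ F₂ T S z

lemma map_ext {L L' : α.Tensor E F →L[ℝ] α.Tensor E₂ F₂}
    (h : ∀ z : α.AlgTensor E F, L (z : α.Tensor E F) = L' z) : L = L' := by
  ext z
  induction z using UniformSpace.Completion.induction_on with
  | hp => exact isClosed_eq (by fun_prop) (by fun_prop)
  | ih z => exact h z

lemma map_add_left (T T' : E →L[ℝ] E₂) (S : F →L[ℝ] F₂) :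
    α.map (T + T') S = α.map T S + α.map T' S := by
  refine α.map_ext fun z => ?_
  rw [_root_.add_apply, map_coe, map_coe, map_coe, ← UniformSpace.Completion.coe_add]
  exact congrArg _ (LinearMap.congr_fun
    (TensorProduct.map_add_left (T : E →ₗ[ℝ] E₂) (T' : E →ₗ[ℝ] E₂) (S : F →ₗ[ℝ] F₂)) z)

lemma map_add_right (T : E →L[ℝ] E₂) (S S' : F →L[ℝ] F₂) :
    α.map T (S + S') = α.map T S + α.map T S' := by
  refine α.map_ext fun z => ?_
  rw [_root_.add_apply, map_coe, map_coe, map_coe, ← UniformSpace.Completion.coe_add]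
  exact congrArg _ (LinearMap.congr_fun
    (TensorProduct.map_add_right (T : E →ₗ[ℝ] E₂) (S : F →ₗ[ℝ] F₂) (S' : F →ₗ[ℝ] F₂)) z)

lemma continuous_map_self : Continuous fun T : E →L[ℝ] E₂ => α.map T T := by
  refine continuous_iff_continuousAt.2 fun T => tendsto_iff_norm_sub_tendsto_zero.2 ?_
  have h1 : Continuous fun T' : E →L[ℝ] E₂ => ‖T' - T‖ * ‖T'‖ + ‖T‖ * ‖T' - T‖ := by fun_prop
  have h2 := h1.tendsto T
  simp only [sub_self, norm_zero, zero_mul, mul_zero, add_zero] at h2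
  refine squeeze_zero (fun _ => norm_nonneg _) (fun T' => ?_) h2
  have h3 : α.map T' T' - α.map T T = α.map (T' - T) T' + α.map T (T' - T) := by
    have h4 := α.map_add_left (T' - T) T T'
    have h5 := α.map_add_right T (T' - T) T
    rw [sub_add_cancel] at h4 h5
    rw [h4, h5]; abel
  rw [h3]
  exact (norm_add_le _ _).trans (add_le_add (α.norm_map_le _ _) (α.norm_map_le _ _))

end UniformCrossnorm

/-! ### The quadratic variation of the Itô–Föllmer integral -/

section IntegralQV

variable {E F G T T' : Type*} [NormedAddCommGroup E] [NormedSpace ℝ E] [CompleteSpace E]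
  [NormedAddCommGroup F] [NormedSpace ℝ F] [CompleteSpace F]
  [NormedAddCommGroup G] [NormedSpace ℝ G] [CompleteSpace G]
  [NormedAddCommGroup T] [NormedSpace ℝ T] [CompleteSpace T]
  [NormedAddCommGroup T'] [NormedSpace ℝ T'] [CompleteSpace T']
  {m : Mode} {π : ℕ → TimePartition} {A : ℝ≥0 → F} {X : ℝ≥0 → E}
  {B : E →L[ℝ] E →L[ℝ] T} {B' : G →L[ℝ] G →L[ℝ] T'} {Q : ℝ≥0 → T} {f : F × E → G}
  {Dx : F × E → E →L[ℝ] G} {Φ : F × E → T →L[ℝ] T'} {V : ℝ≥0 → G}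

omit [NormedSpace ℝ F] [CompleteSpace G] in
lemma jump_integral (hA : IsCadlag A) (hX : IsCadlag X) (hf : ContinuousOnCompacts f)
    (hV : IsCadlag V)
    (hVj : ∀ t, jump V t = jump (fun s => f (A s, X s)) t -
      Dx (Function.leftLim A t, Function.leftLim X t) (jump X t)) (t : ℝ≥0) :
    jump (fun s => f (A s, X s) - f (A 0, X 0) - V s) t =
      Dx (Function.leftLim A t, Function.leftLim X t) (jump X t) := by
  have hfZ : IsCadlag fun s => f (A s, X s) := (hA.prodMk hX).comp hf
  rw [jump_sub (hfZ.sub (isCadlag_const _)) hV, jump_sub hfZ (isCadlag_const _), jump_const, hVj]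
  abel

omit [NormedSpace ℝ F] in
/-- The increments of the integral differ from `D_x f(Z) δX` by remainders that are absolutely
summable, because the correction `V` has finite variation, and uniformly small, because they vanish
at the jumps. -/
theorem eventually_integral_remainder_le (hA : IsCadlag A) (hX : IsCadlag X)
    (hC : ConditionC π (fun t => (A t, X t)))
    (hf : ContinuousOnCompacts f) (hDxK : ContinuousOnCompacts Dx) (hV : IsCadlag V)
    (hVc : ConstantWhere (fun t => (A t, X t)) V)
    (hVj : ∀ t, jump V t = jump (fun s => f (A s, X s)) t -
      Dx (Function.leftLim A t, Function.leftLim X t) (jump X t)) (t : ℝ≥0) {η : ℝ} (hη : 0 < η) :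
    ∀ᶠ n in atTop, ∀ i < (π n).cnt t,
      ‖(π n).incr (fun s => f (A s, X s) - f (A 0, X 0) - V s) t i -
        Dx (A ((π n).pt i), X ((π n).pt i)) ((π n).incr X t i)‖ ≤ η := by
  have hZ : IsCadlag fun t => (A t, X t) := hA.prodMk hX
  have hW : IsCadlag fun t => ((A t, X t), V t) := hZ.prodMk hV
  have hjf : ∀ s, jump (fun s => f (A s, X s)) s =
      f (A s, X s) - f (Function.leftLim A s, Function.leftLim X s) := fun s => by
    rw [jump, hZ.leftLim_comp hf, leftLim_prodMk hA hX]
  have hWc : ConstantWhere (fun t => (A t, X t)) fun t => ((A t, X t), V t) := fun a b hab h =>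
    Prod.ext (h b ⟨hab, le_rfl⟩) (hVc a b hab h)
  have hWj : ∀ s, jump (fun t => ((A t, X t), V t)) s ≠ 0 → jump (fun t => (A t, X t)) s ≠ 0 := by
    intro s hs h0
    refine hs ?_
    rw [jump_prodMk hZ hV, h0, hVj, hjf]
    rw [jump_prodMk hA hX, Prod.mk_eq_zero] at h0
    have h1 : A s = Function.leftLim A s := sub_eq_zero.1 h0.1
    have h2 : X s = Function.leftLim X s := sub_eq_zero.1 h0.2
    rw [h0.2, ← h1, ← h2]
    simp
  set g : (F × E) × G → (F × E) × G → G := fun w w' =>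
    f w'.1 - f w.1 - Dx w.1 (w'.1.2 - w.1.2) - (w'.2 - w.2) with hg
  have hgc : ∀ K : Set ((F × E) × G), IsCompact K →
      ContinuousOn (fun p : ((F × E) × G) × ((F × E) × G) => g p.1 p.2) (K ×ˢ K) := by
    intro K hK
    have hK1 := hK.image continuous_fst
    have h1 : MapsTo (fun p : ((F × E) × G) × ((F × E) × G) => p.1.1) (K ×ˢ K) (Prod.fst '' K) :=
      fun p hp => mem_image_of_mem _ hp.1
    have h2 : MapsTo (fun p : ((F × E) × G) × ((F × E) × G) => p.2.1) (K ×ˢ K) (Prod.fst '' K) :=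
      fun p hp => mem_image_of_mem _ hp.2
    have c1 : Continuous fun p : ((F × E) × G) × ((F × E) × G) => p.1.1 := by fun_prop
    have c2 : Continuous fun p : ((F × E) × G) × ((F × E) × G) => p.2.1 := by fun_prop
    have d1 : Continuous fun p : ((F × E) × G) × ((F × E) × G) => p.2.1.2 - p.1.1.2 := by fun_prop
    have d2 : Continuous fun p : ((F × E) × G) × ((F × E) × G) => p.2.2 - p.1.2 := by fun_prop
    exact ((((hf _ hK1).comp c2.continuousOn h2).sub ((hf _ hK1).comp c1.continuousOn h1)).sub
      (((hDxK _ hK1).comp c1.continuousOn h1).clm_apply d1.continuousOn)).sub d2.continuousOn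
  refine (eventually_forall_norm_le (π := π) (g := g) hW (fun τ hτ hreg => ?_)
    (hgc _ (hW.isCompact_closure_image t)) (fun w => by simp [hg])
    (fun s _ => ?_) hη).mono fun n hn i hi => ?_
  · exact hC.tendsto_upper hW.1 hWc hτ.1 hτ.2
      (hreg.imp_right fun h => h.of_constantWhere hWc (hWj τ))
  · have h1 := hVj s
    rw [hjf, jump, jump] at h1
    rw [leftLim_prodMk hZ hV, leftLim_prodMk hA hX]
    simp only [hg]
    rw [h1, sub_self]
  · refine le_trans (le_of_eq ?_) (hn i hi)
    rw [(π n).incr_eq hi, (π n).incr_eq hi]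
    simp only [hg]
    congr 1
    abel

omit [NormedSpace ℝ F] in
/-- The quadratic variation of the Itô–Föllmer integral `∫ D_x f(Z_-) dX`. The operator
`Φ p` stands for the tensor square of `D_x f(p)`, to which it is tied by `hΦ`. -/
theorem isQuadraticVariation_integral (hA : IsCadlag A) (hAV : HasFiniteVariation A)
    (hX : IsCadlag X) (hC : ConditionC π (fun t => (A t, X t)))
    (hleft : ApproximatesFromLeft π (fun t => (A t, X t)))
    (hX2 : HasFiniteTwoVariation π X) (hQ : IsQuadraticVariation m B π X Q)
    (hf : ContinuousOnCompacts f) (hDxK : ContinuousOnCompacts Dx)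
    (hfD : ∀ t, ∃ N : ℝ, 0 ≤ N ∧ ∀ z ∈ closure (A '' Iic t) ×ˢ closure (X '' Iic t),
      ∀ z' ∈ closure (A '' Iic t) ×ˢ closure (X '' Iic t),
      ‖f z' - f z - Dx z (z'.2 - z.2)‖ ≤ N * (‖z'.1 - z.1‖ + ‖z'.2 - z.2‖ ^ 2))
    (hΦK : ContinuousOnCompacts Φ) (hΦ : ∀ p v w, Φ p (B v w) = B' (Dx p v) (Dx p w))
    (hV : IsCadlag V) (hVV : HasFiniteVariation V)
    (hVc : ConstantWhere (fun t => (A t, X t)) V)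
    (hVj : ∀ t, jump V t = jump (fun s => f (A s, X s)) t -
      Dx (Function.leftLim A t, Function.leftLim X t) (jump X t)) :
    IsQuadraticVariation m B' π (fun t => f (A t, X t) - f (A 0, X 0) - V t)
      (stieltjesIntegral (fun s => Φ (Function.leftLim A s, Function.leftLim X s)) Q
        hQ.finiteVariation) := by
  have hZ : IsCadlag fun t => (A t, X t) := hA.prodMk hX
  have hZX : ConstantWhere (fun t => (A t, X t)) X := fun a b hab h =>
    congrArg Prod.snd (h b ⟨hab, le_rfl⟩)
  have hXleft : ApproximatesFromLeft π X := fun t ht => by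
    have h1 := hleft t ht
    rw [leftLim_prodMk hA hX] at h1
    exact h1.snd_nhds
  have hint := stieltjesIntegrable_comp_leftLim hZ hleft hΦK hQ.cadlag hQ.finiteVariation
  have hb := exists_bound_comp_leftLim hZ hΦK
  have hl := continuousWithinAt_comp_leftLim hZ hΦK
  have hquad := converges_sum_quadratic hZ hC hleft hΦK hX hZX hXleft hX2 hQ
  simp only [leftLim_prodMk hA hX] at hint hb hl hquad
  refine ⟨isCadlag_stieltjesIntegral hQ.cadlag hQ.finiteVariation hint hb hl,
    hasFiniteVariation_stieltjesIntegral hQ.cadlag hQ.finiteVariation hint hb, fun t => ?_,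
    fun t => ?_⟩
  swap
  · rw [jump_stieltjesIntegral hQ.cadlag hQ.finiteVariation hint t (hl t), hQ.jump_eq, hΦ,
      jump_integral hA hX hf hV hVj]
  obtain ⟨L, hL⟩ := exists_bound_comp hZ hDxK t
  have hL0 : 0 ≤ L := (norm_nonneg _).trans (hL _ (mem_closure_image _ le_rfl))
  obtain ⟨M, hM⟩ := hX2 t
  obtain ⟨N, hN0, hN⟩ := hfD t
  obtain ⟨M', hM'⟩ := exists_sum_weight_le hAV hX2 t
  simp only [TimePartition.discreteQV_eq_sum]
  refine Mode.Converges.quadratic_perturb B' (k := fun n => (π n).cnt t) (M := L ^ 2 * M)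
    (N := N * M' + pathVariation V t)
    (x := fun n i => Dx (A ((π n).pt i), X ((π n).pt i)) ((π n).incr X t i)) (fun n => ?_)
    (fun n => ?_) (fun η hη => eventually_integral_remainder_le hA hX hC hf hDxK hV hVc hVj t hη)
    ((hquad t).congr fun n => Finset.sum_congr rfl fun i _ => hΦ _ _ _)
  · have h1 : (π n).discreteScalarQV X t ≤ M := hM ⟨n, rfl⟩
    rw [TimePartition.discreteScalarQV_eq_sum] at h1
    refine le_trans ?_ (mul_le_mul_of_nonneg_left h1 (sq_nonneg L))
    rw [Finset.mul_sum]
    refine Finset.sum_le_sum fun i hi => ?_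
    rw [← mul_pow]
    refine pow_le_pow_left₀ (norm_nonneg _) ((ContinuousLinearMap.le_opNorm _ _).trans ?_) 2
    gcongr
    exact hL _ (mem_closure_image (fun t => (A t, X t))
      ((π n).lt_cnt_iff.1 (Finset.mem_range.1 hi)).le)
  · refine le_trans ?_ (add_le_add (mul_le_mul_of_nonneg_left (hM' n) hN0)
      ((π n).sum_norm_incr_le hVV t ((π n).cnt t)))
    rw [Finset.mul_sum, ← Finset.sum_add_distrib]
    refine Finset.sum_le_sum fun i hi => ?_
    have hi := Finset.mem_range.1 hi
    have h1 := hN (A ((π n).pt i), X ((π n).pt i))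
      ⟨mem_closure_image A ((π n).lt_cnt_iff.1 hi).le,
        mem_closure_image X ((π n).lt_cnt_iff.1 hi).le⟩
      (A (min ((π n).pt (i + 1)) t), X (min ((π n).pt (i + 1)) t))
      ⟨mem_closure_image A (min_le_right _ _), mem_closure_image X (min_le_right _ _)⟩
    refine le_trans ?_ (add_le_add h1 le_rfl)
    refine le_trans (le_of_eq ?_) (norm_sub_le _ _)
    rw [(π n).incr_eq hi, (π n).incr_eq hi, (π n).incr_eq hi]
    congr 1
    abel

end IntegralQV

end ItoFollmer

end

open ItoFollmer
theorem mainTheorem5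
    {E G : Type u} {F : Type v}
    [NormedAddCommGroup E] [NormedSpace ℝ E] [CompleteSpace E]
    [NormedAddCommGroup G] [NormedSpace ℝ G] [CompleteSpace G]
    [NormedAddCommGroup F] [NormedSpace ℝ F] [CompleteSpace F]
    (α : UniformCrossnorm.{u}) (m : Mode) (π : ℕ → TimePartition)
    -- the paths and the sequence of partitions
    (A : ℝ≥0 → F) (X : ℝ≥0 → E)
    (hA : IsCadlag A) (hAV : HasFiniteVariation A) (hX : IsCadlag X)
    (hC : ConditionC π (fun t => (A t, X t)))
    (hleft : ApproximatesFromLeft π (fun t => (A t, X t)))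
    (hX2 : HasFiniteTwoVariation π X)
    -- the strong or weak `α`-tensor quadratic variation of `X`
    (Q : ℝ≥0 → α.Tensor E E) (hQ : IsQuadraticVariation m α.tmul π X Q)
    -- the function and its Gâteaux derivatives
    (f : F × E → G)
    (Da : F × E → F →L[ℝ] G) (Dx : F × E → E →L[ℝ] G) (Dxx : F × E → E →L[ℝ] E →L[ℝ] G)
    (Dα : F × E → α.Tensor E E →L[ℝ] G)
    (hDa : ∀ a x, HasGateauxDerivAt (fun b => f (b, x)) (Da (a, x)) a)
    (hDx : ∀ a x, HasGateauxDerivAt (fun y => f (a, y)) (Dx (a, x)) x)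
    (hDxx : ∀ a x, HasGateauxDerivAt (fun y => Dx (a, y)) (Dxx (a, x)) x)
    (hDaK : ContinuousOnCompacts Da) (hDxK : ContinuousOnCompacts Dx)
    (hDα : ∀ p v w, Dα p (α.tmul v w) = Dxx p v w) (hDαK : ContinuousOnCompacts Dα) :
    ∃ Y C D : ℝ≥0 → G,
      (∀ t, f (A t, X t) = Y t + C t + D t) ∧
      -- `Y` is the Itô–Föllmer integral of `D_x f(A_{s-}, X_{s-})` with respect to `X`
      (∀ t, m.Converges (fun n => (π n).leftSum (fun s => Dx (A s, X s)) X t) (Y t)) ∧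
      IsCadlag Y ∧
      -- its `α`-tensor quadratic variation
      (∀ t, StieltjesIntegrable
        (fun s => α.map (Dx (Function.leftLim A s, Function.leftLim X s))
          (Dx (Function.leftLim A s, Function.leftLim X s))) Q hQ.finiteVariation t) ∧
      IsQuadraticVariation m α.tmul π Y
        (stieltjesIntegral
          (fun s => α.map (Dx (Function.leftLim A s, Function.leftLim X s))
            (Dx (Function.leftLim A s, Function.leftLim X s))) Q hQ.finiteVariation) ∧
      -- the continuous and the purely discontinuous part of finite variation
      Continuous C ∧ HasFiniteVariation C ∧
      IsPurelyDiscontinuous D ∧ HasFiniteVariation D := by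
  have hZ : IsCadlag fun t => (A t, X t) := hA.prodMk hX
  have hB := α.norm_tmul_le (E := E) (F := E)
  have hf : ContinuousOnCompacts f :=
    continuousOnCompacts_of_partial hB hDa hDx hDxx hDaK hDxK hDα hDαK
  have hΦK : ContinuousOnCompacts fun p => α.map (Dx p) (Dx p) := fun K hK =>
    α.continuous_map_self.comp_continuousOn (hDxK K hK)
  obtain ⟨V, hV, hVV, hVc, hVj, hVconv⟩ := exists_ito_correction hB hA hAV hX hC hleft hX2 hQ
    hDa hDx hDxx hDaK hDxK hDα hDαK
  obtain ⟨C, D, hCD, hCc, hCV, hD, hDV⟩ := hVV.exists_continuous_add_purelyDiscontinuous hV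
  refine ⟨fun t => f (A t, X t) - f (A 0, X 0) - V t, fun t => f (A 0, X 0) + C t, D, fun t => ?_,
    hVconv, ((hZ.comp hf).sub (isCadlag_const _)).sub hV, fun t => ?_, ?_,
    continuous_const.add hCc, (hasFiniteVariation_const _).add hCV, hD, hDV⟩
  · simp only [hCD t]; abel
  · have h1 := stieltjesIntegrable_comp_leftLim hZ hleft hΦK hQ.cadlag hQ.finiteVariation t
    simpa only [leftLim_prodMk hA hX] using h1
  · refine isQuadraticVariation_integral (Φ := fun p => α.map (Dx p) (Dx p)) hA hAV hX hC hleft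
      hX2 hQ hf hDxK (fun t => ?_) hΦK (fun p v w => α.map_tmul _ _ v w) hV hVV hVc hVj
    obtain ⟨N, hN0, hN, -⟩ := exists_taylor_bounds hB hDa hDx hDxx hDaK hDxK hDα hDαK
      (hA.isCompact_closure_image t) (hX.isCompact_closure_image t)
    exact ⟨N, hN0, fun z hz z' hz' => (hN z hz z' hz').2.1⟩
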